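/- Let $d\ge 3$, and let $\overline B(c_n,r_n)$, $n\ge 1$, be a sequence of non-overlapping closed balls in $\mathbb R^d$ (i.e. with pairwise disjoint interiors), none of which contains the origin. Suppose that the balls are regularly located, that is: (i) there is $\epsilon>0$ such that $|c_n-c_m|\ge 2\epsilon$ for all $n\ne m$; (ii) there is $R>0$ such that every ball $B(x,R)$, $x\in\mathbb R^d$, contains at least one of the centres $c_n$; (iii) $r_n=\phi(|c_n|)$ for all $n$, where $\phi:(0,\infty)\to(0,\infty)$ is a decreasing (not necessarily strictly decreasing) function. Then the collection of balls is avoidable, meaning that Brownian motion in $\mathbb R^d$ started at $0$ has a positive probability of never hitting any of the balls $\overline B(c_n,r_n)$, if and only if $$\int_1^\infty r\,\phi(r)^{d-2}\,dr<\infty .$$ -/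

import Mathlib

open MeasureTheory ProbabilityTheory
open scoped NNReal

namespace BallConfig

/-- Standard Brownian motion in `ℝ^d` started at the origin, on the probability space `(Ω, P)`:
the coordinate processes are independent standard one-dimensional Brownian motions
(with almost surely continuous paths). -/
structure IsBrownianMotion {d : ℕ} {Ω : Type*} [MeasurableSpace Ω]
    (B : ℝ≥0 → Ω → EuclideanSpace ℝ (Fin d)) (P : Measure Ω) : Prop where
  coord : ∀ i : Fin d, IsBrownianReal (fun t ω => B t ω i) P
  indep : iIndepFun (fun (i : Fin d) (ω : Ω) (t : ℝ≥0) => B t ω i) P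

/-- The closed balls with centres `c n` and radii `r n` are avoidable for the process `B`: with
positive probability `B` never hits any of them. -/
def Avoidable {d : ℕ} {Ω : Type*} [MeasurableSpace Ω]
    (B : ℝ≥0 → Ω → EuclideanSpace ℝ (Fin d)) (P : Measure Ω)
    (c : ℕ → EuclideanSpace ℝ (Fin d)) (r : ℕ → ℝ) : Prop :=
  0 < P {ω | ∀ (t : ℝ≥0) (n : ℕ), B t ω ∉ Metric.closedBall (c n) (r n)}

/-- The balls with centres `c n` and radii `r n` are regularly located, with radius function
`φ` on `(0, ∞)`. -/
structure RegularlyLocated {d : ℕ} (c : ℕ → EuclideanSpace ℝ (Fin d)) (r : ℕ → ℝ)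
    (φ : ℝ → ℝ) : Prop where
  separated : ∃ ε : ℝ, 0 < ε ∧ ∀ n m : ℕ, n ≠ m → 2 * ε ≤ dist (c n) (c m)
  uniformlyDense : ∃ R : ℝ, 0 < R ∧ ∀ x, ∃ n : ℕ, c n ∈ Metric.ball x R
  radius_eq : ∀ n : ℕ, r n = φ ‖c n‖
  radius_antitone : AntitoneOn φ (Set.Ioi 0)
  radius_pos : ∀ s : ℝ, 0 < s → 0 < φ s

/-- The balls do not overlap: their interiors are pairwise disjoint. -/
def NonOverlapping {d : ℕ} (c : ℕ → EuclideanSpace ℝ (Fin d)) (r : ℕ → ℝ) : Prop :=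
  ∀ n m : ℕ, n ≠ m → Disjoint (Metric.ball (c n) (r n)) (Metric.ball (c m) (r m))

end BallConfig

/-! Everything rests on one fact about transience: in dimension at least three, the expected time
that Brownian motion from `x` spends in a ball of radius `ρ` centred at `c` is of order `ρ ^ 2 * (ρ
/ dist x c) ^ (d - 2)` when `x` is outside the ball, and of order `ρ ^ 2` when `x` is inside it.
Dividing the first by the second bounds the probability of ever visiting the ball by a multiple of
`(ρ / dist x c) ^ (d - 2)`. Since the centres are separated and relatively dense, the sum of `(φ ‖c
n‖ / ‖c n‖) ^ (d - 2)` over the centres off the origin converges or diverges together with the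
integral.

Convergent case. Far from the origin, and at a fixed distance from all centres, the visiting
probabilities add up to at most one half (`eventually_sum_le`, `exists_forall_isSafe`), so the balls
are avoided from such a point. It remains to get there from the origin. A polygonal path in the
complement of the balls does it (`exists_polygonallyJoined_far`), and Brownian motion follows each
segment with positive probability (`exists_measure_tube_pos`, `IsSafe.of_segment_subset`). Such a
path exists because a bounded polygonal component would have a farthest limit point `p`.
Non-overlapping balls through `p` share a normal line there, and in dimension at least three one can
leave `p` orthogonally both to that line and to `p` itself, which increases the norm.

Divergent case. Put on small concentric balls the function equal to `(ρ n ^ 2)⁻¹` on the `n`-th one,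
for the centres of norm between 1 and `M`. If `S` is the sum of the relative capacities of these
balls seen from the origin, the potential of this function is at most a multiple of `1 + S` on its
own support (`exists_energy_bound`) and, once `M` is large depending on `x`, at least a multiple of
`1 + S` at `x`. The second moment method (`potential_le_mul_measure_visit`) then bounds the
probability of a visit from below by a constant that does not depend on `x`. By the Markov property
at large times, a set visited with probability bounded below from everywhere is visited almost
surely (`measure_forall_notMem_eq_zero`). -/

namespace BallConfig

/-- A Brownian motion from the origin, every coordinate map of which is measurable and every path
of which is continuous and starts at the origin. -/
structure IsRegularBrownianMotion {d : ℕ} {Ω : Type*} [MeasurableSpace Ω]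
    (W : ℝ≥0 → Ω → EuclideanSpace ℝ (Fin d)) (P : Measure Ω) : Prop
    extends IsBrownianMotion W P where
  measurable : ∀ t, Measurable (W t)
  continuous : ∀ ω, Continuous (W · ω)
  start : ∀ ω, W 0 ω = 0

/-! ### Measurable version with continuous paths -/

section Version

variable {d : ℕ} {Ω : Type*} [MeasurableSpace Ω] {P : Measure Ω}
  {B : ℝ≥0 → Ω → EuclideanSpace ℝ (Fin d)}

lemma IsBrownianMotion.aemeasurable (hB : IsBrownianMotion B P) (t : ℝ≥0) :
    AEMeasurable (B t) P := by
  have h : AEMeasurable (fun ω (i : Fin d) => B t ω i) P :=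
    aemeasurable_pi_lambda _ fun i => (hB.coord i).aemeasurable t
  exact (MeasurableEquiv.toLp 2 (Fin d → ℝ)).measurable.comp_aemeasurable h

lemma IsBrownianMotion.ae_regular (hB : IsBrownianMotion B P) :
    ∀ᵐ ω ∂P, Continuous (B · ω) ∧ B 0 ω = 0 ∧
      ∀ k, B (TopologicalSpace.denseSeq ℝ≥0 k) ω =
        (hB.aemeasurable (TopologicalSpace.denseSeq ℝ≥0 k)).mk _ ω := by
  have h1 : ∀ᵐ ω ∂P, ∀ i : Fin d, Continuous (fun t => B t ω i) :=
    ae_all_iff.2 fun i => (hB.coord i).cont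
  have h2 : ∀ᵐ ω ∂P, ∀ i : Fin d, B 0 ω i = 0 :=
    ae_all_iff.2 fun i => (hB.coord i).eval_zero_ae_eq_zero
  have h3 : ∀ᵐ ω ∂P, ∀ k, B (TopologicalSpace.denseSeq ℝ≥0 k) ω =
        (hB.aemeasurable (TopologicalSpace.denseSeq ℝ≥0 k)).mk _ ω :=
    ae_all_iff.2 fun k => (hB.aemeasurable _).ae_eq_mk
  filter_upwards [h1, h2, h3] with ω h1 h2 h3
  refine ⟨?_, ?_, h3⟩
  · exact (PiLp.continuous_toLp 2 (fun _ : Fin d => ℝ)).comp (continuous_pi h1)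
  · ext i; simpa using h2 i

/-- Every Brownian motion is indistinguishable from a regular one. -/
lemma IsBrownianMotion.exists_regular (hB : IsBrownianMotion B P) :
    ∃ W : ℝ≥0 → Ω → EuclideanSpace ℝ (Fin d), IsRegularBrownianMotion W P ∧
      ∀ᵐ ω ∂P, ∀ t, W t ω = B t ω := by
  classical
  obtain ⟨N, hN, hNm, hN0⟩ := exists_measurable_superset_of_null (ae_iff.1 hB.ae_regular)
  have hreg : ∀ ω ∉ N, Continuous (B · ω) ∧ B 0 ω = 0 ∧
      ∀ k, B (TopologicalSpace.denseSeq ℝ≥0 k) ω =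
        (hB.aemeasurable (TopologicalSpace.denseSeq ℝ≥0 k)).mk _ ω := by
    intro ω hω
    by_contra h
    exact hω (hN h)
  let W : ℝ≥0 → Ω → EuclideanSpace ℝ (Fin d) := fun t ω => if ω ∈ N then 0 else B t ω
  have hWB : ∀ᵐ ω ∂P, ∀ t, W t ω = B t ω := by
    have : ∀ᵐ ω ∂P, ω ∉ N := measure_eq_zero_iff_ae_notMem.1 hN0
    filter_upwards [this] with ω hω t
    simp [W, hω]
  refine ⟨W, ⟨⟨fun i => ⟨?_, ?_⟩, ?_⟩, ?_, ?_, ?_⟩, hWB⟩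
  · refine (hB.coord i).toIsPreBrownianReal.congr fun t => ?_
    filter_upwards [hWB] with ω h
    rw [h t]
  · filter_upwards [hWB, (hB.coord i).cont] with ω h h'
    simpa [h] using h'
  · refine (iIndepFun_congr fun i => ?_).1 hB.indep
    filter_upwards [hWB] with ω h
    ext t
    rw [h t]
  · intro t
    -- Dense times converge to `t`; off `N` the path is continuous and agrees at those times with
    -- measurable representatives, so `W t` is a pointwise limit of measurable maps.
    obtain ⟨s, hs, hst⟩ := mem_closure_iff_seq_limit.1
      ((TopologicalSpace.denseRange_denseSeq ℝ≥0) t)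
    choose k hk using hs
    refine measurable_of_tendsto_metrizable (f := fun j ω => if ω ∈ N then 0 else
      (hB.aemeasurable (TopologicalSpace.denseSeq ℝ≥0 (k j))).mk _ ω) (fun j => ?_) ?_
    · exact Measurable.ite hNm measurable_const (AEMeasurable.measurable_mk _)
    · rw [tendsto_pi_nhds]
      intro ω
      by_cases hω : ω ∈ N
      · simp [W, hω]
      · simp only [W, hω, if_false, ← (hreg ω hω).2.2]
        simp_rw [hk]
        exact ((hreg ω hω).1.tendsto t).comp hst
  · intro ω
    by_cases hω : ω ∈ N
    · simpa [W, hω] using continuous_const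
    · simpa [W, hω] using (hreg ω hω).1
  · intro ω
    by_cases hω : ω ∈ N
    · simp [W, hω]
    · simpa [W, hω] using (hreg ω hω).2.1

end Version

/-! ### Joint Gaussianity, the Markov property and the Brownian bridge -/

section Gaussian

variable {d : ℕ} {Ω : Type*} [MeasurableSpace Ω] {P : Measure Ω}
  {W : ℝ≥0 → Ω → EuclideanSpace ℝ (Fin d)}

/-- Each coordinate is Gaussian on any finite set of times, and independent Gaussian vectors are
jointly Gaussian. All coordinates are taken on the common time set `J`, from which the required
entries are a linear projection. -/
lemma IsBrownianMotion.isGaussianProcess (hW : IsBrownianMotion W P) :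
    IsGaussianProcess (fun (p : Fin d × ℝ≥0) ω => W p.2 ω p.1) P where
  hasGaussianLaw I := by
    classical
    let J : Finset ℝ≥0 := I.image Prod.snd
    have h := iIndepFun.hasGaussianLaw (X := fun (i : Fin d) ω => J.restrict (fun t => W t ω i))
      (fun i =>
        (IsPreBrownianReal.isGaussianProcess (hW.coord i).toIsPreBrownianReal).hasGaussianLaw J)
      (hW.indep.comp (fun _ => J.restrict) fun _ => Finset.measurable_restrict J)
    let L : (Fin d → J → ℝ) →L[ℝ] (I → ℝ) := ContinuousLinearMap.pi fun p =>
      (ContinuousLinearMap.proj (R := ℝ) (φ := fun _ : J => ℝ)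
        ⟨p.1.2, Finset.mem_image_of_mem _ p.2⟩).comp
          (ContinuousLinearMap.proj (R := ℝ) (φ := fun _ : Fin d => J → ℝ) p.1.1)
    exact h.map L

lemma IsBrownianMotion.memLp_two (hW : IsBrownianMotion W P) (i : Fin d) (s : ℝ≥0) :
    MemLp (fun ω => W s ω i) 2 P :=
  ((IsPreBrownianReal.isGaussianProcess (hW.coord i).toIsPreBrownianReal).hasGaussianLaw_eval
    s).memLp_two

lemma IsBrownianMotion.covariance (hW : IsBrownianMotion W P) (i j : Fin d) (s t : ℝ≥0) :
    cov[fun ω => W s ω i, fun ω => W t ω j; P] = if i = j then ((min s t : ℝ≥0) : ℝ) else 0 := by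
  split_ifs with h
  · subst h
    exact (hW.coord i).covariance_fun_eval s t
  · have hi := (hW.indep.indepFun h).comp (measurable_pi_apply s) (measurable_pi_apply t)
    exact hi.covariance_eq_zero (hW.memLp_two i s) (hW.memLp_two j t)

lemma IsRegularBrownianMotion.shift (hW : IsRegularBrownianMotion W P) (T : ℝ≥0) :
    IsRegularBrownianMotion (fun t ω => W (T + t) ω - W T ω) P where
  coord i := (hW.coord i).shift T
  indep := hW.indep.comp (fun _ f t => f (T + t) - f T) fun _ => by fun_prop
  measurable t := (hW.measurable _).sub (hW.measurable _)
  continuous ω := by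
    have := hW.continuous ω
    fun_prop
  start ω := by simp

variable [IsProbabilityMeasure P]

/-- Two families of linear combinations of the coordinates of Brownian motion are independent as
soon as they are uncorrelated. -/
lemma IsBrownianMotion.indepFun_of_covariance (hW : IsBrownianMotion W P) {S T : Type*}
    (a : S → ℝ≥0 × ℝ≥0 × ℝ) (b : T → ℝ≥0 × ℝ≥0 × ℝ)
    (h : ∀ s t, (min (a s).1 (b t).1 : ℝ≥0) - (b t).2.2 * (min (a s).1 (b t).2.1 : ℝ≥0)
      - (a s).2.2 * ((min (a s).2.1 (b t).1 : ℝ≥0) - (b t).2.2 * (min (a s).2.1 (b t).2.1 : ℝ≥0))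
      = (0 : ℝ)) :
    IndepFun (fun ω s => W (a s).1 ω - (a s).2.2 • W (a s).2.1 ω)
      (fun ω t => W (b t).1 ω - (b t).2.2 • W (b t).2.1 ω) P := by
  classical
  have hm : ∀ i t, AEMeasurable (fun ω => W t ω i) P := fun i t => (hW.coord i).aemeasurable t
  -- Within a jointly Gaussian family uncorrelated means independent. Distinct coordinates are
  -- uncorrelated anyway; `h` is the bilinear expansion of the covariance on one coordinate.
  have key := IsGaussianProcess.indepFun_of_covariance_eq_zero (P := P)
    (X := fun (p : Fin d × S) ω => W (a p.2).1 ω p.1 - (a p.2).2.2 * W (a p.2).2.1 ω p.1)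
    (Y := fun (p : Fin d × T) ω => W (b p.2).1 ω p.1 - (b p.2).2.2 * W (b p.2).2.1 ω p.1)
    ?_ (fun p => (hm _ _).sub ((hm _ _).const_mul _)) (fun p => (hm _ _).sub ((hm _ _).const_mul _))
    ?_
  · have mS : Measurable (fun (f : Fin d × S → ℝ) (s : S) =>
        (WithLp.toLp 2 (fun i => f (i, s)) : EuclideanSpace ℝ (Fin d))) := by fun_prop
    have mT : Measurable (fun (f : Fin d × T → ℝ) (s : T) =>
        (WithLp.toLp 2 (fun i => f (i, s)) : EuclideanSpace ℝ (Fin d))) := by fun_prop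
    exact key.comp mS mT
  · refine hW.isGaussianProcess.of_isGaussianProcess ?_
    have aux : ∀ (i : Fin d) (u v : ℝ≥0) (c : ℝ), ∃ (I : Finset (Fin d × ℝ≥0))
        (L : (I → ℝ) →L[ℝ] ℝ), ∀ ω, W u ω i - c * W v ω i =
          L (I.restrict (fun p : Fin d × ℝ≥0 => W p.2 ω p.1)) := by
      intro i u v c
      refine ⟨{(i, u), (i, v)}, ContinuousLinearMap.proj ⟨(i, u), by simp⟩ -
        c • ContinuousLinearMap.proj ⟨(i, v), by simp⟩, fun ω => ?_⟩
      simp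
    rintro (p | p)
    · exact aux _ _ _ _
    · exact aux _ _ _ _
  · intro p q
    have m := hW.memLp_two
    have m' : ∀ i s (c : ℝ), MemLp (fun ω => c * W s ω i) 2 P := fun i s c => (m i s).const_mul c
    have e : (fun ω => W (b q.2).1 ω q.1 - (b q.2).2.2 * W (b q.2).2.1 ω q.1) =
        (fun ω => W (b q.2).1 ω q.1) - fun ω => (b q.2).2.2 * W (b q.2).2.1 ω q.1 := rfl
    rw [covariance_fun_sub_left (m _ _) (m' _ _ _) (e ▸ (m _ _).sub (m' _ _ _)),
      covariance_fun_sub_right (m _ _) (m _ _) (m' _ _ _),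
      covariance_fun_sub_right (m' _ _ _) (m _ _) (m' _ _ _)]
    simp only [covariance_const_mul_left, covariance_const_mul_right, hW.covariance]
    split_ifs
    · linear_combination h p.2 q.2
    · simp

/-- The Markov property: the increments after time `T` are independent of the past of `T`. -/
lemma IsBrownianMotion.indepFun_increments (hW : IsBrownianMotion W P) (T : ℝ≥0) :
    IndepFun (fun ω (s : Set.Iic T) => W s ω) (fun ω (t : ℝ≥0) => W (T + t) ω - W T ω) P := by
  have := hW.indepFun_of_covariance (S := Set.Iic T) (T := ℝ≥0) (fun s => (s, 0, 0))
    (fun t => (T + t, T, 1)) ?_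
  · simpa using this
  · intro s t
    have hs : (s : ℝ≥0) ≤ T := s.2
    simp [-NNReal.coe_min, min_eq_left hs, min_eq_left (hs.trans (le_add_right le_rfl : T ≤ T + t))]

/-- The Brownian bridge on `[0, T]` is independent of the endpoint at time `T`. -/
lemma IsBrownianMotion.indepFun_bridge (hW : IsBrownianMotion W P) {T : ℝ≥0} (hT : 0 < T) :
    IndepFun (fun ω (s : Set.Iic T) => W s ω - ((s : ℝ) / T) • W T ω) (W T) P := by
  have := hW.indepFun_of_covariance (S := Set.Iic T) (T := Unit) (fun s => (s, T, (s : ℝ) / T))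
    (fun _ => (T, 0, 0)) ?_
  · have := this.comp measurable_id (measurable_pi_apply ())
    simpa [Function.comp_def] using this
  · intro s t
    have : (T : ℝ) ≠ 0 := by exact_mod_cast hT.ne'
    have hs : (s : ℝ≥0) ≤ T := s.2
    simp [-NNReal.coe_min, min_eq_left hs]
    field_simp
    simp

/-- The Markov property, in integrated form. -/
lemma IsRegularBrownianMotion.lintegral_markov (hW : IsRegularBrownianMotion W P) (T : ℝ≥0)
    {g : (Set.Iic T → EuclideanSpace ℝ (Fin d)) × (ℝ≥0 → EuclideanSpace ℝ (Fin d)) → ENNReal}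
    (hg : Measurable g) :
    ∫⁻ ω, g (fun s => W s ω, fun t => W (T + t) ω - W T ω) ∂P =
      ∫⁻ ω, ∫⁻ ω', g (fun s => W s ω, fun t => W (T + t) ω' - W T ω') ∂P ∂P := by
  have m1 : Measurable (fun ω (s : Set.Iic T) => W s ω) :=
    measurable_pi_lambda _ fun s => hW.measurable _
  have m2 : Measurable (fun ω (t : ℝ≥0) => W (T + t) ω - W T ω) :=
    measurable_pi_lambda _ fun s => (hW.shift T).measurable _
  have h := (indepFun_iff_map_prod_eq_prod_map_map m1.aemeasurable m2.aemeasurable).1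
    (hW.indepFun_increments T)
  rw [← lintegral_map hg (m1.prodMk m2), h]
  have : IsProbabilityMeasure (P.map (fun ω (t : ℝ≥0) => W (T + t) ω - W T ω)) :=
    Measure.isProbabilityMeasure_map m2.aemeasurable
  rw [lintegral_prod _ hg.aemeasurable, lintegral_map hg.lintegral_prod_right' m1]
  refine lintegral_congr fun ω => ?_
  exact lintegral_map (hg.comp measurable_prodMk_left) m2

end Gaussian

/-! ### Gaussian estimates for the probability of being in a ball at a given time -/

section Kernel

lemma gaussianReal_Icc_le {v : ℝ≥0} (hv : v ≠ 0) (a : ℝ) {ρ q : ℝ}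
    (hq : ∀ x ∈ Set.Icc (a - ρ) (a + ρ), q ≤ x ^ 2) :
    gaussianReal 0 v (Set.Icc (a - ρ) (a + ρ)) ≤
      ENNReal.ofReal (2 * ρ * (√v)⁻¹ * Real.exp (-q / (2 * v))) := by
  have hv0 : (0 : ℝ) < v := by positivity
  rw [gaussianReal_apply _ hv]
  calc ∫⁻ x in Set.Icc (a - ρ) (a + ρ), gaussianPDF 0 v x
      ≤ ∫⁻ x in Set.Icc (a - ρ) (a + ρ),
        ENNReal.ofReal ((√v)⁻¹ * Real.exp (-q / (2 * v))) := by
        refine setLIntegral_mono measurable_const fun x hx => ENNReal.ofReal_le_ofReal ?_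
        rw [gaussianPDFReal]
        have h1 : √(v : ℝ) ≤ √(2 * Real.pi * v) := by
          apply Real.sqrt_le_sqrt
          nlinarith [Real.pi_gt_three]
        have h2 : (0 : ℝ) < √v := Real.sqrt_pos.2 hv0
        gcongr
        simpa using hq x hx
    _ = _ := by
        rw [setLIntegral_const, Real.volume_Icc, ← ENNReal.ofReal_mul (by positivity)]
        congr 1; ring

lemma le_gaussianReal_Icc {v : ℝ≥0} (hv : v ≠ 0) (a : ℝ) {ρ : ℝ} (hρ : 0 ≤ ρ) :
    ENNReal.ofReal (2 * ρ * (√(2 * Real.pi * v))⁻¹ * Real.exp (-(a ^ 2 + ρ ^ 2) / v)) ≤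
      gaussianReal 0 v (Set.Icc (a - ρ) (a + ρ)) := by
  have hv0 : (0 : ℝ) < v := by positivity
  rw [gaussianReal_apply _ hv]
  calc _ = ∫⁻ x in Set.Icc (a - ρ) (a + ρ),
        ENNReal.ofReal ((√(2 * Real.pi * v))⁻¹ * Real.exp (-(a ^ 2 + ρ ^ 2) / v)) := by
        rw [setLIntegral_const, Real.volume_Icc, ← ENNReal.ofReal_mul (by positivity)]
        congr 1; ring
    _ ≤ _ := by
        refine setLIntegral_mono (measurable_gaussianPDF 0 v) fun x hx =>
          ENNReal.ofReal_le_ofReal ?_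
        rw [gaussianPDFReal]
        gcongr ?_ * ?_
        rw [Real.exp_le_exp, div_le_div_iff₀ hv0 (by positivity)]
        have : (x - a) ^ 2 ≤ ρ ^ 2 := by
          rw [sq_le_sq, abs_of_nonneg hρ, abs_le]; constructor <;> linarith [hx.1, hx.2]
        have : x ^ 2 ≤ 2 * (a ^ 2 + ρ ^ 2) := by nlinarith [sq_nonneg (x - 2 * a)]
        nlinarith

variable {d : ℕ} {Ω : Type*} [MeasurableSpace Ω] {P : Measure Ω}
  {W : ℝ≥0 → Ω → EuclideanSpace ℝ (Fin d)}

lemma IsRegularBrownianMotion.measure_box (hW : IsRegularBrownianMotion W P) (t : ℝ≥0)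
    (a : Fin d → ℝ) (ρ : ℝ) :
    P {ω | ∀ i, W t ω i ∈ Set.Icc (a i - ρ) (a i + ρ)} =
      ∏ i, gaussianReal 0 t (Set.Icc (a i - ρ) (a i + ρ)) := by
  have h := (hW.indep.comp (fun _ f => f t) fun _ => measurable_pi_apply t).meas_iInter
    (s := fun i => (fun ω => W t ω i) ⁻¹' Set.Icc (a i - ρ) (a i + ρ))
    fun i => ⟨_, measurableSet_Icc, rfl⟩
  rw [Set.ofPred_forall]
  refine h.trans (Finset.prod_congr rfl fun i _ => ?_)
  rw [← ((hW.coord i).hasLaw_eval t).map_eq, Measure.map_apply_of_aemeasurable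
    ((hW.coord i).aemeasurable t) measurableSet_Icc]

/-- The ball lies in a cube, on which the law factors over the coordinates. The bounds `q` are left
free because two choices are needed: zero, for the decay in time, and a quadratic one, for the decay
in the distance. -/
lemma IsRegularBrownianMotion.measure_closedBall_le (hW : IsRegularBrownianMotion W P) {t : ℝ≥0}
    (ht : t ≠ 0) (x c : EuclideanSpace ℝ (Fin d)) {ρ : ℝ} (hρ : 0 ≤ ρ) {q : Fin d → ℝ}
    (hq : ∀ i, ∀ y ∈ Set.Icc ((c - x) i - ρ) ((c - x) i + ρ), q i ≤ y ^ 2) :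
    P {ω | x + W t ω ∈ Metric.closedBall c ρ} ≤
      ENNReal.ofReal ((2 * ρ * (√t)⁻¹) ^ d * Real.exp (-(∑ i, q i) / (2 * t))) := by
  calc P {ω | x + W t ω ∈ Metric.closedBall c ρ}
      ≤ P {ω | ∀ i, W t ω i ∈ Set.Icc ((c - x) i - ρ) ((c - x) i + ρ)} := by
        refine measure_mono fun ω hω i => ?_
        have h1 : ‖x + W t ω - c‖ ≤ ρ := by simpa [dist_eq_norm] using hω
        have h2 := (PiLp.norm_apply_le (x + W t ω - c) i).trans h1
        rw [Real.norm_eq_abs, abs_le] at h2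
        simp only [PiLp.sub_apply, PiLp.add_apply] at h2 ⊢
        constructor <;> linarith [h2.1, h2.2]
    _ = ∏ i, gaussianReal 0 t (Set.Icc ((c - x) i - ρ) ((c - x) i + ρ)) := hW.measure_box t _ ρ
    _ ≤ ∏ i, ENNReal.ofReal (2 * ρ * (√t)⁻¹ *
          Real.exp (-q i / (2 * t))) :=
        Finset.prod_le_prod' fun i _ => gaussianReal_Icc_le ht _ (hq i)
    _ = _ := by
        rw [← ENNReal.ofReal_prod_of_nonneg fun i _ => by positivity, Finset.prod_mul_distrib,
          ← Real.exp_sum, ← Finset.sum_div, Finset.sum_neg_distrib]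
        simp

/-- The cube of half-side `ρ / d` fits inside the ball, since `d * (ρ / d) ^ 2 ≤ ρ ^ 2`. -/
lemma IsRegularBrownianMotion.le_measure_closedBall (hW : IsRegularBrownianMotion W P) {t : ℝ≥0}
    (ht : t ≠ 0) (hd : d ≠ 0) (x c : EuclideanSpace ℝ (Fin d)) {ρ : ℝ} (hρ : 0 ≤ ρ) :
    ENNReal.ofReal ((2 * (ρ / d) * (√(2 * Real.pi * t))⁻¹) ^ d *
        Real.exp (-(dist x c ^ 2 + ρ ^ 2) / t)) ≤
      P {ω | x + W t ω ∈ Metric.closedBall c ρ} := by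
  have hd1 : (1 : ℝ) ≤ d := by exact_mod_cast Nat.one_le_iff_ne_zero.2 hd
  calc _ ≤ ENNReal.ofReal (∏ i, (2 * (ρ / d) * (√(2 * Real.pi * t))⁻¹ *
          Real.exp (-(((c - x) i) ^ 2 + (ρ / d) ^ 2) / t))) := by
        refine ENNReal.ofReal_le_ofReal ?_
        rw [Finset.prod_mul_distrib, ← Real.exp_sum, dist_comm, dist_eq_norm,
          EuclideanSpace.norm_sq_eq]
        simp only [Finset.prod_const, Finset.card_univ, Fintype.card_fin, Real.norm_eq_abs, sq_abs]
        rw [← Finset.sum_div]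
        gcongr
        rw [Finset.sum_neg_distrib, Finset.sum_add_distrib]
        simp only [Finset.sum_const, Finset.card_univ, Fintype.card_fin, nsmul_eq_mul]
        gcongr
        rw [div_pow, ← mul_div_assoc, div_le_iff₀ (by positivity), mul_comm]
        gcongr
        nlinarith
    _ = ∏ i, ENNReal.ofReal (2 * (ρ / d) * (√(2 * Real.pi * t))⁻¹ *
          Real.exp (-(((c - x) i) ^ 2 + (ρ / d) ^ 2) / t)) :=
        ENNReal.ofReal_prod_of_nonneg fun i _ => by positivity
    _ ≤ ∏ i, gaussianReal 0 t (Set.Icc ((c - x) i - ρ / d) ((c - x) i + ρ / d)) :=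
        Finset.prod_le_prod' fun i _ => le_gaussianReal_Icc ht _ (by positivity)
    _ = P {ω | ∀ i, W t ω i ∈ Set.Icc ((c - x) i - ρ / d) ((c - x) i + ρ / d)} :=
        (hW.measure_box t _ _).symm
    _ ≤ _ := by
        refine measure_mono fun ω hω => ?_
        rw [Set.mem_ofPred_eq, mem_closedBall_iff_norm, ← sq_le_sq₀ (norm_nonneg _) hρ,
          EuclideanSpace.norm_sq_eq]
        have h1 : ∀ i, ‖(x + W t ω - c) i‖ ^ 2 ≤ (ρ / d) ^ 2 := by
          intro i
          have := hω i
          rw [Real.norm_eq_abs, sq_abs, sq_le_sq, abs_of_nonneg (by positivity : 0 ≤ ρ / d),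
            abs_le]
          simp only [PiLp.sub_apply, PiLp.add_apply, Set.mem_Icc] at this ⊢
          constructor <;> linarith [this.1, this.2]
        calc ∑ i, ‖(x + W t ω - c) i‖ ^ 2 ≤ ∑ _i : Fin d, (ρ / d) ^ 2 :=
              Finset.sum_le_sum fun i _ => h1 i
          _ = ρ ^ 2 / d := by
              simp only [Finset.sum_const, Finset.card_univ, Fintype.card_fin, nsmul_eq_mul]
              field_simp
          _ ≤ ρ ^ 2 := div_le_self (by positivity) hd1

end Kernel

/-! ### Two-sided bounds for the expected occupation time of a ball -/

section Potential

/-- A function of time bounded on `(0, σ²]` and decaying as `t ^ (-d / 2)` has a small integral. -/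
lemma lintegral_le_of_decay {d : ℕ} (hd : 3 ≤ d) {K : ℝ → ENNReal} {κ A σ : ℝ} (hκ : 0 ≤ κ)
    (hA : 0 ≤ A) (hσ : 0 < σ) (h1 : ∀ s, 0 < s → s ≤ σ ^ 2 → K s ≤ ENNReal.ofReal κ)
    (h2 : ∀ s, 0 < s → K s ≤ ENNReal.ofReal (A * ((√s)⁻¹) ^ d)) :
    ∫⁻ s in Set.Ioi 0, K s ≤ ENNReal.ofReal (κ * σ ^ 2 + 2 * A * (σ ^ 2 / σ ^ d)) := by
  have hd' : (3 : ℝ) ≤ d := by exact_mod_cast hd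
  have hσ2 : 0 < σ ^ 2 := by positivity
  have e : Set.Ioi (0 : ℝ) = Set.Ioc 0 (σ ^ 2) ∪ Set.Ioi (σ ^ 2) :=
    (Set.Ioc_union_Ioi_eq_Ioi hσ2.le).symm
  rw [e]
  refine (lintegral_union_le _ _ _).trans ?_
  rw [ENNReal.ofReal_add (by positivity) (by positivity)]
  refine add_le_add ?_ ?_
  · calc ∫⁻ s in Set.Ioc 0 (σ ^ 2), K s ≤ ∫⁻ s in Set.Ioc 0 (σ ^ 2), ENNReal.ofReal κ :=
          setLIntegral_mono measurable_const fun s hs => h1 s hs.1 hs.2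
      _ = _ := by
          rw [setLIntegral_const, Real.volume_Ioc, ← ENNReal.ofReal_mul hκ, sub_zero]
  · have ha : -((d : ℝ) / 2) < -1 := by linarith
    have hint := integrableOn_Ioi_rpow_of_lt ha hσ2
    calc ∫⁻ s in Set.Ioi (σ ^ 2), K s
        ≤ ∫⁻ s in Set.Ioi (σ ^ 2), ENNReal.ofReal (A * s ^ (-((d : ℝ) / 2))) := by
          refine setLIntegral_mono (by fun_prop) fun s hs => ?_
          have hs0 : 0 < s := hσ2.trans hs
          refine (h2 s hs0).trans_eq ?_
          congr 2
          rw [inv_pow, ← Real.rpow_natCast, Real.sqrt_eq_rpow, ← Real.rpow_mul hs0.le,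
            Real.rpow_neg hs0.le]
          congr 2
          ring
      _ = ENNReal.ofReal (∫ s in Set.Ioi (σ ^ 2), A * s ^ (-((d : ℝ) / 2))) := by
          rw [ofReal_integral_eq_lintegral_ofReal (hint.const_mul A)]
          filter_upwards [ae_restrict_mem measurableSet_Ioi] with s hs
          have hs0 : 0 < s := hσ2.trans hs
          positivity
      _ ≤ _ := by
          refine ENNReal.ofReal_le_ofReal ?_
          rw [integral_const_mul, integral_Ioi_rpow_of_lt ha hσ2]
          have h3 : (σ ^ 2) ^ (-((d : ℝ) / 2) + 1) = σ ^ 2 / σ ^ d := by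
            rw [Real.rpow_add hσ2, Real.rpow_one, Real.rpow_neg hσ2.le, ← Real.rpow_natCast σ 2,
              ← Real.rpow_mul hσ.le, ← Real.rpow_natCast σ d, mul_comm, div_eq_mul_inv]
            congr 3
            push_cast
            ring
          rw [h3, neg_div, ← div_neg, mul_comm 2 A, mul_assoc]
          gcongr
          rw [div_le_iff₀ (by linarith)]
          have : 0 ≤ σ ^ 2 / σ ^ d := by positivity
          nlinarith

/-- With `y = D / √s` the claim is that `y ^ d * exp (-y ^ 2 / 8)` is bounded, which follows from
one term of the exponential series. -/
lemma inv_sqrt_pow_mul_exp_le (d : ℕ) {D s : ℝ} (hD : 0 < D) (hs : 0 < s) :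
    ((√s)⁻¹) ^ d * Real.exp (-(D ^ 2 / (8 * s))) ≤ (1 + 8 ^ d * d.factorial) / D ^ d := by
  have hr : 0 < √s := Real.sqrt_pos.2 hs
  set y := D / √s with hy
  have hy0 : 0 < y := by positivity
  have hy2 : y ^ 2 = D ^ 2 / s := by rw [hy, div_pow, Real.sq_sqrt hs.le]
  have e1 : ((√s)⁻¹) ^ d = y ^ d / D ^ d := by
    rw [hy, ← div_pow]; congr 1; field_simp
  have e2 : D ^ 2 / (8 * s) = y ^ 2 / 8 := by rw [hy2]; field_simp
  rw [e1, e2, div_mul_eq_mul_div]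
  gcongr
  have h1 : y ^ d ≤ 1 + (y ^ 2) ^ d := by
    rw [← pow_mul, mul_comm, pow_mul]
    nlinarith [sq_nonneg (y ^ d - 1), sq_nonneg (y ^ d)]
  have h2 : (y ^ 2) ^ d ≤ 8 ^ d * d.factorial * Real.exp (y ^ 2 / 8) := by
    have := Real.pow_div_factorial_le_exp (y ^ 2 / 8) (by positivity) d
    rw [div_le_iff₀ (by positivity), div_pow, div_le_iff₀ (by positivity)] at this
    linarith
  have h3 : Real.exp (-(y ^ 2 / 8)) ≤ 1 := Real.exp_le_one_iff.2 (by linarith [sq_nonneg y])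
  have h4 : Real.exp (y ^ 2 / 8) * Real.exp (-(y ^ 2 / 8)) = 1 := by
    rw [← Real.exp_add]; simp
  have h5 := Real.exp_pos (-(y ^ 2 / 8))
  have h6 : (0 : ℝ) ≤ 8 ^ d * d.factorial := by positivity
  calc y ^ d * Real.exp (-(y ^ 2 / 8))
      ≤ (1 + 8 ^ d * d.factorial * Real.exp (y ^ 2 / 8)) * Real.exp (-(y ^ 2 / 8)) := by
        gcongr; linarith
    _ = Real.exp (-(y ^ 2 / 8)) + 8 ^ d * d.factorial *
        (Real.exp (y ^ 2 / 8) * Real.exp (-(y ^ 2 / 8))) := by ring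
    _ ≤ _ := by rw [h4]; linarith

variable {d : ℕ} {Ω : Type*} [MeasurableSpace Ω]

/-- The Green potential of `f` for the process `W`. -/
noncomputable def potential (P : Measure Ω) (W : ℝ≥0 → Ω → EuclideanSpace ℝ (Fin d))
    (f : EuclideanSpace ℝ (Fin d) → ENNReal) (x : EuclideanSpace ℝ (Fin d)) : ENNReal :=
  ∫⁻ s in Set.Ioi (0 : ℝ), ∫⁻ ω, f (x + W s.toNNReal ω) ∂P

/-- The expected time that `x + W` spends in the closed ball with centre `c` and radius `ρ`. -/
noncomputable def occupation (P : Measure Ω) (W : ℝ≥0 → Ω → EuclideanSpace ℝ (Fin d))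
    (c : EuclideanSpace ℝ (Fin d)) (ρ : ℝ) (x : EuclideanSpace ℝ (Fin d)) : ENNReal :=
  ∫⁻ s in Set.Ioi (0 : ℝ), P {ω | x + W s.toNNReal ω ∈ Metric.closedBall c ρ}

lemma IsRegularBrownianMotion.potential_indicator {P : Measure Ω}
    {W : ℝ≥0 → Ω → EuclideanSpace ℝ (Fin d)} (hW : IsRegularBrownianMotion W P)
    (c : EuclideanSpace ℝ (Fin d)) (ρ : ℝ) (x : EuclideanSpace ℝ (Fin d)) :
    potential P W ((Metric.closedBall c ρ).indicator 1) x = occupation P W c ρ x := by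
  refine lintegral_congr fun s => ?_
  have hm : MeasurableSet {ω | x + W s.toNNReal ω ∈ Metric.closedBall c ρ} :=
    ((hW.measurable _).const_add x) Metric.isClosed_closedBall.measurableSet
  rw [← lintegral_indicator_one hm]
  rfl

/-- Times before and after `ρ ^ 2` (or `dist x c ^ 2` for a distant start) are treated separately;
`t ^ (-d / 2)` is integrable at infinity because `d ≥ 3`. The constant is chosen before the process,
so that it also serves the motions restarted at a later time. -/
lemma exists_occupation_le (hd : 3 ≤ d) (P : Measure Ω) [IsProbabilityMeasure P] :
    ∃ C : ℝ, 0 < C ∧ ∀ W : ℝ≥0 → Ω → EuclideanSpace ℝ (Fin d), IsRegularBrownianMotion W P →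
      ∀ (x c : EuclideanSpace ℝ (Fin d)) (ρ : ℝ), 0 < ρ →
        occupation P W c ρ x ≤ ENNReal.ofReal (C * ρ ^ 2) ∧
        (x ≠ c → occupation P W c ρ x ≤ ENNReal.ofReal (C * ρ ^ 2 * (ρ / dist x c) ^ (d - 2))) := by
  have hd' : (3 : ℝ) ≤ d := by exact_mod_cast hd
  have hd2 : d = (d - 2) + 2 := by omega
  set C₁ : ℝ := 1 + 2 * 2 ^ d with hC₁
  set C₂ : ℝ := 2 ^ d * (1 + 8 ^ d * d.factorial + 2) with hC₂
  have hC₁0 : 0 < C₁ := by positivity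
  have hC₂0 : 0 < C₂ := by positivity
  have key : ∀ W : ℝ≥0 → Ω → EuclideanSpace ℝ (Fin d), IsRegularBrownianMotion W P →
      ∀ (x c : EuclideanSpace ℝ (Fin d)) (ρ : ℝ), 0 < ρ →
      occupation P W c ρ x ≤ ENNReal.ofReal (C₁ * ρ ^ 2) ∧
      (2 * d * ρ ≤ dist x c →
        occupation P W c ρ x ≤ ENNReal.ofReal (C₂ * ρ ^ 2 * (ρ / dist x c) ^ (d - 2))) := by
    intro W hW x c ρ hρ
    -- A point `y` within `ρ` of a coordinate `a` of `c - x` satisfies `y ^ 2 ≥ a ^ 2 / 2 - ρ ^ 2`.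
    -- When `2 * d * ρ ≤ dist x c` the loss `d * ρ ^ 2` is at most a quarter of the squared
    -- distance, which leaves the exponent `-(dist x c ^ 2) / (8 * s)`.
    have hbd : ∀ s : ℝ, 0 < s → P {ω | x + W s.toNNReal ω ∈ Metric.closedBall c ρ} ≤
        ENNReal.ofReal ((2 * ρ * (√s)⁻¹) ^ d *
        Real.exp (-(dist x c ^ 2 / 2 - d * ρ ^ 2) / (2 * s))) := by
      intro s hs
      have := hW.measure_closedBall_le (t := s.toNNReal) (by simpa using hs) x c hρ.le
        (q := fun i => (c - x) i ^ 2 / 2 - ρ ^ 2) fun i y hy => by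
          have : (y - (c - x) i) ^ 2 ≤ ρ ^ 2 := by
            rw [sq_le_sq, abs_of_nonneg hρ.le, abs_le]; constructor <;> linarith [hy.1, hy.2]
          nlinarith [sq_nonneg (2 * y - (c - x) i)]
      rw [Real.coe_toNNReal s hs.le, Finset.sum_sub_distrib, ← Finset.sum_div] at this
      rw [dist_comm, dist_eq_norm, EuclideanSpace.norm_sq_eq]
      simpa using this
    have hbox : ∀ s : ℝ, 0 < s → P {ω | x + W s.toNNReal ω ∈ Metric.closedBall c ρ} ≤
        ENNReal.ofReal ((2 * ρ) ^ d * ((√s)⁻¹) ^ d) := by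
      intro s hs
      have := hW.measure_closedBall_le (t := s.toNNReal) (by simpa using hs) x c hρ.le
        (q := fun _ => 0) fun i y _ => sq_nonneg y
      rw [Real.coe_toNNReal s hs.le] at this
      rw [← mul_pow]
      simpa using this
    constructor
    · refine (lintegral_le_of_decay hd (κ := 1) (A := (2 * ρ) ^ d) zero_le_one (by positivity) hρ
        (fun s _ _ => by simpa using prob_le_one) hbox).trans_eq ?_
      congr 1
      rw [hC₁, mul_pow]; field_simp
    · intro hD
      have hD0 : 0 < dist x c := by nlinarith
      refine (lintegral_le_of_decay hd (κ := (2 * ρ) ^ d * ((1 + 8 ^ d * d.factorial) /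
        dist x c ^ d)) (A := (2 * ρ) ^ d) (by positivity) (by positivity) hD0
        (fun s hs _ => (hbd s hs).trans (ENNReal.ofReal_le_ofReal ?_)) hbox).trans_eq ?_
      · rw [mul_pow, mul_assoc]
        gcongr
        refine le_trans ?_ (inv_sqrt_pow_mul_exp_le d hD0 hs)
        gcongr
        rw [← neg_le_neg_iff, neg_neg, neg_div, neg_neg, div_le_div_iff₀ (by positivity)
          (by positivity)]
        have : d * ρ ^ 2 ≤ dist x c ^ 2 / 4 := by
          have h1 : (2 * d * ρ) ^ 2 ≤ dist x c ^ 2 := by gcongr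
          have h2 : d * ρ ^ 2 ≤ d * (d * ρ ^ 2) :=
            le_mul_of_one_le_left (by positivity) (by linarith)
          nlinarith
        nlinarith
      · congr 1
        rw [hC₂]
        have e : dist x c ^ d = dist x c ^ (d - 2) * dist x c ^ 2 := by rw [← pow_add]; congr
        have e' : ρ ^ d = ρ ^ (d - 2) * ρ ^ 2 := by rw [← pow_add]; congr
        rw [div_pow, mul_pow, e, e']
        field_simp
  refine ⟨C₂ + C₁ * (2 * d) ^ (d - 2), by positivity, fun W hW x c ρ hρ => ⟨?_, fun hxc => ?_⟩⟩
  · refine (key W hW x c ρ hρ).1.trans (ENNReal.ofReal_le_ofReal ?_)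
    gcongr
    have : (1 : ℝ) ≤ (2 * d) ^ (d - 2) := one_le_pow₀ (by linarith)
    nlinarith
  · have hD0 : 0 < dist x c := dist_pos.2 hxc
    -- For a close start the factor `(2 * d * ρ / dist x c) ^ (d - 2)` is at least 1, so the uniform
    -- bound suffices.
    by_cases hD : 2 * d * ρ ≤ dist x c
    · refine ((key W hW x c ρ hρ).2 hD).trans (ENNReal.ofReal_le_ofReal ?_)
      gcongr
      have : 0 ≤ C₁ * (2 * d) ^ (d - 2) := by positivity
      linarith
    · refine (key W hW x c ρ hρ).1.trans (ENNReal.ofReal_le_ofReal ?_)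
      have h1 : 1 ≤ (2 * d) ^ (d - 2) * (ρ / dist x c) ^ (d - 2) := by
        rw [← mul_pow]
        refine one_le_pow₀ ?_
        rw [← mul_div_assoc, le_div_iff₀ hD0]
        linarith
      have h2 : 0 ≤ C₂ * ρ ^ 2 * (ρ / dist x c) ^ (d - 2) := by positivity
      have h3 : C₁ * ρ ^ 2 ≤ C₁ * ρ ^ 2 * ((2 * d) ^ (d - 2) * (ρ / dist x c) ^ (d - 2)) :=
        le_mul_of_one_le_right (by positivity) h1
      linarith

/-- During the time window from `m ^ 2` to `2 * m ^ 2` the motion is spread over the scale `m`, so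
it is in the ball with probability at least of order `(ρ / m) ^ d`; the window has length `m ^ 2`.
-/
lemma exists_le_occupation (hd : 3 ≤ d) (P : Measure Ω) :
    ∃ C : ℝ, 0 < C ∧ ∀ W : ℝ≥0 → Ω → EuclideanSpace ℝ (Fin d), IsRegularBrownianMotion W P →
      ∀ (x c : EuclideanSpace ℝ (Fin d)) (ρ m : ℝ), 0 < ρ → ρ ≤ m → dist x c ≤ m →
        ENNReal.ofReal (C * ρ ^ 2 * (ρ / m) ^ (d - 2)) ≤ occupation P W c ρ x := by
  have hd0 : (0 : ℝ) < d := by exact_mod_cast (by omega : 0 < d)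
  refine ⟨(1 / (2 * d)) ^ d * Real.exp (-2), by positivity,
    fun W hW x c ρ m hρ hm hD => ?_⟩
  have hm0 : 0 < m := hρ.trans_le hm
  calc _ = ENNReal.ofReal ((2 * (ρ / d) * (4 * m)⁻¹) ^ d * Real.exp (-2)) *
        volume (Set.Icc (m ^ 2) (2 * m ^ 2)) := by
        rw [Real.volume_Icc, ← ENNReal.ofReal_mul (by positivity)]
        congr 1
        have e : m ^ d = m ^ (d - 2) * m ^ 2 := by rw [← pow_add]; congr; omega
        have e' : ρ ^ d = ρ ^ (d - 2) * ρ ^ 2 := by rw [← pow_add]; congr; omega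
        have e'' : 2 * (ρ / d) * (4 * m)⁻¹ = 1 / (2 * d) * (ρ / m) := by field_simp; norm_num
        rw [e'', mul_pow, div_pow ρ m d, e, e', div_pow ρ m]
        have : m ^ (d - 2) ≠ 0 := by positivity
        field_simp
        ring
    _ = ∫⁻ s in Set.Icc (m ^ 2) (2 * m ^ 2),
        ENNReal.ofReal ((2 * (ρ / d) * (4 * m)⁻¹) ^ d * Real.exp (-2)) := by
        rw [setLIntegral_const]
    _ ≤ ∫⁻ s in Set.Icc (m ^ 2) (2 * m ^ 2),
        P {ω | x + W s.toNNReal ω ∈ Metric.closedBall c ρ} := by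
        refine setLIntegral_mono' measurableSet_Icc fun s hs => ?_
        have hs0 : 0 < s := lt_of_lt_of_le (by positivity) hs.1
        have := hW.le_measure_closedBall (t := s.toNNReal) (by simpa using hs0) (by omega) x c hρ.le
        rw [Real.coe_toNNReal s hs0.le] at this
        refine le_trans (ENNReal.ofReal_le_ofReal ?_) this
        gcongr
        · rw [Real.sqrt_le_left (by positivity)]
          nlinarith [Real.pi_lt_four, hs.2, Real.pi_pos]
        · rw [neg_div, neg_le_neg_iff, div_le_iff₀ hs0]
          have : dist x c ^ 2 ≤ m ^ 2 := by gcongr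
          have : ρ ^ 2 ≤ m ^ 2 := by gcongr
          linarith [hs.1]
    _ ≤ _ := lintegral_mono_set fun s hs => lt_of_lt_of_le (by positivity : 0 < m ^ 2) hs.1

end Potential

/-! ### First passage and second moment estimates from the Markov property -/

section Potential

variable {d : ℕ} {Ω : Type*} [MeasurableSpace Ω] {P : Measure Ω}
  {W : ℝ≥0 → Ω → EuclideanSpace ℝ (Fin d)} {f : EuclideanSpace ℝ (Fin d) → ENNReal}

lemma IsRegularBrownianMotion.measurable_uncurry (hW : IsRegularBrownianMotion W P) :
    Measurable (fun p : ℝ × Ω => W p.1.toNNReal p.2) := by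
  have h : Measurable (Function.uncurry fun (ω : Ω) (t : ℝ≥0) => W t ω) := by
    have := measurable_uncurry_of_continuous_of_measurable (u := fun (t : ℝ≥0) ω => W t ω)
      hW.continuous hW.measurable
    exact this.comp measurable_swap
  exact h.comp (measurable_snd.prodMk (measurable_real_toNNReal.comp measurable_fst))

variable [IsProbabilityMeasure P]

/-- The Markov property applied to the time integral of `f` along the future of the path. -/
lemma IsRegularBrownianMotion.lintegral_mul_potential (hW : IsRegularBrownianMotion W P) (T : ℝ≥0)
    {h : (Set.Iic T → EuclideanSpace ℝ (Fin d)) → ENNReal} (hh : Measurable h)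
    (hf : Measurable f) (x : EuclideanSpace ℝ (Fin d)) :
    ∫⁻ ω, h (fun s => W s ω) * (∫⁻ t in Set.Ioi (0 : ℝ), f (x + W (T + t.toNNReal) ω)) ∂P =
      ∫⁻ ω, h (fun s => W s ω) *
        potential P (fun t ω => W (T + t) ω - W T ω) f (x + W T ω) ∂P := by
  have mh : Measurable (fun ω => h (fun s : Set.Iic T => W s ω)) :=
    hh.comp (measurable_pi_lambda _ fun s => hW.measurable _)
  have mS := (hW.shift T).measurable_uncurry
  have mT := hW.measurable T
  have m1 : Measurable (fun p : ℝ × Ω => f (x + W (T + p.1.toNNReal) p.2)) := by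
    have : (fun p : ℝ × Ω => f (x + W (T + p.1.toNNReal) p.2)) = fun p : ℝ × Ω =>
        f (x + (W T p.2 + (W (T + p.1.toNNReal) p.2 - W T p.2))) := by
      ext p; congr 2; abel
    rw [this]
    exact hf.comp (((mT.comp measurable_snd).add mS).const_add x)
  have m2 : Measurable (fun q : (ℝ × Ω) × Ω =>
      f (x + W T q.1.2 + (W (T + q.1.1.toNNReal) q.2 - W T q.2))) :=
    hf.comp (((mT.comp (measurable_snd.comp measurable_fst)).const_add x).add
      (mS.comp ((measurable_fst.comp measurable_fst).prodMk measurable_snd)))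
  have m3 : Measurable (fun p : ℝ × Ω => ∫⁻ ω', f (x + W T p.2 +
      (W (T + p.1.toNNReal) ω' - W T ω')) ∂P) := m2.lintegral_prod_right'
  calc ∫⁻ ω, h (fun s => W s ω) * (∫⁻ t in Set.Ioi (0 : ℝ), f (x + W (T + t.toNNReal) ω)) ∂P
      = ∫⁻ ω, (∫⁻ t in Set.Ioi (0 : ℝ), h (fun s => W s ω) * f (x + W (T + t.toNNReal) ω)) ∂P := by
        refine lintegral_congr fun ω => ?_
        exact (lintegral_const_mul _ (m1.comp measurable_prodMk_right)).symm
    _ = ∫⁻ t in Set.Ioi (0 : ℝ), ∫⁻ ω, h (fun s => W s ω) * f (x + W (T + t.toNNReal) ω) ∂P :=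
        lintegral_lintegral_swap (((mh.comp measurable_fst).mul
          (m1.comp measurable_swap)).aemeasurable)
    _ = ∫⁻ t in Set.Ioi (0 : ℝ), ∫⁻ ω, h (fun s => W s ω) *
          ∫⁻ ω', f (x + W T ω + (W (T + t.toNNReal) ω' - W T ω')) ∂P ∂P := by
        refine lintegral_congr fun t => ?_
        have := hW.lintegral_markov T (g := fun p => h p.1 *
          f (x + p.1 ⟨T, Set.self_mem_Iic⟩ + p.2 t.toNNReal)) ((hh.comp measurable_fst).mul
            (hf.comp (by fun_prop)))
        convert this using 1
        · refine lintegral_congr fun ω => ?_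
          congr 2
          change _ = x + W T ω + (W (T + t.toNNReal) ω - W T ω)
          abel
        · refine lintegral_congr fun ω => ?_
          exact (lintegral_const_mul _ (m2.comp (measurable_prodMk_left (x := (t, ω))))).symm
    _ = ∫⁻ ω, (∫⁻ t in Set.Ioi (0 : ℝ), h (fun s => W s ω) *
          ∫⁻ ω', f (x + W T ω + (W (T + t.toNNReal) ω' - W T ω')) ∂P) ∂P :=
        (lintegral_lintegral_swap (((mh.comp measurable_fst).mul
          (m3.comp measurable_swap)).aemeasurable)).symm
    _ = _ := by
        refine lintegral_congr fun ω => ?_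
        exact lintegral_const_mul _ (m3.comp measurable_prodMk_right)

lemma lintegral_Ioi_add (g : ℝ → ENNReal) (a : ℝ) :
    ∫⁻ t in Set.Ioi 0, g (a + t) = ∫⁻ t in Set.Ioi a, g t := by
  have h := (measurePreserving_add_left (volume : Measure ℝ) a).setLIntegral_comp_preimage_emb
    (measurableEmbedding_addLeft a) g (Set.Ioi a)
  rw [← h]
  simp

lemma lintegral_toNNReal_add (g : ℝ≥0 → ENNReal) (T : ℝ≥0) :
    ∫⁻ t in Set.Ioi (0 : ℝ), g (T + t.toNNReal) = ∫⁻ t in Set.Ioi (T : ℝ), g t.toNNReal := by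
  rw [← lintegral_Ioi_add (fun t => g t.toNNReal) T]
  refine setLIntegral_congr_fun measurableSet_Ioi fun t ht => ?_
  have : ((T : ℝ) + t).toNNReal = T + t.toNNReal := by
    rw [Real.toNNReal_add T.coe_nonneg (le_of_lt ht), Real.toNNReal_coe]
  simp only [this]

/-- First passage estimate: the probability of visiting a ball at finitely many given times is
controlled by the expected occupation time of that ball. -/
lemma IsRegularBrownianMotion.mul_measure_visit_le (hW : IsRegularBrownianMotion W P)
    (x c : EuclideanSpace ℝ (Fin d)) (ρ : ℝ) {lam : ENNReal}
    (hlam : ∀ T : ℝ≥0, ∀ z ∈ Metric.closedBall c ρ,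
      lam ≤ occupation P (fun t ω => W (T + t) ω - W T ω) c ρ z) (F : Finset ℝ≥0) :
    lam * P {ω | ∃ q ∈ F, x + W q ω ∈ Metric.closedBall c ρ} ≤ occupation P W c ρ x := by
  classical
  set A := Metric.closedBall c ρ with hA
  have mA : MeasurableSet A := Metric.isClosed_closedBall.measurableSet
  set f : EuclideanSpace ℝ (Fin d) → ENNReal := A.indicator 1 with hf
  have mf : Measurable f := measurable_one.indicator mA
  -- The event that `q` is the first time of `F` spent in the ball, read off the path on `[0, q]`;
  -- `min q' q` only serves to keep the index in `Set.Iic q`.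
  let past : (q : ℝ≥0) → Set (Set.Iic q → EuclideanSpace ℝ (Fin d)) := fun q =>
    {p | x + p ⟨q, Set.self_mem_Iic⟩ ∈ A ∧
      ∀ q' ∈ F, q' < q → x + p ⟨min q' q, Set.mem_Iic.2 (min_le_right _ _)⟩ ∉ A}
  let E : ℝ≥0 → Set Ω := fun q => {ω | x + W q ω ∈ A ∧ ∀ q' ∈ F, q' < q → x + W q' ω ∉ A}
  have mpast : ∀ q, MeasurableSet (past q) := by
    intro q
    have hev : ∀ s : Set.Iic q, MeasurableSet
        {p : Set.Iic q → EuclideanSpace ℝ (Fin d) | x + p s ∈ A} := fun s =>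
      measurableSet_preimage (by fun_prop : Measurable fun p : Set.Iic q →
        EuclideanSpace ℝ (Fin d) => x + p s) mA
    refine (hev _).inter ?_
    have : {p : Set.Iic q → EuclideanSpace ℝ (Fin d) |
        ∀ q' ∈ F, q' < q → x + p ⟨min q' q, Set.mem_Iic.2 (min_le_right _ _)⟩ ∉ A} =
        ⋂ q' ∈ F, ⋂ (_ : q' < q),
          {p | x + p ⟨min q' q, Set.mem_Iic.2 (min_le_right _ _)⟩ ∈ A}ᶜ := by
      ext p; simp
    change MeasurableSet {p : Set.Iic q → EuclideanSpace ℝ (Fin d) |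
        ∀ q' ∈ F, q' < q → x + p ⟨min q' q, Set.mem_Iic.2 (min_le_right _ _)⟩ ∉ A}
    rw [this]
    exact Finset.measurableSet_biInter _ fun q' _ => MeasurableSet.iInter fun _ => (hev _).compl
  have hEpast : ∀ q ω, (fun s : Set.Iic q => W s ω) ∈ past q ↔ ω ∈ E q := by
    intro q ω
    simp only [past, E, Set.mem_ofPred_eq]
    refine and_congr_right fun _ => forall₂_congr fun q' _ => forall_congr' fun hq => ?_
    rw [min_eq_left hq.le]
  have mE : ∀ q, MeasurableSet (E q) := by
    intro q
    have : E q = (fun ω (s : Set.Iic q) => W s ω) ⁻¹' past q := by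
      ext ω; exact (hEpast q ω).symm
    rw [this]
    exact (measurable_pi_lambda _ fun s => hW.measurable _) (mpast q)
  have hcover : {ω | ∃ q ∈ F, x + W q ω ∈ A} ⊆ ⋃ q ∈ F, E q := by
    rintro ω ⟨q, hq, hqA⟩
    obtain ⟨q₀, h₀, hmin⟩ := (F.filter fun q => x + W q ω ∈ A).exists_min_image id
      ⟨q, by simp [hq, hqA]⟩
    simp only [Finset.mem_filter, id] at h₀ hmin
    simp only [Set.mem_iUnion]
    refine ⟨q₀, h₀.1, h₀.2, fun q' hq' hlt hmem => ?_⟩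
    exact absurd (hmin q' ⟨hq', hmem⟩) (not_le.2 hlt)
  -- Restart at the first visit: the motion is then in the ball, and its expected occupation time
  -- from there on is at least `lam`.
  have hstep : ∀ q, lam * P (E q) ≤ ∫⁻ ω, (E q).indicator 1 ω *
      (∫⁻ t in Set.Ioi (0 : ℝ), f (x + W t.toNNReal ω)) ∂P := by
    intro q
    have e1 : ∀ ω, (past q).indicator (1 : (Set.Iic q → EuclideanSpace ℝ (Fin d)) → ENNReal)
          (fun s : Set.Iic q => W s ω) =
        (E q).indicator 1 ω := by
      intro ω
      by_cases h : ω ∈ E q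
      · rw [Set.indicator_of_mem h, Set.indicator_of_mem ((hEpast q ω).2 h)]; rfl
      · rw [Set.indicator_of_notMem h, Set.indicator_of_notMem (mt (hEpast q ω).1 h)]
    have h2 := hW.lintegral_mul_potential q
      (h := (past q).indicator (1 : (Set.Iic q → EuclideanSpace ℝ (Fin d)) → ENNReal))
      (measurable_one.indicator (mpast q)) mf x
    simp only [e1] at h2
    calc lam * P (E q) = ∫⁻ ω, (E q).indicator 1 ω * lam ∂P := by
          rw [lintegral_mul_const _ (measurable_one.indicator (mE q)),
            lintegral_indicator_one (mE q), mul_comm]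
      _ ≤ ∫⁻ ω, (E q).indicator 1 ω *
          potential P (fun t ω => W (q + t) ω - W q ω) f (x + W q ω) ∂P := by
          refine lintegral_mono fun ω => ?_
          by_cases h : ω ∈ E q
          · rw [hf, (hW.shift q).potential_indicator]
            gcongr
            exact hlam q _ h.1
          · simp [h]
      _ = _ := h2.symm
      _ ≤ _ := by
          refine lintegral_mono fun ω => ?_
          refine mul_le_mul_right ?_ _
          rw [lintegral_toNNReal_add (fun t => f (x + W t ω)) q]
          exact lintegral_mono_set (Set.Ioi_subset_Ioi q.2)
  have mZ : Measurable (fun ω => ∫⁻ t in Set.Ioi (0 : ℝ), f (x + W t.toNNReal ω)) := by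
    have : Measurable (fun p : Ω × ℝ => f (x + W p.2.toNNReal p.1)) :=
      mf.comp ((hW.measurable_uncurry.comp measurable_swap).const_add x)
    exact this.lintegral_prod_right'
  calc lam * P {ω | ∃ q ∈ F, x + W q ω ∈ A} ≤ lam * ∑ q ∈ F, P (E q) := by
        gcongr
        exact (measure_mono hcover).trans (measure_biUnion_finset_le _ _)
    _ = ∑ q ∈ F, lam * P (E q) := Finset.mul_sum _ _ _
    _ ≤ ∑ q ∈ F, ∫⁻ ω, (E q).indicator 1 ω *
        (∫⁻ t in Set.Ioi (0 : ℝ), f (x + W t.toNNReal ω)) ∂P := Finset.sum_le_sum fun q _ => hstep q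
    _ = ∫⁻ ω, ∑ q ∈ F, (E q).indicator 1 ω *
        (∫⁻ t in Set.Ioi (0 : ℝ), f (x + W t.toNNReal ω)) ∂P :=
        (lintegral_finsetSum _ fun q _ => (measurable_one.indicator (mE q)).mul mZ).symm
    _ ≤ ∫⁻ ω, (∫⁻ t in Set.Ioi (0 : ℝ), f (x + W t.toNNReal ω)) ∂P := by
        refine lintegral_mono fun ω => ?_
        rw [← Finset.sum_mul]
        refine mul_le_of_le_one_left' ?_
        -- There is at most one first visit, so the indicators sum to at most 1.
        by_cases h : ∃ q ∈ F, ω ∈ E q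
        · obtain ⟨q, hq, hqE⟩ := h
          rw [Finset.sum_eq_single_of_mem q hq]
          · simp [hqE]
          · intro q' hq' hne
            refine Set.indicator_of_notMem (fun h' => ?_) _
            rcases lt_or_gt_of_ne hne with hlt | hlt
            · exact hqE.2 q' hq' hlt h'.1
            · exact h'.2 q hq hlt hqE.1
        · push Not at h
          rw [Finset.sum_eq_zero fun q hq => Set.indicator_of_notMem (h q hq) _]
          exact zero_le_one
    _ = potential P W f x := by
        refine lintegral_lintegral_swap (Measurable.aemeasurable ?_)
        exact mf.comp ((hW.measurable_uncurry.comp measurable_swap).const_add x)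
    _ = _ := hW.potential_indicator c ρ x

/-- The quadrant is split along the diagonal into two symmetric halves. In the ordered form the
later time is in the future of the earlier one, as the Markov property requires. -/
lemma lintegral_mul_lintegral_le {g : ℝ → ENNReal} (hg : Measurable g) :
    (∫⁻ s in Set.Ioi 0, g s) * ∫⁻ t in Set.Ioi 0, g t ≤
      2 * ∫⁻ s in Set.Ioi 0, g s * ∫⁻ t in Set.Ioi s, g t := by
  have key : ∀ s ∈ Set.Ioi (0 : ℝ), ∫⁻ t in Set.Ioi 0, g t =
      (∫⁻ t in Set.Ioi s, g t) + ∫⁻ t in Set.Ioi 0, (Set.Iic s).indicator g t := by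
    intro s hs
    rw [lintegral_indicator measurableSet_Iic, Measure.restrict_restrict measurableSet_Iic,
      Set.inter_comm, Set.Ioi_inter_Iic, add_comm, ← lintegral_union measurableSet_Ioi
        (Set.disjoint_left.2 fun t h1 h2 => not_lt.2 h1.2 h2),
      Set.Ioc_union_Ioi_eq_Ioi (le_of_lt hs)]
  have mI : Measurable (fun p : ℝ × ℝ => g p.1 * (Set.Iic p.1).indicator g p.2) := by
    have : (fun p : ℝ × ℝ => (Set.Iic p.1).indicator g p.2) =
        {p : ℝ × ℝ | p.2 ≤ p.1}.indicator fun p => g p.2 := by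
      ext p; simp [Set.indicator]
    refine (hg.comp measurable_fst).mul ?_
    rw [this]
    exact (hg.comp measurable_snd).indicator (measurableSet_le measurable_snd measurable_fst)
  have mJ : Measurable (fun s => g s * ∫⁻ t in Set.Ioi s, g t) := by
    refine hg.mul ?_
    have : (fun s => ∫⁻ t in Set.Ioi s, g t) = fun s => ∫⁻ t, {p : ℝ × ℝ | p.1 < p.2}.indicator
        (fun p => g p.2) (s, t) := by
      ext s
      rw [← lintegral_indicator measurableSet_Ioi]
      simp [Set.indicator]
    rw [this]
    exact ((hg.comp measurable_snd).indicator
      (measurableSet_lt measurable_fst measurable_snd)).lintegral_prod_right'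
  calc (∫⁻ s in Set.Ioi 0, g s) * ∫⁻ t in Set.Ioi 0, g t
      = ∫⁻ s in Set.Ioi 0, g s * ∫⁻ t in Set.Ioi 0, g t := (lintegral_mul_const _ hg).symm
    _ = ∫⁻ s in Set.Ioi 0, ((g s * ∫⁻ t in Set.Ioi s, g t) +
          ∫⁻ t in Set.Ioi 0, g s * (Set.Iic s).indicator g t) := by
        refine setLIntegral_congr_fun measurableSet_Ioi fun s hs => ?_
        rw [key s hs, mul_add, lintegral_const_mul _ (hg.indicator measurableSet_Iic)]
    _ = (∫⁻ s in Set.Ioi 0, g s * ∫⁻ t in Set.Ioi s, g t) +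
          ∫⁻ s in Set.Ioi 0, ∫⁻ t in Set.Ioi 0, g s * (Set.Iic s).indicator g t :=
        lintegral_add_left mJ _
    _ = (∫⁻ s in Set.Ioi 0, g s * ∫⁻ t in Set.Ioi s, g t) +
          ∫⁻ t in Set.Ioi 0, ∫⁻ s in Set.Ioi 0, g s * (Set.Iic s).indicator g t := by
        congr 1
        exact lintegral_lintegral_swap mI.aemeasurable
    _ = (∫⁻ s in Set.Ioi 0, g s * ∫⁻ t in Set.Ioi s, g t) +
          ∫⁻ t in Set.Ioi 0, g t * ∫⁻ s in Set.Ioi t, g s := by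
        congr 1
        refine setLIntegral_congr_fun measurableSet_Ioi fun t ht => ?_
        rw [← lintegral_const_mul _ hg, setLIntegral_congr (Ioi_ae_eq_Ici (a := t))]
        have : ∀ s, g s * (Set.Iic s).indicator g t = (Set.Ici t).indicator
            (fun s => g t * g s) s := by
          intro s
          by_cases h : t ≤ s <;> simp [h, mul_comm]
        simp only [this]
        rw [lintegral_indicator measurableSet_Ici, Measure.restrict_restrict measurableSet_Ici,
          Set.inter_eq_left.2 (Set.Ici_subset_Ioi.2 ht)]
    _ ≤ 2 * ∫⁻ s in Set.Ioi 0, g s * ∫⁻ t in Set.Ioi s, g t := (two_mul _).ge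

/-- Second moment estimate: the potential of `f` at `x`, divided by twice the supremum of the
potential over the support of `f`, bounds from below the probability that `x + W` ever visits the
support of `f`. -/
lemma IsRegularBrownianMotion.potential_le_mul_measure_visit (hW : IsRegularBrownianMotion W P)
    (hf : Measurable f) (x : EuclideanSpace ℝ (Fin d)) {S : ENNReal}
    (hS : ∀ T : ℝ≥0, ∀ z, f z ≠ 0 → potential P (fun t ω => W (T + t) ω - W T ω) f z ≤ S)
    (hfin : potential P W f x ≠ ⊤) :
    potential P W f x ≤ 2 * S * P {ω | ∃ t : ℝ≥0, f (x + W t ω) ≠ 0} := by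
  have mfW : Measurable (fun p : Ω × ℝ => f (x + W p.2.toNNReal p.1)) :=
    hf.comp ((hW.measurable_uncurry.comp measurable_swap).const_add x)
  set Z : Ω → ENNReal := fun ω => ∫⁻ s in Set.Ioi (0 : ℝ), f (x + W s.toNNReal ω) with hZ
  have mZ : Measurable Z := mfW.lintegral_prod_right'
  have hEZ : ∫⁻ ω, Z ω ∂P = potential P W f x := lintegral_lintegral_swap mfW.aemeasurable
  have mfut : Measurable (fun p : Ω × ℝ =>
      ∫⁻ t in Set.Ioi (0 : ℝ), f (x + W (p.2.toNNReal + t.toNNReal) p.1)) := by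
    have : Measurable (fun q : (Ω × ℝ) × ℝ =>
        f (x + W (q.1.2.toNNReal + q.2.toNNReal) q.1.1)) := by
      have h : Measurable (Function.uncurry fun (t : ℝ≥0) (ω : Ω) => W t ω) :=
        measurable_uncurry_of_continuous_of_measurable (u := fun (t : ℝ≥0) ω => W t ω)
          hW.continuous hW.measurable
      have h' : Measurable (fun q : (Ω × ℝ) × ℝ => (q.1.2.toNNReal + q.2.toNNReal, q.1.1)) := by
        fun_prop
      exact hf.comp ((h.comp h').const_add x)
    exact this.lintegral_prod_right'
  -- The earlier of the two times contributes only if the motion is then in the support of `f`,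
  -- where the expected future contribution is at most `S`.
  have hsecond : ∫⁻ ω, Z ω * Z ω ∂P ≤ 2 * S * potential P W f x := by
    calc ∫⁻ ω, Z ω * Z ω ∂P
        ≤ ∫⁻ ω, (2 * ∫⁻ s in Set.Ioi (0 : ℝ), f (x + W s.toNNReal ω) *
          ∫⁻ t in Set.Ioi (0 : ℝ), f (x + W (s.toNNReal + t.toNNReal) ω)) ∂P := by
          refine lintegral_mono fun ω => ?_
          refine (lintegral_mul_lintegral_le (mfW.comp measurable_prodMk_left)).trans_eq ?_
          congr 1
          refine setLIntegral_congr_fun measurableSet_Ioi fun s hs => ?_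
          simp only [Function.comp_apply]
          rw [lintegral_toNNReal_add (fun t => f (x + W t ω)), Real.coe_toNNReal s (le_of_lt hs)]
      _ = 2 * ∫⁻ s in Set.Ioi (0 : ℝ), ∫⁻ ω, f (x + W s.toNNReal ω) *
          (∫⁻ t in Set.Ioi (0 : ℝ), f (x + W (s.toNNReal + t.toNNReal) ω)) ∂P := by
          refine (lintegral_const_mul _ (mfW.mul mfut).lintegral_prod_right').trans ?_
          congr 1
          exact lintegral_lintegral_swap (mfW.mul mfut).aemeasurable
      _ ≤ 2 * ∫⁻ s in Set.Ioi (0 : ℝ), ∫⁻ ω, f (x + W s.toNNReal ω) * S ∂P := by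
          refine mul_le_mul_right (lintegral_mono fun s => ?_) _
          rw [hW.lintegral_mul_potential s.toNNReal
            (h := fun p => f (x + p ⟨s.toNNReal, Set.self_mem_Iic⟩))
            (hf.comp (by fun_prop)) hf x]
          refine lintegral_mono fun ω => ?_
          by_cases h : f (x + W s.toNNReal ω) = 0
          · simp only [h, zero_mul, le_refl]
          · exact mul_le_mul_right (hS _ _ h) _
      _ = 2 * S * potential P W f x := by
          have : ∀ s : ℝ, ∫⁻ ω, f (x + W s.toNNReal ω) * S ∂P =
              S * ∫⁻ ω, f (x + W s.toNNReal ω) ∂P := by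
            intro s
            rw [mul_comm S]
            exact lintegral_mul_const S (hf.comp ((hW.measurable _).const_add x))
          simp only [this]
          rw [lintegral_const_mul, mul_assoc]
          · rfl
          · exact (mfW.comp measurable_swap).lintegral_prod_right'
  have hset : {ω | Z ω ≠ 0} ⊆ {ω | ∃ t : ℝ≥0, f (x + W t ω) ≠ 0} := by
    intro ω hω
    by_contra hno
    simp only [Set.mem_ofPred_eq, not_exists, not_not] at hno
    exact hω (by simp [hZ, hno])
  have mset : MeasurableSet {ω | Z ω ≠ 0} :=
    (measurableSet_singleton (0 : ENNReal)).compl.preimage mZ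
  -- Cauchy–Schwarz for the product of `Z` with the indicator of `Z ≠ 0`.
  have hCS : (∫⁻ ω, Z ω ∂P) ^ 2 ≤ (∫⁻ ω, Z ω * Z ω ∂P) * P {ω | Z ω ≠ 0} := by
    have h := ENNReal.lintegral_mul_le_Lp_mul_Lq P Real.HolderConjugate.two_two mZ.aemeasurable
      (measurable_one.indicator mset :
        Measurable ({ω | Z ω ≠ 0}.indicator (1 : Ω → ENNReal))).aemeasurable
    have e1 : ∫⁻ ω, (Z * {ω | Z ω ≠ 0}.indicator (1 : Ω → ENNReal)) ω ∂P = ∫⁻ ω, Z ω ∂P := by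
      refine lintegral_congr fun ω => ?_
      by_cases h : Z ω = 0 <;> simp [h]
    have e2 : ∫⁻ ω, {ω | Z ω ≠ 0}.indicator (1 : Ω → ENNReal) ω ^ (2 : ℝ) ∂P =
        P {ω | Z ω ≠ 0} := by
      rw [← lintegral_indicator_one mset]
      refine lintegral_congr fun ω => ?_
      by_cases h : Z ω = 0 <;> simp [h]
    have e3 : ∫⁻ ω, Z ω ^ (2 : ℝ) ∂P = ∫⁻ ω, Z ω * Z ω ∂P := by
      refine lintegral_congr fun ω => ?_
      rw [ENNReal.rpow_two, sq]
    rw [e1, e2, e3] at h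
    calc (∫⁻ ω, Z ω ∂P) ^ 2 ≤ ((∫⁻ ω, Z ω * Z ω ∂P) ^ (1 / 2 : ℝ) *
          P {ω | Z ω ≠ 0} ^ (1 / 2 : ℝ)) ^ 2 := by gcongr
      _ = _ := by
        rw [mul_pow, ← ENNReal.rpow_two, ← ENNReal.rpow_two, ← ENNReal.rpow_mul,
          ← ENNReal.rpow_mul]
        simp
  rw [hEZ] at hCS
  by_cases h0 : potential P W f x = 0
  · simp [h0]
  have h2 : potential P W f x * potential P W f x ≤
      potential P W f x * (2 * S * P {ω | ∃ t : ℝ≥0, f (x + W t ω) ≠ 0}) := by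
    calc _ = potential P W f x ^ 2 := (sq _).symm
      _ ≤ _ := hCS
      _ ≤ (2 * S * potential P W f x) * P {ω | ∃ t : ℝ≥0, f (x + W t ω) ≠ 0} := by
          gcongr
      _ = _ := by ring
  exact (ENNReal.mul_le_mul_iff_right h0 hfin).1 h2

end Potential

/-! ### Sums over the centres against radial integrals -/

section Sums

variable {d : ℕ} {c : ℕ → EuclideanSpace ℝ (Fin d)} {ε R : ℝ}

lemma finite_centres_dist_le (hε : 0 < ε) (hsep : ∀ n m, n ≠ m → 2 * ε ≤ dist (c n) (c m))
    (x : EuclideanSpace ℝ (Fin d)) (M : ℝ) : {n | dist (c n) x ≤ M}.Finite := by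
  by_contra hinf
  obtain ⟨u, hu⟩ : ∃ u : ℕ ↪ ℕ, ∀ n, dist (c (u n)) x ≤ M :=
    ⟨(Set.Infinite.natEmbedding _ hinf).trans (Function.Embedding.subtype _),
      fun n => (Set.Infinite.natEmbedding _ hinf n).2⟩
  obtain ⟨a, -, θ, hθ, hlim⟩ := (isCompact_closedBall x M).tendsto_subseq
    (x := fun n => c (u n)) fun n => hu n
  obtain ⟨N, hN⟩ := Metric.cauchySeq_iff.1 hlim.cauchySeq (2 * ε) (by linarith)
  have h1 := hN N le_rfl (N + 1) (Nat.le_succ N)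
  have h2 : u (θ N) ≠ u (θ (N + 1)) :=
    fun h => absurd (u.injective h) (hθ (Nat.lt_succ_self N)).ne
  exact absurd (hsep _ _ h2) (not_le.2 h1)

lemma lintegral_ofReal_norm (hd : 3 ≤ d) {f : ℝ → ℝ} (hf : ∀ s, 0 ≤ f s)
    (hint : IntegrableOn (fun s => s ^ (d - 1) * f s) (Set.Ioi 0)) :
    ∫⁻ x : EuclideanSpace ℝ (Fin d), ENNReal.ofReal (f ‖x‖) =
      ENNReal.ofReal (d * (volume : Measure (EuclideanSpace ℝ (Fin d))).real (Metric.ball 0 1) *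
        ∫ s in Set.Ioi 0, s ^ (d - 1) * f s) := by
  have : Nonempty (Fin d) := ⟨⟨0, by omega⟩⟩
  have h1 : Integrable (fun x : EuclideanSpace ℝ (Fin d) => f ‖x‖) := by
    rw [integrable_fun_norm_addHaar (volume : Measure (EuclideanSpace ℝ (Fin d)))]
    simpa using hint
  rw [← ofReal_integral_eq_lintegral_ofReal h1 (Filter.Eventually.of_forall fun x => hf _),
    integral_fun_norm_addHaar]
  simp [mul_assoc]

/-- Comparison of a sum with an integral, for a packing by balls. -/
lemma sum_mul_volume_le_lintegral {F : EuclideanSpace ℝ (Fin d) → ENNReal} (I : Finset ℕ)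
    (b : ℕ → EuclideanSpace ℝ (Fin d)) {δ : ℝ} (a : ℕ → ENNReal)
    (hsep : ∀ n ∈ I, ∀ m ∈ I, n ≠ m → Disjoint (Metric.ball (b n) δ) (Metric.ball (b m) δ))
    (hF : ∀ n ∈ I, ∀ x ∈ Metric.ball (b n) δ, a n ≤ F x) :
    (∑ n ∈ I, a n) * volume (Metric.ball (0 : EuclideanSpace ℝ (Fin d)) δ) ≤ ∫⁻ x, F x := by
  calc (∑ n ∈ I, a n) * volume (Metric.ball (0 : EuclideanSpace ℝ (Fin d)) δ)
      = ∑ n ∈ I, ∫⁻ _x in Metric.ball (b n) δ, a n := by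
        rw [Finset.sum_mul]
        refine Finset.sum_congr rfl fun n _ => ?_
        rw [setLIntegral_const, Measure.addHaar_ball_center volume (b n)]
    _ ≤ ∑ n ∈ I, ∫⁻ x in Metric.ball (b n) δ, F x :=
        Finset.sum_le_sum fun n hn => setLIntegral_mono' measurableSet_ball (hF n hn)
    _ = ∫⁻ x in ⋃ n ∈ I, Metric.ball (b n) δ, F x :=
        (lintegral_biUnion_finset (fun n hn m hm h => hsep n hn m hm h)
          (fun n _ => measurableSet_ball) _).symm
    _ ≤ _ := setLIntegral_le_lintegral _ _

lemma integrableOn_truncated_id (s : ℝ) :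
    IntegrableOn ((Set.Iio s).indicator (fun r : ℝ => r)) (Set.Ioi 0) := by
  rw [IntegrableOn, integrable_indicator_iff measurableSet_Iio, IntegrableOn,
    Measure.restrict_restrict measurableSet_Iio]
  have : Set.Iio s ∩ Set.Ioi 0 = Set.Ioo 0 s := by ext; simp [and_comm]
  rw [this]
  exact (continuous_id.integrableOn_Icc (a := 0) (b := s)).mono_set Set.Ioo_subset_Icc_self

lemma pow_mul_inv_pow_eq (hd : 3 ≤ d) {r : ℝ} (hr : 0 < r) :
    r ^ (d - 1) * (r⁻¹) ^ (d - 2) = r := by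
  have : d - 1 = (d - 2) + 1 := by omega
  rw [this, pow_succ, mul_right_comm, ← mul_pow, mul_inv_cancel₀ hr.ne', one_pow, one_mul]

/-- Sums of the Newtonian kernel over separated points. -/
lemma exists_sum_inv_dist_le (hd : 3 ≤ d) (hε : 0 < ε)
    (hsep : ∀ n m, n ≠ m → 2 * ε ≤ dist (c n) (c m)) :
    ∃ C : ℝ, 0 < C ∧ ∀ (z : EuclideanSpace ℝ (Fin d)) (s : ℝ) (I : Finset ℕ),
      (∀ n ∈ I, ε ≤ dist z (c n) ∧ dist z (c n) ≤ s) →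
        ∑ n ∈ I, ((dist z (c n))⁻¹) ^ (d - 2) ≤ C * s ^ 2 := by
  have : Nonempty (Fin d) := ⟨⟨0, by omega⟩⟩
  set v := (volume : Measure (EuclideanSpace ℝ (Fin d))).real (Metric.ball 0 ε) with hv
  have hv0 : 0 < v := ENNReal.toReal_pos (Metric.measure_ball_pos _ _ hε).ne'
    measure_ball_lt_top.ne
  set v₁ := (volume : Measure (EuclideanSpace ℝ (Fin d))).real (Metric.ball 0 1) with hv₁
  have hv₁0 : 0 < v₁ := ENNReal.toReal_pos (Metric.measure_ball_pos _ _ one_pos).ne'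
    measure_ball_lt_top.ne
  have hd0 : (0 : ℝ) < d := by exact_mod_cast (by omega : 0 < d)
  refine ⟨2 ^ (d - 2) * (d * v₁ * 2) / v, by positivity, fun z s I hI => ?_⟩
  rcases I.eq_empty_or_nonempty with rfl | ⟨n₀, hn₀⟩
  · simp; positivity
  have hs : ε ≤ s := (hI n₀ hn₀).1.trans (hI n₀ hn₀).2
  -- The factors 2 absorb the passage from `c n` to a point of the ball of radius `ε` around it: as
  -- `dist z (c n) ≥ ε`, the distance to `z` at most doubles.
  set f : ℝ → ℝ := (Set.Iio (2 * s)).indicator fun r => (2 * |r|⁻¹) ^ (d - 2) with hf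
  have hf0 : ∀ r, 0 ≤ f r := fun r => Set.indicator_nonneg (fun r _ => by positivity) r
  have hfr : ∀ r ∈ Set.Ioi (0 : ℝ), r ^ (d - 1) * f r =
      2 ^ (d - 2) * (Set.Iio (2 * s)).indicator (fun r : ℝ => r) r := by
    intro r hr
    by_cases h : r ∈ Set.Iio (2 * s)
    · rw [hf, Set.indicator_of_mem h, Set.indicator_of_mem h, abs_of_pos hr, mul_pow,
        mul_left_comm, pow_mul_inv_pow_eq hd hr]
    · rw [hf, Set.indicator_of_notMem h, Set.indicator_of_notMem h, mul_zero, mul_zero]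
  have hfi : IntegrableOn (fun r => r ^ (d - 1) * f r) (Set.Ioi 0) :=
    (integrableOn_congr_fun hfr measurableSet_Ioi).2 ((integrableOn_truncated_id _).const_mul _)
  have hfI : ∫ r in Set.Ioi 0, r ^ (d - 1) * f r = 2 ^ (d - 2) * (2 * s ^ 2) := by
    rw [setIntegral_congr_fun measurableSet_Ioi hfr, integral_const_mul,
      setIntegral_indicator measurableSet_Iio]
    have : Set.Ioi (0 : ℝ) ∩ Set.Iio (2 * s) = Set.Ioo 0 (2 * s) := Set.Ioi_inter_Iio
    rw [this, ← integral_Ioc_eq_integral_Ioo, ← intervalIntegral.integral_of_le (by linarith),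
      integral_id]
    ring
  have key := sum_mul_volume_le_lintegral (F := fun x => ENNReal.ofReal (f ‖x - z‖)) I c
    (fun n => ENNReal.ofReal (((dist z (c n))⁻¹) ^ (d - 2))) (δ := ε)
    (fun n _ m _ h => Metric.ball_disjoint_ball (by linarith [hsep n m h])) (fun n hn x hx => by
      refine ENNReal.ofReal_le_ofReal ?_
      have h1 : dist x (c n) < ε := hx
      have h2 : ‖x - z‖ ≤ dist x (c n) + dist z (c n) := by
        rw [← dist_eq_norm]; exact dist_triangle_right _ _ _
      have hz := hI n hn
      have h3 : 0 < ‖x - z‖ := by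
        have : x ≠ z := by
          rintro rfl
          linarith
        exact norm_pos_iff.2 (sub_ne_zero.2 this)
      rw [hf, Set.indicator_of_mem (by simp only [Set.mem_Iio]; linarith), abs_norm]
      gcongr
      rw [← div_eq_mul_inv, inv_eq_one_div, div_le_div_iff₀ (by linarith) h3]
      linarith)
  rw [lintegral_sub_right_eq_self (fun x => ENNReal.ofReal (f ‖x‖)) z,
    lintegral_ofReal_norm hd hf0 hfi, hfI, ← ENNReal.ofReal_sum_of_nonneg fun n _ => by positivity,
    ← ENNReal.ofReal_toReal measure_ball_lt_top.ne, ← ENNReal.ofReal_mul (by positivity),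
    ENNReal.ofReal_le_ofReal_iff (by positivity)] at key
  rw [div_mul_eq_mul_div, le_div_iff₀ hv0]
  refine key.trans_eq ?_
  ring

variable {ψ : ℝ → ℝ}

lemma intervalIntegrable_id_mul (hψ : AntitoneOn ψ (Set.Ioi 0)) {a b : ℝ} (ha : 0 < a)
    (hb : 0 < b) : IntervalIntegrable (fun s => s * ψ s) volume a b := by
  refine IntervalIntegrable.continuousOn_mul (AntitoneOn.intervalIntegrable fun x hx y hy h => ?_)
    continuousOn_id
  have hpos : ∀ x ∈ Set.uIcc a b, 0 < x := fun x hx => lt_of_lt_of_le (lt_min ha hb) hx.1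
  exact hψ (hpos x hx) (hpos y hy) h

/-- On `[t / 2, t]` the function is at least `ψ t`, and `s` integrates to `3 * t ^ 2 / 8`; three
times this exceeds `t ^ 2`. -/
lemma mul_sq_le_integral (hψ : AntitoneOn ψ (Set.Ioi 0)) {t : ℝ} (ht : 0 < t) (h0 : 0 ≤ ψ t) :
    ψ t * t ^ 2 ≤ 3 * ∫ s in (t / 2)..t, s * ψ s := by
  have h1 : ∫ s in (t / 2)..t, s * ψ t ≤ ∫ s in (t / 2)..t, s * ψ s := by
    refine intervalIntegral.integral_mono_on (by linarith)
      ((continuous_id.mul continuous_const).intervalIntegrable _ _)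
      (intervalIntegrable_id_mul hψ (by linarith) ht) fun s hs => ?_
    have hs0 : 0 < s := lt_of_lt_of_le (by linarith) hs.1
    exact mul_le_mul_of_nonneg_left (hψ hs0 ht hs.2) hs0.le
  rw [intervalIntegral.integral_mul_const, integral_id] at h1
  nlinarith [mul_nonneg h0 (sq_nonneg t)]

/-- Covering estimate: the integral is controlled by the sum over a relatively dense set of
points. -/
lemma exists_integral_le_sum (hd : 3 ≤ d) (hR : 0 < R) (hdense : ∀ x, ∃ n, c n ∈ Metric.ball x R)
    (hψ : AntitoneOn ψ (Set.Ioi 0)) (hψ0 : ∀ s, 0 < s → 0 ≤ ψ s) :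
    ∃ C : ℝ, 0 < C ∧ ∀ (M : ℝ) (I : Finset ℕ), 1 + 2 * R ≤ M →
      (∀ n, 1 ≤ ‖c n‖ → ‖c n‖ ≤ M → n ∈ I) →
      (∀ n ∈ I, c n ≠ 0) →
      ∫ s in (1 + 2 * R)..M, s * ψ s ≤ C * ∑ n ∈ I, ψ ‖c n‖ * (‖c n‖⁻¹) ^ (d - 2) := by
  have : Nonempty (Fin d) := ⟨⟨0, by omega⟩⟩
  set v := (volume : Measure (EuclideanSpace ℝ (Fin d))).real (Metric.ball 0 (2 * R)) with hv
  have hv0 : 0 < v := ENNReal.toReal_pos (Metric.measure_ball_pos _ _ (by linarith)).ne'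
    measure_ball_lt_top.ne
  set v₁ := (volume : Measure (EuclideanSpace ℝ (Fin d))).real (Metric.ball 0 1) with hv₁
  have hv₁0 : 0 < v₁ := ENNReal.toReal_pos (Metric.measure_ball_pos _ _ one_pos).ne'
    measure_ball_lt_top.ne
  have hd0 : (0 : ℝ) < d := by exact_mod_cast (by omega : 0 < d)
  refine ⟨v / (d * v₁), by positivity, fun M I hM hI hI0 => ?_⟩
  set f : ℝ → ℝ := (Set.Ioc (1 + 2 * R) M).indicator fun r => ψ r * (r⁻¹) ^ (d - 2) with hf
  have hf0 : ∀ r, 0 ≤ f r := fun r => Set.indicator_nonneg (fun r hr => by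
    have hr0 : 0 < r := lt_trans (by linarith) hr.1
    have := hψ0 r hr0
    positivity) r
  have hfr : ∀ r ∈ Set.Ioi (0 : ℝ), r ^ (d - 1) * f r =
      (Set.Ioc (1 + 2 * R) M).indicator (fun r : ℝ => r * ψ r) r := by
    intro r hr
    by_cases h : r ∈ Set.Ioc (1 + 2 * R) M
    · rw [hf, Set.indicator_of_mem h, Set.indicator_of_mem h, mul_left_comm,
        pow_mul_inv_pow_eq hd hr, mul_comm]
    · rw [hf, Set.indicator_of_notMem h, Set.indicator_of_notMem h, mul_zero]
  have hsub : Set.Ioi (0 : ℝ) ∩ Set.Ioc (1 + 2 * R) M = Set.Ioc (1 + 2 * R) M :=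
    Set.inter_eq_right.2 fun r hr => Set.mem_Ioi.2 (lt_trans (by linarith) hr.1)
  have hint := intervalIntegrable_id_mul hψ (a := 1 + 2 * R) (b := M) (by linarith) (by linarith)
  rw [intervalIntegrable_iff_integrableOn_Ioc_of_le hM] at hint
  have hfi : IntegrableOn (fun r => r ^ (d - 1) * f r) (Set.Ioi 0) := by
    refine (integrableOn_congr_fun hfr measurableSet_Ioi).2 ?_
    rw [IntegrableOn, integrable_indicator_iff measurableSet_Ioc, IntegrableOn,
      Measure.restrict_restrict measurableSet_Ioc, Set.inter_comm, hsub]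
    exact hint
  have hfI : ∫ r in Set.Ioi 0, r ^ (d - 1) * f r = ∫ s in (1 + 2 * R)..M, s * ψ s := by
    rw [setIntegral_congr_fun measurableSet_Ioi hfr, setIntegral_indicator measurableSet_Ioc,
      hsub, intervalIntegral.integral_of_le hM]
  have key : ∫⁻ x : EuclideanSpace ℝ (Fin d), ENNReal.ofReal (f ‖x‖) ≤
      ∑ n ∈ I, ENNReal.ofReal (ψ ‖c n‖ * (‖c n‖⁻¹) ^ (d - 2)) *
        volume (Metric.ball (0 : EuclideanSpace ℝ (Fin d)) (2 * R)) := by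
    calc ∫⁻ x : EuclideanSpace ℝ (Fin d), ENNReal.ofReal (f ‖x‖)
        ≤ ∫⁻ x : EuclideanSpace ℝ (Fin d), ∑ n ∈ I, (Metric.ball (c n) (2 * R)).indicator
          (fun _ => ENNReal.ofReal (ψ ‖c n‖ * (‖c n‖⁻¹) ^ (d - 2))) x := by
          refine lintegral_mono fun x => ?_
          by_cases hx : ‖x‖ ∈ Set.Ioc (1 + 2 * R) M
          · have hx0 : 0 < ‖x‖ := lt_trans (by linarith) hx.1
            -- Pulling `x` towards the origin by `R` before looking for a centre ensures `‖c n‖ ≤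
            -- ‖x‖`, the direction in which monotonicity helps.
            obtain ⟨n, hn⟩ := hdense ((1 - R / ‖x‖) • x)
            have hy1 : ‖(1 - R / ‖x‖) • x‖ = ‖x‖ - R := by
              rw [norm_smul, Real.norm_eq_abs, abs_of_nonneg, sub_mul, div_mul_cancel₀ _ hx0.ne',
                one_mul]
              rw [sub_nonneg, div_le_one hx0]
              linarith [hx.1]
            have hy2 : dist ((1 - R / ‖x‖) • x) x = R := by
              rw [dist_eq_norm, sub_smul, one_smul, sub_sub_cancel_left, norm_neg, norm_smul,
                Real.norm_eq_abs, abs_of_pos (by positivity), div_mul_cancel₀ _ hx0.ne']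
            have hn' : dist (c n) ((1 - R / ‖x‖) • x) < R := hn
            have h1 : ‖c n‖ ≤ ‖x‖ := by
              have := norm_le_norm_add_norm_sub' (c n) ((1 - R / ‖x‖) • x)
              rw [← dist_eq_norm, hy1] at this
              linarith
            have h2 : 1 ≤ ‖c n‖ := by
              have := norm_le_norm_add_norm_sub' ((1 - R / ‖x‖) • x) (c n)
              rw [← dist_eq_norm, hy1, dist_comm] at this
              linarith [hx.1]
            have h3 : x ∈ Metric.ball (c n) (2 * R) := by
              have : dist x (c n) ≤ dist x ((1 - R / ‖x‖) • x) + dist (c n) ((1 - R / ‖x‖) • x) :=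
                dist_triangle_right x (c n) ((1 - R / ‖x‖) • x)
              rw [dist_comm] at hy2
              rw [Metric.mem_ball]
              linarith
            refine le_trans ?_ (Finset.single_le_sum (fun _ _ => zero_le)
              (hI n h2 (h1.trans hx.2)))
            rw [Set.indicator_of_mem h3, hf, Set.indicator_of_mem hx]
            refine ENNReal.ofReal_le_ofReal ?_
            have hc0 : 0 < ‖c n‖ := by linarith
            have := hψ0 ‖x‖ hx0
            gcongr
            exact hψ0 _ hc0
            exact hψ hc0 hx0 h1
          · rw [hf, Set.indicator_of_notMem hx, ENNReal.ofReal_zero]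
            exact zero_le
      _ = _ := by
          rw [lintegral_finsetSum _ fun n _ => measurable_const.indicator measurableSet_ball]
          refine Finset.sum_congr rfl fun n _ => ?_
          rw [lintegral_indicator measurableSet_ball, setLIntegral_const,
            Measure.addHaar_ball_center volume (c n)]
  have hI' : ∀ n ∈ I, 0 ≤ ψ ‖c n‖ * (‖c n‖⁻¹) ^ (d - 2) := fun n hn => by
    have := hψ0 ‖c n‖ (norm_pos_iff.2 (hI0 n hn))
    positivity
  have hsum0 := Finset.sum_nonneg hI'
  rw [lintegral_ofReal_norm hd hf0 hfi, hfI, ← Finset.sum_mul,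
    ← ENNReal.ofReal_sum_of_nonneg hI',
    ← ENNReal.ofReal_toReal (measure_ball_lt_top (x := (0 : EuclideanSpace ℝ (Fin d)))
      (r := 2 * R)).ne, ← ENNReal.ofReal_mul hsum0,
    ENNReal.ofReal_le_ofReal_iff (mul_nonneg hsum0 ENNReal.toReal_nonneg)] at key
  rw [div_mul_eq_mul_div, le_div_iff₀ (by positivity)]
  calc _ = d * v₁ * ∫ s in (1 + 2 * R)..M, s * ψ s := by ring
    _ ≤ _ := key
    _ = _ := mul_comm _ _

/-- Packing estimate: over separated points the sum converges as soon as the integral does. -/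
lemma summable_of_integrableOn (hd : 3 ≤ d) (hε : 0 < ε)
    (hsep : ∀ n m, n ≠ m → 2 * ε ≤ dist (c n) (c m))
    (hψ : AntitoneOn ψ (Set.Ioi 0)) (hψ0 : ∀ s, 0 < s → 0 ≤ ψ s)
    (hint : IntegrableOn (fun s => s * ψ s) (Set.Ioi 1)) :
    Summable (fun n : {n // c n ≠ 0} => ψ ‖c n‖ * (‖c n‖⁻¹) ^ (d - 2)) := by
  have : Nonempty (Fin d) := ⟨⟨0, by omega⟩⟩
  set v := (volume : Measure (EuclideanSpace ℝ (Fin d))).real (Metric.ball 0 (ε / 2)) with hv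
  have hv0 : 0 < v := ENNReal.toReal_pos (Metric.measure_ball_pos _ _ (by linarith)).ne'
    measure_ball_lt_top.ne
  set v₁ := (volume : Measure (EuclideanSpace ℝ (Fin d))).real (Metric.ball 0 1) with hv₁
  set f : ℝ → ℝ := (Set.Ioi 1).indicator fun r => ψ r * (r⁻¹) ^ (d - 2) with hf
  have hf0 : ∀ r, 0 ≤ f r := fun r => Set.indicator_nonneg (fun r hr => by
    have hr0 : 0 < r := lt_trans one_pos hr
    have := hψ0 r hr0
    positivity) r
  have hfr : ∀ r ∈ Set.Ioi (0 : ℝ), r ^ (d - 1) * f r =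
      (Set.Ioi 1).indicator (fun r : ℝ => r * ψ r) r := by
    intro r hr
    by_cases h : r ∈ Set.Ioi (1 : ℝ)
    · rw [hf, Set.indicator_of_mem h, Set.indicator_of_mem h, mul_left_comm,
        pow_mul_inv_pow_eq hd hr, mul_comm]
    · rw [hf, Set.indicator_of_notMem h, Set.indicator_of_notMem h, mul_zero]
  have hfi : IntegrableOn (fun r => r ^ (d - 1) * f r) (Set.Ioi 0) := by
    refine (integrableOn_congr_fun hfr measurableSet_Ioi).2 ?_
    rw [IntegrableOn, integrable_indicator_iff measurableSet_Ioi, IntegrableOn,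
      Measure.restrict_restrict measurableSet_Ioi]
    exact hint.mono_set Set.inter_subset_left
  set K := d * v₁ * ∫ r in Set.Ioi 0, r ^ (d - 1) * f r with hK
  have hterm : ∀ n : {n // c n ≠ 0}, 0 ≤ ψ ‖c n‖ * (‖c n‖⁻¹) ^ (d - 2) := fun n => by
    have := hψ0 ‖c n‖ (norm_pos_iff.2 n.2)
    positivity
  have hfin : {n : {n // c n ≠ 0} | ‖c n‖ ≤ 1 + ε}.Finite := by
    have := finite_centres_dist_le hε hsep 0 (1 + ε)
    simp only [dist_zero_right] at this
    exact this.preimage Subtype.val_injective.injOn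
  -- The finitely many centres of norm at most `1 + ε` are dropped, so that the packing balls used
  -- for the others stay in `‖x‖ > 1`.
  rw [← hfin.summable_compl_iff]
  refine summable_of_sum_le (fun n => hterm n) (c := K / v) fun J => ?_
  set I : Finset ℕ := J.image (fun n => n.1.1) with hIdef
  have hJI : ∑ n ∈ J, ψ ‖c n‖ * (‖c n‖⁻¹) ^ (d - 2) =
      ∑ n ∈ I, ψ ‖c n‖ * (‖c n‖⁻¹) ^ (d - 2) := by
    rw [hIdef, Finset.sum_image]
    exact fun a _ b _ h => Subtype.ext (Subtype.ext h)
  have hI : ∀ n ∈ I, 1 + ε < ‖c n‖ := by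
    intro n hn
    obtain ⟨m, -, rfl⟩ := Finset.mem_image.1 hn
    exact not_le.1 m.2
  -- The half-size ball is moved towards the origin by its own radius: it remains inside the ball of
  -- radius `ε` around `c n`, hence disjoint from the others, and all its points have norm at most
  -- `‖c n‖`.
  have hb : ∀ n ∈ I, dist ((1 - ε / 2 / ‖c n‖) • c n) (c n) = ε / 2 ∧
      ‖(1 - ε / 2 / ‖c n‖) • c n‖ = ‖c n‖ - ε / 2 := by
    intro n hn
    have hn0 := hI n hn
    have hc0 : 0 < ‖c n‖ := by linarith
    constructor
    · rw [dist_eq_norm, sub_smul, one_smul, sub_sub_cancel_left, norm_neg, norm_smul,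
        Real.norm_eq_abs, abs_of_pos (by positivity), div_mul_cancel₀ _ hc0.ne']
    · rw [norm_smul, Real.norm_eq_abs, abs_of_nonneg, sub_mul, div_mul_cancel₀ _ hc0.ne', one_mul]
      rw [sub_nonneg, div_le_one hc0]
      linarith
  have key := sum_mul_volume_le_lintegral (F := fun x => ENNReal.ofReal (f ‖x‖)) I
    (fun n => (1 - ε / 2 / ‖c n‖) • c n) (δ := ε / 2)
    (fun n => ENNReal.ofReal (ψ ‖c n‖ * (‖c n‖⁻¹) ^ (d - 2)))
    (fun n hn m hm h => by
      have h1 : Metric.ball ((1 - ε / 2 / ‖c n‖) • c n) (ε / 2) ⊆ Metric.ball (c n) ε :=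
        Metric.ball_subset_ball' (by linarith [(hb n hn).1])
      have h2 : Metric.ball ((1 - ε / 2 / ‖c m‖) • c m) (ε / 2) ⊆ Metric.ball (c m) ε :=
        Metric.ball_subset_ball' (by linarith [(hb m hm).1])
      exact (Metric.ball_disjoint_ball (by linarith [hsep n m h])).mono h1 h2)
    (fun n hn x hx => by
      refine ENNReal.ofReal_le_ofReal ?_
      have hx' : dist x ((1 - ε / 2 / ‖c n‖) • c n) < ε / 2 := hx
      have h1 := norm_le_norm_add_norm_sub' x ((1 - ε / 2 / ‖c n‖) • c n)
      have h2 := norm_le_norm_add_norm_sub' ((1 - ε / 2 / ‖c n‖) • c n) x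
      rw [← dist_eq_norm, (hb n hn).2] at h1 h2
      rw [dist_comm] at h2
      have hn0 := hI n hn
      have hx1 : 1 < ‖x‖ := by linarith
      have hxc : ‖x‖ ≤ ‖c n‖ := by linarith
      have hx0 : 0 < ‖x‖ := by linarith
      have hc0 : 0 < ‖c n‖ := by linarith
      rw [hf, Set.indicator_of_mem (Set.mem_Ioi.2 hx1)]
      have := hψ0 ‖x‖ hx0
      gcongr
      exact hψ hx0 hc0 hxc)
  have hI' : ∀ n ∈ I, 0 ≤ ψ ‖c n‖ * (‖c n‖⁻¹) ^ (d - 2) := fun n hn => by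
    have := hψ0 ‖c n‖ (by linarith [hI n hn])
    positivity
  have hK0 : 0 ≤ K := by
    have : 0 ≤ ∫ r in Set.Ioi 0, r ^ (d - 1) * f r :=
      setIntegral_nonneg measurableSet_Ioi fun r hr => mul_nonneg (pow_nonneg (le_of_lt hr) _)
        (hf0 r)
    positivity
  rw [lintegral_ofReal_norm hd hf0 hfi, ← ENNReal.ofReal_sum_of_nonneg hI',
    ← ENNReal.ofReal_toReal (measure_ball_lt_top (x := (0 : EuclideanSpace ℝ (Fin d)))
      (r := ε / 2)).ne, ← ENNReal.ofReal_mul (Finset.sum_nonneg hI'),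
    ENNReal.ofReal_le_ofReal_iff hK0] at key
  rw [le_div_iff₀ hv0]
  exact (congrArg (· * v) hJI).le.trans key

end Sums

/-! ### Sums of relative capacities seen from an arbitrary point -/

section Energy

variable {d : ℕ} {c : ℕ → EuclideanSpace ℝ (Fin d)} {ε R : ℝ} {φ : ℝ → ℝ}

lemma antitoneOn_pow (hφ : AntitoneOn φ (Set.Ioi 0)) (hφ0 : ∀ s, 0 < s → 0 < φ s) (k : ℕ) :
    AntitoneOn (fun s => φ s ^ k) (Set.Ioi 0) :=
  fun _ hx y hy h => pow_le_pow_left₀ (hφ0 y hy).le (hφ hx hy h) k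

/-- A centre nearer to `z` than a quarter of its norm has `‖c n‖ ≥ 4 / 5 * ‖z‖`, so `φ` can be
frozen at that radius, leaving a Newtonian sum over distances at most `‖z‖`. -/
lemma exists_near_sum_le (hd : 3 ≤ d) (hε : 0 < ε)
    (hsep : ∀ n m, n ≠ m → 2 * ε ≤ dist (c n) (c m))
    (hφ : AntitoneOn φ (Set.Ioi 0)) (hφ0 : ∀ s, 0 < s → 0 < φ s) :
    ∃ C : ℝ, 0 < C ∧ ∀ (z : EuclideanSpace ℝ (Fin d)) (I : Finset ℕ),
      (∀ n ∈ I, c n ≠ 0 ∧ ε ≤ dist z (c n) ∧ dist z (c n) < ‖c n‖ / 4) →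
        ∑ n ∈ I, (φ ‖c n‖ / dist z (c n)) ^ (d - 2) ≤
          C * (φ (4 / 5 * ‖z‖) ^ (d - 2) * (4 / 5 * ‖z‖) ^ 2) := by
  obtain ⟨C, hC, h⟩ := exists_sum_inv_dist_le hd hε hsep
  refine ⟨C * (25 / 16), by positivity, fun z I hI => ?_⟩
  rcases I.eq_empty_or_nonempty with rfl | ⟨n₀, hn₀⟩
  · rcases eq_or_ne z 0 with rfl | hz
    · simp
    · have := hφ0 (4 / 5 * ‖z‖) (by positivity)
      simp only [Finset.sum_empty]
      positivity
  have hnorm : ∀ n ∈ I, 4 / 5 * ‖z‖ ≤ ‖c n‖ ∧ dist z (c n) ≤ ‖z‖ := by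
    intro n hn
    have h1 := norm_le_norm_add_norm_sub' z (c n)
    have h2 := norm_le_norm_add_norm_sub' (c n) z
    rw [← dist_eq_norm] at h1 h2
    rw [dist_comm] at h2
    have := (hI n hn).2.2
    constructor <;> linarith
  have hz : 0 < ‖z‖ := by
    have := hI n₀ hn₀
    linarith [(hnorm n₀ hn₀).2]
  have hφz := hφ0 (4 / 5 * ‖z‖) (by positivity)
  calc ∑ n ∈ I, (φ ‖c n‖ / dist z (c n)) ^ (d - 2)
      ≤ ∑ n ∈ I, φ (4 / 5 * ‖z‖) ^ (d - 2) * ((dist z (c n))⁻¹) ^ (d - 2) := by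
        refine Finset.sum_le_sum fun n hn => ?_
        have hc : 0 < ‖c n‖ := norm_pos_iff.2 (hI n hn).1
        rw [div_eq_mul_inv, mul_pow]
        have := (hφ0 _ hc).le
        have hz' : (4 / 5 * ‖z‖) ∈ Set.Ioi (0 : ℝ) := Set.mem_Ioi.2 (by positivity)
        gcongr
        exact hφ hz' hc (hnorm n hn).1
    _ = φ (4 / 5 * ‖z‖) ^ (d - 2) * ∑ n ∈ I, ((dist z (c n))⁻¹) ^ (d - 2) :=
        (Finset.mul_sum _ _ _).symm
    _ ≤ φ (4 / 5 * ‖z‖) ^ (d - 2) * (C * ‖z‖ ^ 2) := by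
        gcongr
        exact h z ‖z‖ I fun n hn => ⟨(hI n hn).2.1, (hnorm n hn).2⟩
    _ = _ := by ring

/-- Complements `exists_near_sum_le`: for the remaining centres the kernel seen from `z` is
dominated by the one seen from the origin. -/
lemma far_term_le {d : ℕ} {a D r : ℝ} (ha : 0 ≤ a) (hr : 0 < r) (h : r / 4 ≤ D) :
    (a / D) ^ (d - 2) ≤ 4 ^ (d - 2) * (a ^ (d - 2) * (r⁻¹) ^ (d - 2)) := by
  rw [← mul_pow, ← mul_pow]
  have hD : 0 < D := by linarith
  gcongr
  rw [← div_eq_mul_inv, ← mul_div_assoc, div_le_div_iff₀ hD hr]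
  nlinarith

/-- By `mul_sq_le_integral` the quantity is at most three times the integral over `[t / 2, t]`,
which vanishes in the limit when the integral converges. -/
lemma tendsto_pow_mul_sq (hφ : AntitoneOn φ (Set.Ioi 0)) (hφ0 : ∀ s, 0 < s → 0 < φ s) (k : ℕ)
    (hint : IntegrableOn (fun s => s * φ s ^ k) (Set.Ioi 1)) :
    Filter.Tendsto (fun t => φ t ^ k * t ^ 2) Filter.atTop (nhds 0) := by
  have h1 := intervalIntegral_tendsto_integral_Ioi 1 hint Filter.tendsto_id
  have h2 := intervalIntegral_tendsto_integral_Ioi 1 hint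
    (Filter.tendsto_id.atTop_div_const (zero_lt_two' ℝ))
  have h3 := (h1.sub h2).const_mul 3
  rw [sub_self, mul_zero] at h3
  refine squeeze_zero' ?_ ?_ h3
  · filter_upwards [Filter.eventually_gt_atTop 0] with t ht
    have := hφ0 t ht
    positivity
  · filter_upwards [Filter.eventually_gt_atTop 0] with t ht
    have hanti := antitoneOn_pow hφ hφ0 k
    refine (mul_sq_le_integral hanti ht (pow_nonneg (hφ0 t ht).le _)).trans_eq ?_
    have hi : ∀ a b : ℝ, 0 < a → 0 < b → IntervalIntegrable (fun s => s * φ s ^ k) volume a b :=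
      fun a b ha hb => intervalIntegrable_id_mul hanti ha hb
    simp only [id]
    rw [intervalIntegral.integral_interval_sub_left (hi _ _ one_pos ht)
      (hi _ _ one_pos (by linarith))]

/-- If the integral converges, then far away from the origin and at a fixed distance from all the
centres the sum of the capacities relative to the observer is small. -/
lemma eventually_sum_le (hd : 3 ≤ d) (hε : 0 < ε)
    (hsep : ∀ n m, n ≠ m → 2 * ε ≤ dist (c n) (c m))
    (hφ : AntitoneOn φ (Set.Ioi 0)) (hφ0 : ∀ s, 0 < s → 0 < φ s)
    (hint : IntegrableOn (fun s => s * φ s ^ (d - 2)) (Set.Ioi 1)) {κ : ℝ} (hκ : 0 < κ) :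
    ∀ᶠ y in Bornology.cobounded (EuclideanSpace ℝ (Fin d)), (∀ n, ε ≤ dist y (c n)) →
      ∀ I : Finset ℕ, (∀ n ∈ I, c n ≠ 0) →
        ∑ n ∈ I, (φ ‖c n‖ / dist y (c n)) ^ (d - 2) ≤ κ := by
  classical
  obtain ⟨C, hC, hnear⟩ := exists_near_sum_le hd hε hsep hφ hφ0
  have hsum := summable_of_integrableOn hd hε hsep (antitoneOn_pow hφ hφ0 (d - 2))
    (fun s hs => pow_nonneg (hφ0 s hs).le _) hint
  have hsum' := (summable_subtype_iff_indicator (s := {n | c n ≠ 0})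
    (f := fun n => φ ‖c n‖ ^ (d - 2) * (‖c n‖⁻¹) ^ (d - 2))).1 hsum
  obtain ⟨s₀, hs₀⟩ := summable_iff_vanishing_norm.1 hsum' (κ / 3 / 4 ^ (d - 2)) (by positivity)
  have e1 : ∀ᶠ y in Bornology.cobounded (EuclideanSpace ℝ (Fin d)),
      C * (φ (4 / 5 * ‖y‖) ^ (d - 2) * (4 / 5 * ‖y‖) ^ 2) < κ / 3 := by
    have h1 : Filter.Tendsto (fun y : EuclideanSpace ℝ (Fin d) => 4 / 5 * ‖y‖)
        (Bornology.cobounded _) Filter.atTop :=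
      tendsto_norm_cobounded_atTop.const_mul_atTop (by norm_num)
    have h2 := ((tendsto_pow_mul_sq hφ hφ0 (d - 2) hint).comp h1).const_mul C
    rw [mul_zero] at h2
    exact h2.eventually_lt_const (by positivity)
  have e2 : ∀ᶠ y in Bornology.cobounded (EuclideanSpace ℝ (Fin d)),
      ∑ n ∈ s₀, (|φ ‖c n‖| / dist y (c n)) ^ (d - 2) < κ / 3 := by
    have h1 : Filter.Tendsto (fun y : EuclideanSpace ℝ (Fin d) =>
        ∑ n ∈ s₀, (|φ ‖c n‖| / dist y (c n)) ^ (d - 2)) (Bornology.cobounded _) (nhds 0) := by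
      rw [← Finset.sum_const_zero (s := s₀)]
      refine tendsto_finsetSum _ fun n _ => ?_
      have h2 : Filter.Tendsto (fun y : EuclideanSpace ℝ (Fin d) => |φ ‖c n‖| / dist y (c n))
          (Bornology.cobounded _) (nhds 0) :=
        (Metric.tendsto_dist_right_cobounded_atTop (c n)).const_div_atTop _
      simpa [zero_pow (by omega : d - 2 ≠ 0)] using h2.pow (d - 2)
    exact h1.eventually_lt_const (by positivity)
  filter_upwards [e1, e2] with y h1 h2 hy I hI
  have hpos : ∀ n ∈ I, 0 < φ ‖c n‖ := fun n hn => hφ0 _ (norm_pos_iff.2 (hI n hn))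
  -- Three parts, each at most `κ / 3`: the finite set `s₀`, whose terms tend to 0 as `y` recedes;
  -- the centres near `y`; and the rest, which lies in the tail of the series seen from the origin.
  rw [← Finset.sum_filter_add_sum_filter_not I (· ∈ s₀),
    ← Finset.sum_filter_add_sum_filter_not (I.filter (· ∉ s₀)) (fun n => dist y (c n) < ‖c n‖ / 4)]
  have b1 : ∑ n ∈ I.filter (· ∈ s₀), (φ ‖c n‖ / dist y (c n)) ^ (d - 2) ≤ κ / 3 := by
    refine le_trans ?_ h2.le
    calc _ = ∑ n ∈ I.filter (· ∈ s₀), (|φ ‖c n‖| / dist y (c n)) ^ (d - 2) := by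
          refine Finset.sum_congr rfl fun n hn => ?_
          rw [abs_of_pos (hpos n (Finset.mem_filter.1 hn).1)]
      _ ≤ _ := by
          refine Finset.sum_le_sum_of_subset_of_nonneg
            (fun n hn => (Finset.mem_filter.1 hn).2) fun n _ _ => by positivity
  have b2 : ∑ n ∈ (I.filter (· ∉ s₀)).filter (fun n => dist y (c n) < ‖c n‖ / 4),
      (φ ‖c n‖ / dist y (c n)) ^ (d - 2) ≤ κ / 3 := by
    refine (hnear y _ fun n hn => ?_).trans h1.le
    simp only [Finset.mem_filter] at hn
    exact ⟨hI n hn.1.1, hy n, hn.2⟩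
  have b3 : ∑ n ∈ (I.filter (· ∉ s₀)).filter (fun n => ¬ dist y (c n) < ‖c n‖ / 4),
      (φ ‖c n‖ / dist y (c n)) ^ (d - 2) ≤ κ / 3 := by
    set J := (I.filter (· ∉ s₀)).filter (fun n => ¬ dist y (c n) < ‖c n‖ / 4) with hJ
    have hJm : ∀ n ∈ J, n ∈ I ∧ n ∉ s₀ ∧ ‖c n‖ / 4 ≤ dist y (c n) := by
      intro n hn
      simp only [hJ, Finset.mem_filter, not_lt] at hn
      exact ⟨hn.1.1, hn.1.2, hn.2⟩
    have h3 := hs₀ J (Finset.disjoint_left.2 fun n hn => (hJm n hn).2.1)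
    calc ∑ n ∈ J, (φ ‖c n‖ / dist y (c n)) ^ (d - 2)
        ≤ ∑ n ∈ J, 4 ^ (d - 2) * Set.indicator {n | c n ≠ 0}
          (fun n => φ ‖c n‖ ^ (d - 2) * (‖c n‖⁻¹) ^ (d - 2)) n := by
          refine Finset.sum_le_sum fun n hn => ?_
          have hn' := hJm n hn
          rw [Set.indicator_of_mem (show n ∈ {n | c n ≠ 0} from hI n hn'.1)]
          exact far_term_le (hpos n hn'.1).le (norm_pos_iff.2 (hI n hn'.1)) hn'.2.2
      _ = 4 ^ (d - 2) * ∑ n ∈ J, Set.indicator {n | c n ≠ 0}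
          (fun n => φ ‖c n‖ ^ (d - 2) * (‖c n‖⁻¹) ^ (d - 2)) n := (Finset.mul_sum _ _ _).symm
      _ ≤ 4 ^ (d - 2) * (κ / 3 / 4 ^ (d - 2)) := by
          gcongr
          exact (le_abs_self _).trans h3.le
      _ = κ / 3 := by field_simp
  linarith

/-- The energy bound: at a point of a ball, the sum of the relative capacities of the other balls
is controlled by the sum of the relative capacities seen from the origin. -/
lemma exists_energy_bound (hd : 3 ≤ d) (hε : 0 < ε) (hε1 : ε ≤ 1) (hR : 0 < R)
    (hsep : ∀ n m, n ≠ m → 2 * ε ≤ dist (c n) (c m)) (hdense : ∀ x, ∃ n, c n ∈ Metric.ball x R)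
    (hφ : AntitoneOn φ (Set.Ioi 0)) (hφ0 : ∀ s, 0 < s → 0 < φ s) :
    ∃ C : ℝ, 0 < C ∧ ∀ (M : ℝ) (I : Finset ℕ), 2 ≤ M → (∀ n, n ∈ I ↔ 1 ≤ ‖c n‖ ∧ ‖c n‖ ≤ M) →
      ∀ (z : EuclideanSpace ℝ (Fin d)), ∀ m ∈ I, dist z (c m) ≤ ε / 2 →
        ∑ n ∈ I.erase m, (φ ‖c n‖ / dist z (c n)) ^ (d - 2) ≤
          C * (1 + ∑ n ∈ I, φ ‖c n‖ ^ (d - 2) * (‖c n‖⁻¹) ^ (d - 2)) := by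
  classical
  obtain ⟨C₁, hC₁, hnear⟩ := exists_near_sum_le hd hε hsep hφ hφ0
  have hanti := antitoneOn_pow hφ hφ0 (d - 2)
  have hψ0 : ∀ s, 0 < s → 0 ≤ φ s ^ (d - 2) := fun s hs => pow_nonneg (hφ0 s hs).le _
  obtain ⟨C₂, hC₂, hcover⟩ := exists_integral_le_sum hd hR hdense hanti hψ0
  have hK : 0 ≤ φ (2 / 5) ^ (d - 2) * (2 * (1 + 2 * R)) ^ 2 := by
    have := hψ0 (2 / 5) (by norm_num)
    positivity
  set K := φ (2 / 5) ^ (d - 2) * (2 * (1 + 2 * R)) ^ 2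
  refine ⟨C₁ * (K + 3 * C₂) + 4 ^ (d - 2), by positivity, fun M I hM hI z m hm hz => ?_⟩
  set S := ∑ n ∈ I, φ ‖c n‖ ^ (d - 2) * (‖c n‖⁻¹) ^ (d - 2) with hS
  have hc : ∀ n ∈ I, 0 < ‖c n‖ := fun n hn => by linarith [((hI n).1 hn).1]
  have hterm : ∀ n ∈ I, 0 ≤ φ ‖c n‖ ^ (d - 2) * (‖c n‖⁻¹) ^ (d - 2) := fun n hn => by
    have := hψ0 _ (hc n hn)
    positivity
  have hS0 : 0 ≤ S := Finset.sum_nonneg hterm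
  have hzm1 := norm_le_norm_add_norm_sub' z (c m)
  have hzm2 := norm_le_norm_add_norm_sub' (c m) z
  rw [← dist_eq_norm] at hzm1 hzm2
  rw [dist_comm] at hzm2
  have hm' := (hI m).1 hm
  set t := 4 / 5 * ‖z‖ with ht
  -- For large `t` the left side is controlled by the integral up to `t`, hence by `S` through the
  -- covering estimate; this needs `t ≤ M`, which `‖z‖ ≤ M + 1 / 2` and `M ≥ 2` provide. For smaller
  -- `t` the constant `K` suffices, since `‖z‖ ≥ 1 / 2` gives `t ≥ 2 / 5`.
  have hbound : φ t ^ (d - 2) * t ^ 2 ≤ K + 3 * C₂ * S := by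
    have ht1 : 2 / 5 ≤ t := by linarith
    have ht0 : 0 < t := by linarith
    by_cases hbig : 2 * (1 + 2 * R) ≤ t
    · have h1 := mul_sq_le_integral hanti ht0 (hψ0 t ht0)
      have h2 : ∫ s in (t / 2)..t, s * φ s ^ (d - 2) ≤
          ∫ s in (1 + 2 * R)..t, s * φ s ^ (d - 2) := by
        have := intervalIntegral.integral_add_adjacent_intervals
          (intervalIntegrable_id_mul hanti (a := 1 + 2 * R) (b := t / 2) (by linarith)
            (by linarith)) (intervalIntegrable_id_mul hanti (a := t / 2) (b := t) (by linarith) ht0)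
        have h3 : 0 ≤ ∫ s in (1 + 2 * R)..(t / 2), s * φ s ^ (d - 2) :=
          intervalIntegral.integral_nonneg (by linarith) fun s hs => by
            have hs0 : 0 < s := lt_of_lt_of_le (by linarith) hs.1
            exact mul_nonneg hs0.le (hψ0 s hs0)
        linarith
      have h3 := hcover t I (by linarith)
        (fun n h1 h2 => (hI n).2 ⟨h1, h2.trans (by linarith)⟩)
        (fun n hn => norm_pos_iff.1 (hc n hn))
      linarith
    · have h1 : φ t ^ (d - 2) ≤ φ (2 / 5) ^ (d - 2) :=
        hanti (Set.mem_Ioi.2 (by norm_num)) ht0 ht1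
      have h2 : t ^ 2 ≤ (2 * (1 + 2 * R)) ^ 2 := by
        push Not at hbig
        gcongr
      have h3 : φ t ^ (d - 2) * t ^ 2 ≤ K :=
        mul_le_mul h1 h2 (sq_nonneg _) (hψ0 _ (by norm_num))
      have : 0 ≤ 3 * C₂ * S := by positivity
      linarith
  have hdist : ∀ n ∈ I.erase m, ε ≤ dist z (c n) := by
    intro n hn
    have h1 := hsep n m (Finset.ne_of_mem_erase hn)
    have h2 := dist_triangle_left (c n) (c m) z
    linarith
  rw [← Finset.sum_filter_add_sum_filter_not (I.erase m) (fun n => dist z (c n) < ‖c n‖ / 4)]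
  have b1 := hnear z ((I.erase m).filter fun n => dist z (c n) < ‖c n‖ / 4) fun n hn => by
    rw [Finset.mem_filter] at hn
    exact ⟨norm_pos_iff.1 (hc n (Finset.mem_of_mem_erase hn.1)), hdist n hn.1, hn.2⟩
  have b2 : ∑ n ∈ (I.erase m).filter (fun n => ¬ dist z (c n) < ‖c n‖ / 4),
      (φ ‖c n‖ / dist z (c n)) ^ (d - 2) ≤ 4 ^ (d - 2) * S := by
    calc _ ≤ ∑ n ∈ (I.erase m).filter (fun n => ¬ dist z (c n) < ‖c n‖ / 4),
          4 ^ (d - 2) * (φ ‖c n‖ ^ (d - 2) * (‖c n‖⁻¹) ^ (d - 2)) := by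
          refine Finset.sum_le_sum fun n hn => ?_
          rw [Finset.mem_filter, not_lt] at hn
          have hcn := hc n (Finset.mem_of_mem_erase hn.1)
          exact far_term_le (hφ0 _ hcn).le hcn hn.2
      _ = 4 ^ (d - 2) * ∑ n ∈ (I.erase m).filter (fun n => ¬ dist z (c n) < ‖c n‖ / 4),
          φ ‖c n‖ ^ (d - 2) * (‖c n‖⁻¹) ^ (d - 2) := (Finset.mul_sum _ _ _).symm
      _ ≤ _ := by
          gcongr
          exact Finset.sum_le_sum_of_subset_of_nonneg
            ((Finset.filter_subset _ _).trans (Finset.erase_subset _ _)) fun n hn _ => hterm n hn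
  have b3 : C₁ * (φ t ^ (d - 2) * t ^ 2) ≤ C₁ * (K + 3 * C₂ * S) := by gcongr
  have h4 : (0 : ℝ) ≤ 4 ^ (d - 2) := by positivity
  have h5 : 0 ≤ C₁ * (3 * C₂) := by positivity
  have h6 : 0 ≤ C₁ * K * S := by positivity
  calc _ ≤ C₁ * (K + 3 * C₂ * S) + 4 ^ (d - 2) * S := add_le_add (b1.trans b3) b2
    _ ≤ _ := by nlinarith

/-- If the integral diverges then so does the sum of the relative capacities. -/
lemma exists_sum_gt (hd : 3 ≤ d) (hR : 0 < R) (hdense : ∀ x, ∃ n, c n ∈ Metric.ball x R)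
    (hφ : AntitoneOn φ (Set.Ioi 0)) (hφ0 : ∀ s, 0 < s → 0 < φ s)
    (hint : ¬ IntegrableOn (fun s => s * φ s ^ (d - 2)) (Set.Ioi 1)) (K : ℝ) :
    ∃ M : ℝ, K ≤ M ∧ ∀ I : Finset ℕ, (∀ n, n ∈ I ↔ 1 ≤ ‖c n‖ ∧ ‖c n‖ ≤ M) →
      K < ∑ n ∈ I, φ ‖c n‖ ^ (d - 2) * (‖c n‖⁻¹) ^ (d - 2) := by
  have hanti := antitoneOn_pow hφ hφ0 (d - 2)
  have hψ0 : ∀ s, 0 < s → 0 ≤ φ s ^ (d - 2) := fun s hs => pow_nonneg (hφ0 s hs).le _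
  obtain ⟨C, hC, hcover⟩ := exists_integral_le_sum hd hR hdense hanti hψ0
  by_contra! hcon
  apply hint
  have hA : (0 : ℝ) < 1 + 2 * R := by linarith
  have hi : ∀ a b : ℝ, 0 < a → 0 < b →
      IntervalIntegrable (fun s => s * φ s ^ (d - 2)) volume a b :=
    fun a b ha hb => intervalIntegrable_id_mul hanti ha hb
  have hIoi : IntegrableOn (fun s => s * φ s ^ (d - 2)) (Set.Ioi (1 + 2 * R)) := by
    refine integrableOn_Ioi_of_intervalIntegral_norm_bounded (C * K) (1 + 2 * R)
      (b := fun M : ℝ => M) (l := Filter.atTop) (fun M => ?_) Filter.tendsto_id ?_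
    · rcases le_total (1 + 2 * R) M with hM | hM
      · exact (intervalIntegrable_iff_integrableOn_Ioc_of_le hM).1 (hi _ _ hA (hA.trans_le hM))
      · simp [Set.Ioc_eq_empty (not_lt.2 hM)]
    · filter_upwards [Filter.eventually_ge_atTop (1 + 2 * R), Filter.eventually_ge_atTop K]
        with M hM hMK
      obtain ⟨I, hI, hle⟩ := hcon M hMK
      have h1 := hcover M I hM (fun n h1 h2 => (hI n).2 ⟨h1, h2⟩) fun n hn =>
        norm_pos_iff.1 (by linarith [((hI n).1 hn).1])
      have h2 : ∫ s in (1 + 2 * R)..M, ‖s * φ s ^ (d - 2)‖ =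
          ∫ s in (1 + 2 * R)..M, s * φ s ^ (d - 2) := by
        refine intervalIntegral.integral_congr fun s hs => ?_
        rw [Set.uIcc_of_le hM] at hs
        have hs0 : 0 < s := hA.trans_le hs.1
        exact abs_of_nonneg (mul_nonneg hs0.le (hψ0 s hs0))
      rw [h2]
      exact h1.trans (by gcongr)
  have hIoc := (intervalIntegrable_iff_integrableOn_Ioc_of_le
    (by linarith : (1 : ℝ) ≤ 1 + 2 * R)).1 (hi 1 (1 + 2 * R) one_pos hA)
  rw [← Set.Ioc_union_Ioi_eq_Ioi (by linarith : (1 : ℝ) ≤ 1 + 2 * R)]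
  exact hIoc.union hIoi

end Energy

/-! ### Escaping to infinity through the complement of the balls -/

section Geometry

variable {d : ℕ}

/-- Two vectors span at most a plane, which is not the whole space. -/
lemma exists_ne_zero_orthogonal (hd : 3 ≤ d) (u p : EuclideanSpace ℝ (Fin d)) :
    ∃ e : EuclideanSpace ℝ (Fin d), e ≠ 0 ∧ inner ℝ u e = 0 ∧ inner ℝ p e = 0 := by
  classical
  set K := Submodule.span ℝ (({u, p} : Finset (EuclideanSpace ℝ (Fin d))) :
    Set (EuclideanSpace ℝ (Fin d))) with hK
  have hlt : Module.finrank ℝ K < d := by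
    have h1 := finrank_span_finset_le_card (R := ℝ) ({u, p} : Finset (EuclideanSpace ℝ (Fin d)))
    have h2 := Finset.card_le_two (a := u) (b := p)
    exact lt_of_le_of_lt (h1.trans h2) (by omega)
  have hbot : Kᗮ ≠ ⊥ := by
    intro h
    rw [Submodule.orthogonal_eq_bot_iff] at h
    rw [h, finrank_top, finrank_euclideanSpace_fin] at hlt
    exact lt_irrefl _ hlt
  obtain ⟨e, he, he0⟩ := Submodule.exists_mem_ne_zero_of_ne_bot hbot
  refine ⟨e, he0, ?_, ?_⟩
  · exact (Submodule.mem_orthogonal K e).1 he u (Submodule.subset_span (by simp))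
  · exact (Submodule.mem_orthogonal K e).1 he p (Submodule.subset_span (by simp))

/-- The complement of the union of the closed balls. -/
def freeRegion (c : ℕ → EuclideanSpace ℝ (Fin d)) (r : ℕ → ℝ) : Set (EuclideanSpace ℝ (Fin d)) :=
  {x | ∀ n, x ∉ Metric.closedBall (c n) (r n)}

/-- Points joined by a polygonal path in the complement of the closed balls. -/
def PolygonallyJoined (c : ℕ → EuclideanSpace ℝ (Fin d)) (r : ℕ → ℝ) :
    EuclideanSpace ℝ (Fin d) → EuclideanSpace ℝ (Fin d) → Prop :=
  Relation.ReflTransGen fun a b => segment ℝ a b ⊆ freeRegion c r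

variable {c : ℕ → EuclideanSpace ℝ (Fin d)} {r : ℕ → ℝ}

lemma PolygonallyJoined.mem_freeRegion {x y : EuclideanSpace ℝ (Fin d)}
    (h : PolygonallyJoined c r x y) (hx : x ∈ freeRegion c r) : y ∈ freeRegion c r := by
  cases h with
  | refl => exact hx
  | tail _ h => exact h (right_mem_segment ℝ _ _)

lemma isOpen_freeRegion (hlf : LocallyFinite fun n => Metric.closedBall (c n) (r n)) :
    IsOpen (freeRegion c r) := by
  have h := hlf.isClosed_iUnion fun n => Metric.isClosed_closedBall
  rw [← isOpen_compl_iff] at h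
  convert h using 1
  ext x
  simp [freeRegion]

/-- The triangle inequality through the common boundary point `p` is an equality, so the centres lie
on opposite sides of `p` on one line. Expanding the square of `r n • b + r m • a` makes this
explicit. -/
lemma centre_sub_eq_smul {n m : ℕ} {p : EuclideanSpace ℝ (Fin d)} (hn : 0 < r n) (hm : 0 < r m)
    (hdisj : Disjoint (Metric.ball (c n) (r n)) (Metric.ball (c m) (r m)))
    (hpn : dist p (c n) = r n) (hpm : dist p (c m) = r m) :
    c m = p + (-r m) • ((r n)⁻¹ • (c n - p)) := by
  rw [disjoint_ball_ball_iff hn hm] at hdisj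
  set a := c n - p with ha
  set b := c m - p with hb
  have hna : ‖a‖ = r n := by rw [ha, ← dist_eq_norm, dist_comm, hpn]
  have hnb : ‖b‖ = r m := by rw [hb, ← dist_eq_norm, dist_comm, hpm]
  have hab : r n + r m ≤ ‖a - b‖ := by
    rwa [ha, hb, sub_sub_sub_cancel_right, ← dist_eq_norm]
  have h1 : (r n + r m) ^ 2 ≤ ‖a - b‖ ^ 2 := by gcongr
  rw [norm_sub_sq_real, hna, hnb] at h1
  have h2 : ‖r n • b + r m • a‖ ^ 2 ≤ 0 := by
    rw [norm_add_sq_real, norm_smul, norm_smul, inner_smul_left, inner_smul_right, hna, hnb,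
      real_inner_comm]
    simp only [Real.norm_eq_abs, abs_of_pos hn, abs_of_pos hm, conj_trivial]
    nlinarith [mul_pos hn hm]
  have h3 : r n • b + r m • a = 0 := by
    rw [← norm_eq_zero]
    nlinarith [norm_nonneg (r n • b + r m • a)]
  have h4 : b = (-r m) • ((r n)⁻¹ • a) := by
    have : r n • b = -(r m • a) := eq_neg_of_add_eq_zero_left h3
    calc b = (r n)⁻¹ • (r n • b) := by rw [smul_smul, inv_mul_cancel₀ hn.ne', one_smul]
      _ = _ := by rw [this, smul_neg, smul_comm, neg_smul]
  rw [← h4, hb]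
  abel

/-- The polygonal component of a point in the complement of locally finitely many non-overlapping
closed balls is unbounded: a farthest point of its closure would be a point of tangency of at most
two balls, and one could move away from it within the common tangent hyperplane. -/
lemma exists_polygonallyJoined_norm_gt (hd : 3 ≤ d)
    (hlf : LocallyFinite fun n => Metric.closedBall (c n) (r n)) (hdisj : NonOverlapping c r)
    (hr : ∀ n, r n ≠ 0) {x₀ : EuclideanSpace ℝ (Fin d)} (hx₀ : x₀ ∈ freeRegion c r) (M : ℝ) :
    ∃ y, PolygonallyJoined c r x₀ y ∧ M < ‖y‖ := by
  by_contra! hM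
  set U := freeRegion c r with hU
  set D := {y | PolygonallyJoined c r x₀ y} with hD
  have hUo : IsOpen U := isOpen_freeRegion hlf
  have hDU : D ⊆ U := fun y hy => hy.mem_freeRegion hx₀
  have hstep : ∀ y ∈ D, ∀ b, segment ℝ y b ⊆ U → b ∈ D := fun y hy b hb => hy.tail hb
  have hDo : IsOpen D := by
    rw [Metric.isOpen_iff]
    intro y hy
    obtain ⟨δ, hδ, hb⟩ := Metric.isOpen_iff.1 hUo y (hDU hy)
    exact ⟨δ, hδ, fun z hz => hstep y hy z
      (((convex_ball y δ).segment_subset (Metric.mem_ball_self hδ) hz).trans hb)⟩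
  have hcomp : IsCompact (closure D) :=
    (isCompact_closedBall 0 M).of_isClosed_subset isClosed_closure
      (closure_minimal (fun y hy => by simpa using hM y hy) Metric.isClosed_closedBall)
  obtain ⟨p, hp, hmax⟩ := hcomp.exists_isMaxOn (f := fun y => ‖y‖)
    ⟨x₀, subset_closure Relation.ReflTransGen.refl⟩ continuous_norm.continuousOn
  -- By Pythagoras a step orthogonal to `p` increases the norm; the contradiction will come from
  -- such a step that stays in `D`.
  have hfar : ∀ e : EuclideanSpace ℝ (Fin d), e ≠ 0 → inner ℝ p e = 0 → p + e ∉ D := by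
    intro e he hpe hmem
    have h1 : ‖p + e‖ ≤ ‖p‖ := hmax (subset_closure hmem)
    have h2 : ‖p + e‖ ^ 2 ≤ ‖p‖ ^ 2 := by gcongr
    rw [norm_add_sq_real, hpe] at h2
    have h3 : 0 < ‖e‖ := norm_pos_iff.2 he
    nlinarith
  have hclose : ∀ ρ > 0, ∃ y ∈ D, dist y p < ρ := by
    intro ρ hρ
    obtain ⟨y, hy, h⟩ := Metric.mem_closure_iff.1 hp ρ hρ
    exact ⟨y, hy, by rwa [dist_comm]⟩
  set N := {n | p ∈ Metric.closedBall (c n) (r n)} with hN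
  have hNr : ∀ n ∈ N, 0 < r n := fun n hn =>
    lt_of_le_of_ne (dist_nonneg.trans (Metric.mem_closedBall.1 hn)) (hr n).symm
  have hNd : ∀ n ∈ N, dist p (c n) = r n := by
    intro n hn
    refine le_antisymm (Metric.mem_closedBall.1 hn) (not_lt.1 fun hlt => ?_)
    obtain ⟨y, hy, hyp⟩ := hclose (r n - dist p (c n)) (by linarith)
    refine hDU hy n (Metric.mem_closedBall.2 ?_)
    linarith [dist_triangle y p (c n)]
  have hNfin : N.Finite := hlf.point_finite p
  obtain ⟨ρ₁, hρ₁, hball₁⟩ : ∃ ρ > 0, ∀ x, dist x p < ρ → ∀ n ∉ N,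
      x ∉ Metric.closedBall (c n) (r n) := by
    have hcl : IsClosed (⋃ n : {n // n ∉ N}, Metric.closedBall (c n) (r n)) :=
      (hlf.comp_injective Subtype.val_injective).isClosed_iUnion
        fun n => Metric.isClosed_closedBall
    have hpn : p ∈ (⋃ n : {n // n ∉ N}, Metric.closedBall (c n) (r n))ᶜ := by
      simp only [Set.mem_compl_iff, Set.mem_iUnion, not_exists]
      exact fun n => n.2
    obtain ⟨ρ, hρ, hsub⟩ := Metric.isOpen_iff.1 hcl.isOpen_compl p hpn
    refine ⟨ρ, hρ, fun x hx n hn hxn => hsub hx (Set.mem_iUnion.2 ⟨⟨n, hn⟩, hxn⟩)⟩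
  obtain ⟨ρ, hρ, hρ1, hρr⟩ : ∃ ρ > 0, ρ ≤ ρ₁ ∧ ∀ n ∈ N, ρ < r n := by
    have h1 : ∀ᶠ ρ in nhdsWithin (0 : ℝ) (Set.Ioi 0), ∀ n ∈ N, ρ < r n :=
      (Filter.eventually_all_finite hNfin).2 fun n hn =>
        (eventually_lt_nhds (hNr n hn)).filter_mono nhdsWithin_le_nhds
    have h2 : ∀ᶠ ρ in nhdsWithin (0 : ℝ) (Set.Ioi 0), ρ ≤ ρ₁ :=
      (eventually_le_nhds hρ₁).filter_mono nhdsWithin_le_nhds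
    obtain ⟨ρ, h⟩ := ((h1.and h2).and self_mem_nhdsWithin).exists
    exact ⟨ρ, h.2, h.1.2, h.1.1⟩
  have hball : ∀ x, dist x p < ρ → (∀ n ∈ N, x ∉ Metric.closedBall (c n) (r n)) → x ∈ U := by
    intro x hx h n
    by_cases hn : n ∈ N
    · exact h n hn
    · exact hball₁ x (hx.trans_le hρ1) n hn
  -- the common normal direction of the balls through `p`
  obtain ⟨u, hu, hcu⟩ : ∃ u : EuclideanSpace ℝ (Fin d), ‖u‖ = 1 ∧
      ∀ n ∈ N, ∃ s : ℝ, |s| = r n ∧ c n = p + s • u := by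
    rcases N.eq_empty_or_nonempty with hemp | ⟨n₀, hn₀⟩
    · obtain ⟨e, he, -⟩ := exists_ne_zero_orthogonal hd p p
      refine ⟨‖e‖⁻¹ • e, norm_smul_inv_norm (𝕜 := ℝ) he, fun n hn => ?_⟩
      rw [hemp] at hn
      exact absurd hn (Set.notMem_empty n)
    · have h0 := hNr n₀ hn₀
      refine ⟨(r n₀)⁻¹ • (c n₀ - p), ?_, fun n hn => ?_⟩
      · rw [norm_smul, ← dist_eq_norm, dist_comm, hNd n₀ hn₀, norm_inv, Real.norm_eq_abs,
          abs_of_pos h0, inv_mul_cancel₀ h0.ne']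
      · rcases eq_or_ne n n₀ with rfl | hne
        · refine ⟨r n, abs_of_pos h0, ?_⟩
          rw [smul_smul, mul_inv_cancel₀ h0.ne', one_smul]
          abel
        · exact ⟨-r n, by rw [abs_neg, abs_of_pos (hNr n hn)], centre_sub_eq_smul h0 (hNr n hn)
            (hdisj n₀ n hne.symm) (hNd n₀ hn₀) (hNd n hn)⟩
  have hdistsq : ∀ (a s : ℝ) (w : EuclideanSpace ℝ (Fin d)), inner ℝ u w = 0 →
      dist (p + (a • u + w)) (p + s • u) ^ 2 = (a - s) ^ 2 + ‖w‖ ^ 2 := by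
    intro a s w hw
    have e : p + (a • u + w) - (p + s • u) = (a - s) • u + w := by rw [sub_smul]; abel
    rw [dist_eq_norm, e, norm_add_sq_real, inner_smul_left, hw, norm_smul, hu]
    simp
  -- In normal and tangential coordinates at `p`. In particular, nonzero displacements with `a = 0`
  -- miss every ball through `p`.
  have hout : ∀ (a s : ℝ) (w : EuclideanSpace ℝ (Fin d)) (n : ℕ), inner ℝ u w = 0 → n ∈ N →
      |s| = r n → c n = p + s • u →
      (p + (a • u + w) ∉ Metric.closedBall (c n) (r n) ↔ 0 < a ^ 2 - 2 * a * s + ‖w‖ ^ 2) := by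
    intro a s w n hw hn hs hc
    rw [Metric.mem_closedBall, not_le, ← sq_lt_sq₀ (hNr n hn).le dist_nonneg, hc,
      hdistsq a s w hw, ← hs, sq_abs]
    constructor <;> intro h <;> nlinarith
  obtain ⟨e, he0, hue, hpe⟩ := exists_ne_zero_orthogonal hd u p
  have hepos : 0 < ‖e‖ := norm_pos_iff.2 he0
  -- a point of the component near `p` off the normal line
  obtain ⟨a, w, hw0, huw, hyD, hyρ⟩ : ∃ (a : ℝ) (w : EuclideanSpace ℝ (Fin d)), w ≠ 0 ∧
      inner ℝ u w = 0 ∧ p + (a • u + w) ∈ D ∧ ‖a • u + w‖ < ρ := by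
    obtain ⟨y, hy, hyp⟩ := hclose ρ hρ
    have key : ∀ y ∈ D, dist y p < ρ → y - p - (inner ℝ u (y - p) : ℝ) • u ≠ 0 →
        ∃ (a : ℝ) (w : EuclideanSpace ℝ (Fin d)), w ≠ 0 ∧ inner ℝ u w = 0 ∧
          p + (a • u + w) ∈ D ∧ ‖a • u + w‖ < ρ := by
      intro y hy hyp hne
      refine ⟨inner ℝ u (y - p), y - p - (inner ℝ u (y - p) : ℝ) • u, hne, ?_, ?_, ?_⟩
      · rw [inner_sub_right, inner_smul_right, real_inner_self_eq_norm_sq, hu]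
        ring
      · rwa [add_sub_cancel, add_sub_cancel]
      · rwa [add_sub_cancel, ← dist_eq_norm]
    -- If `y` happens to lie on the normal line, openness of `D` allows a small move along `e`.
    by_cases hne : y - p - (inner ℝ u (y - p) : ℝ) • u = 0
    · obtain ⟨δ, hδ, hsub⟩ := Metric.isOpen_iff.1 (hDo.inter (Metric.isOpen_ball (x := p) (ε := ρ)))
        y ⟨hy, hyp⟩
      set τ := δ / (2 * ‖e‖) with hτ
      have hτ0 : 0 < τ := by positivity
      have hmem := hsub (show y + τ • e ∈ Metric.ball y δ by
        rw [Metric.mem_ball, dist_eq_norm, add_sub_cancel_left, norm_smul, Real.norm_eq_abs,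
          abs_of_pos hτ0, hτ]
        field_simp
        linarith)
      refine key _ hmem.1 hmem.2 ?_
      have : y + τ • e - p - (inner ℝ u (y + τ • e - p) : ℝ) • u = τ • e := by
        have h1 : y + τ • e - p = (y - p) + τ • e := by abel
        rw [h1, inner_add_right, inner_smul_right, hue, mul_zero, add_zero, add_sub_right_comm,
          hne, zero_add]
      rw [this]
      exact smul_ne_zero hτ0.ne' he0
    · exact key y hy hyp hne
  -- into the tangent hyperplane
  have hwnorm : ‖a • u + w‖ ^ 2 = a ^ 2 + ‖w‖ ^ 2 := by
    rw [norm_add_sq_real, inner_smul_left, huw, norm_smul, hu]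
    simp
  have hwpos : 0 < ‖w‖ := norm_pos_iff.2 hw0
  have hnormlt : ∀ (b : ℝ) (w' : EuclideanSpace ℝ (Fin d)), inner ℝ u w' = 0 →
      b ^ 2 + ‖w'‖ ^ 2 < ρ ^ 2 → dist (p + (b • u + w')) p < ρ := by
    intro b w' hw' h
    rw [dist_eq_norm, add_sub_cancel_left]
    refine lt_of_pow_lt_pow_left₀ 2 hρ.le ?_
    rw [norm_add_sq_real, inner_smul_left, hw', norm_smul, hu]
    simpa using h
  have haw : a ^ 2 + ‖w‖ ^ 2 < ρ ^ 2 := by rw [← hwnorm]; gcongr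
  have hD1 : p + w ∈ D := by
    refine hstep _ hyD _ ?_
    intro x hx
    rw [segment_eq_image'] at hx
    obtain ⟨t, ht, rfl⟩ := hx
    have e1 : p + (a • u + w) + t • (p + w - (p + (a • u + w))) =
        p + (((1 - t) * a) • u + w) := by
      rw [sub_mul, one_mul, sub_smul, mul_smul]
      have : p + w - (p + (a • u + w)) = -(a • u) := by abel
      rw [this, smul_neg]
      abel
    have ht' : 0 ≤ 1 - t ∧ 1 - t ≤ 1 := ⟨by linarith [ht.2], by linarith [ht.1]⟩
    simp only
    rw [e1]
    refine hball _ (hnormlt _ _ huw ?_) fun n hn => ?_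
    · have : ((1 - t) * a) ^ 2 ≤ a ^ 2 := by
        rw [mul_pow]
        exact mul_le_of_le_one_left (sq_nonneg a) (pow_le_one₀ ht'.1 ht'.2)
      linarith
    · obtain ⟨s, hs, hc⟩ := hcu n hn
      rw [hout _ s w n huw hn hs hc]
      have h1 := (hout a s w n huw hn hs hc).1 (hDU hyD n)
      have ha2 : a ^ 2 < s ^ 2 := by
        rw [← sq_abs s, hs]
        have := hρr n hn
        nlinarith
      have hw2 : 0 < ‖w‖ ^ 2 := by positivity
      -- With `l = 1 - t`, the quantity to keep positive is `l ^ 2 * a ^ 2 - 2 * l * a * s + ‖w‖ ^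
      -- 2`. If `a * s ≤ 0` every term is nonnegative. Otherwise `|a| < |s|` gives `a ^ 2 ≤ a * s`,
      -- so the expression decreases in `l` and is at least its value at `l = 1`, which is positive.
      rcases le_or_gt (a * s) 0 with has | has
      · nlinarith [mul_nonneg ht'.1 (neg_nonneg.2 has), sq_nonneg ((1 - t) * a)]
      · have h3 : a ^ 2 ≤ a * s := by
          have : |a| ≤ |s| := (sq_lt_sq.1 ha2).le
          calc a ^ 2 = |a| * |a| := by rw [← sq, sq_abs]
            _ ≤ |a| * |s| := by gcongr
            _ = a * s := by rw [← abs_mul, abs_of_pos has]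
        nlinarith [mul_nonneg ht.1 (sub_nonneg.2 h3),
          mul_nonneg (mul_nonneg ht.1 ht.1) (sq_nonneg a)]
  -- and away from `p`
  obtain ⟨e', he', hue', hpe', heρ, hwe⟩ : ∃ e' : EuclideanSpace ℝ (Fin d), e' ≠ 0 ∧
      inner ℝ u e' = 0 ∧ inner ℝ p e' = 0 ∧ ‖e'‖ < ρ ∧ 0 ≤ inner ℝ w e' := by
    set τ := ρ / (2 * ‖e‖) with hτ
    have hτ0 : 0 < τ := by positivity
    have hτe : ‖τ • e‖ < ρ := by
      rw [norm_smul, Real.norm_eq_abs, abs_of_pos hτ0, hτ]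
      field_simp
      linarith
    -- The sign is chosen so that the segment from `w` to `e'` does not pass through 0, that is,
    -- through `p` itself.
    rcases le_total 0 (inner ℝ w (τ • e)) with h | h
    · exact ⟨τ • e, smul_ne_zero hτ0.ne' he0, by rw [inner_smul_right, hue, mul_zero],
        by rw [inner_smul_right, hpe, mul_zero], hτe, h⟩
    · exact ⟨-(τ • e), neg_ne_zero.2 (smul_ne_zero hτ0.ne' he0),
        by rw [inner_neg_right, inner_smul_right, hue, mul_zero, neg_zero],
        by rw [inner_neg_right, inner_smul_right, hpe, mul_zero, neg_zero], by rwa [norm_neg],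
        by rw [inner_neg_right]; linarith⟩
  refine hfar e' he' hpe' (hstep _ hD1 _ ?_)
  intro x hx
  rw [segment_eq_image'] at hx
  obtain ⟨t, ht, rfl⟩ := hx
  have e1 : p + w + t • (p + e' - (p + w)) = p + ((0 : ℝ) • u + ((1 - t) • w + t • e')) := by
    rw [zero_smul, zero_add, add_sub_add_left_eq_sub, smul_sub, sub_smul, one_smul]
    abel
  have huw' : inner ℝ u ((1 - t) • w + t • e') = 0 := by
    rw [inner_add_right, inner_smul_right, inner_smul_right, huw, hue', mul_zero, mul_zero,
      add_zero]
  have hne : 0 < ‖(1 - t) • w + t • e'‖ ^ 2 := by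
    rw [norm_add_sq_real, inner_smul_left, inner_smul_right, norm_smul, norm_smul]
    simp only [Real.norm_eq_abs, conj_trivial, mul_pow, sq_abs]
    have h1 : 0 ≤ (1 - t) * (t * inner ℝ w e') :=
      mul_nonneg (by linarith [ht.2]) (mul_nonneg ht.1 hwe)
    have h2 : 0 < ‖e'‖ := norm_pos_iff.2 he'
    rcases eq_or_lt_of_le ht.1 with h0 | h0
    · rw [← h0]
      simp only [sub_zero, one_pow, one_mul, zero_mul, mul_zero]
      positivity
    · have : 0 < t ^ 2 * ‖e'‖ ^ 2 := by positivity
      have : 0 ≤ (1 - t) ^ 2 * ‖w‖ ^ 2 := by positivity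
      linarith
  simp only
  rw [e1]
  refine hball _ (hnormlt _ _ huw' ?_) fun n hn => ?_
  · have h1 : ‖w‖ < ρ := by
      refine lt_of_pow_lt_pow_left₀ 2 hρ.le ?_
      nlinarith
    have h2 : ‖(1 - t) • w + t • e'‖ < ρ := by
      have := (convex_ball (0 : EuclideanSpace ℝ (Fin d)) ρ) (x := w) (by simpa using h1)
        (y := e') (by simpa using heρ) (sub_nonneg.2 ht.2) ht.1 (by ring)
      simpa using this
    have : ‖(1 - t) • w + t • e'‖ ^ 2 < ρ ^ 2 := by gcongr
    linarith
  · obtain ⟨s, hs, hc⟩ := hcu n hn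
    rw [hout _ s _ n huw' hn hs hc]
    linarith

/-- One can move, within the complement of the balls, to a point far away from the origin and at a
definite distance from all the centres. -/
lemma exists_polygonallyJoined_far (hd : 3 ≤ d) {ε K : ℝ} (hε : 0 < ε)
    (hsep : ∀ n m, n ≠ m → 2 * ε ≤ dist (c n) (c m))
    (hK : ∀ n, r n < ε / 2 ∨ ‖c n‖ + r n ≤ K)
    (hlf : LocallyFinite fun n => Metric.closedBall (c n) (r n)) (hdisj : NonOverlapping c r)
    (hr : ∀ n, r n ≠ 0) (hneg : ∀ n, r n < 0 → c n = 0)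
    {x₀ : EuclideanSpace ℝ (Fin d)} (hx₀ : x₀ ∈ freeRegion c r) (M : ℝ) :
    ∃ y, PolygonallyJoined c r x₀ y ∧ M < ‖y‖ ∧ ∀ n, ε / 2 ≤ dist y (c n) := by
  obtain ⟨y, hy, hyM⟩ :=
    exists_polygonallyJoined_norm_gt hd hlf hdisj hr hx₀ (max (max M K) 0 + ε)
  have hyM' : M < ‖y‖ - ε ∧ K < ‖y‖ - ε ∧ 0 < ‖y‖ - ε := by
    have h1 := le_max_left (max M K) 0
    have h2 := le_max_right (max M K) 0
    have h3 := le_max_left M K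
    have h4 := le_max_right M K
    refine ⟨?_, ?_, ?_⟩ <;> linarith
  by_cases hfar : ∀ n, ε / 2 ≤ dist y (c n)
  · exact ⟨y, hy, by linarith, hfar⟩
  push Not at hfar
  obtain ⟨n, hn⟩ := hfar
  have hyU := hy.mem_freeRegion hx₀
  have hyn : r n < dist y (c n) := lt_of_not_ge fun h => hyU n (Metric.mem_closedBall.2 h)
  have hrpos : 0 < r n := by
    refine lt_of_le_of_ne (not_lt.1 fun h => ?_) (hr n).symm
    rw [hneg n h, dist_zero_right] at hn
    linarith [hyM'.2.2]
  set ℓ := dist y (c n) with hℓ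
  have hℓ0 : 0 < ℓ := hrpos.trans hyn
  -- Moving away from the single centre closer than `ε / 2` meets no other ball: small ones do not
  -- reach this far from their centres, and the others are confined to norm at most `K`.
  have hpt : ∀ a : ℝ, 1 ≤ a → a * ℓ ≤ ε / 2 → c n + a • (y - c n) ∈ freeRegion c r ∧
      dist (c n + a • (y - c n)) (c n) = a * ℓ ∧
      ∀ m, m ≠ n → ε ≤ dist (c n + a • (y - c n)) (c m) := by
    intro a ha haℓ
    have hd1 : dist (c n + a • (y - c n)) (c n) = a * ℓ := by
      rw [dist_eq_norm, add_sub_cancel_left, norm_smul, Real.norm_eq_abs,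
        abs_of_nonneg (by linarith), hℓ, dist_eq_norm]
    have hd2 : ∀ m, m ≠ n → ε ≤ dist (c n + a • (y - c n)) (c m) := by
      intro m hm
      have h1 := hsep n m hm.symm
      have h2 := dist_triangle_left (c n) (c m) (c n + a • (y - c n))
      linarith
    refine ⟨fun m hm => ?_, hd1, hd2⟩
    rw [Metric.mem_closedBall] at hm
    rcases eq_or_ne m n with rfl | hmn
    · rw [hd1] at hm
      nlinarith
    · have h1 := hd2 m hmn
      rcases hK m with h2 | h2
      · linarith
      · have h3 : ‖c n + a • (y - c n)‖ ≤ ‖c m‖ + r m := by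
          have := norm_le_norm_add_norm_sub' (c n + a • (y - c n)) (c m)
          rw [← dist_eq_norm] at this
          linarith
        have h4 : ‖y‖ ≤ ‖c n + a • (y - c n)‖ + (a * ℓ + ℓ) := by
          have h5 := norm_le_norm_add_norm_sub' y (c n + a • (y - c n))
          rw [← dist_eq_norm] at h5
          have h6 := dist_triangle_right y (c n + a • (y - c n)) (c n)
          rw [hd1] at h6
          linarith
        linarith [hyM'.2.1]
  set b := ε / 2 / ℓ with hb
  have hbℓ : b * ℓ = ε / 2 := div_mul_cancel₀ _ hℓ0.ne'
  have hb1 : 1 ≤ b := by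
    rw [hb, le_div_iff₀ hℓ0]
    linarith
  obtain ⟨-, hdn, hdm⟩ := hpt b hb1 hbℓ.le
  refine ⟨c n + b • (y - c n), hy.tail ?_, ?_, fun m => ?_⟩
  · intro x hx
    rw [segment_eq_image'] at hx
    obtain ⟨t, ht, rfl⟩ := hx
    have e1 : y + t • (c n + b • (y - c n) - y) = c n + (1 + t * (b - 1)) • (y - c n) := by
      module
    simp only
    rw [e1]
    refine (hpt _ ?_ ?_).1
    · nlinarith [mul_nonneg ht.1 (sub_nonneg.2 hb1)]
    · rw [← hbℓ]
      refine mul_le_mul_of_nonneg_right ?_ hℓ0.le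
      nlinarith [mul_nonneg (sub_nonneg.2 ht.2) (sub_nonneg.2 hb1)]
  · have h1 := norm_le_norm_add_norm_sub' y (c n + b • (y - c n))
    rw [← dist_eq_norm] at h1
    have h2 := dist_triangle_right y (c n + b • (y - c n)) (c n)
    rw [hdn, hbℓ] at h2
    linarith [hyM'.1]
  · rcases eq_or_ne m n with rfl | hmn
    · rw [hdn, hbℓ]
    · linarith [hdm m hmn]

end Geometry

/-! ### The avoidance event as a measurable set of paths -/

section Paths

variable {d : ℕ}

lemma le_of_forall_denseSeq_lt {g : ℝ≥0 → ℝ} (hg : Continuous g) {T : ℝ≥0} {a : ℝ}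
    (h : ∀ j, TopologicalSpace.denseSeq ℝ≥0 j < T → g (TopologicalSpace.denseSeq ℝ≥0 j) ≤ a)
    {t : ℝ≥0} (ht : t < T) : g t ≤ a := by
  by_contra! hlt
  have ho : IsOpen {s | s < T ∧ a < g s} := (isOpen_gt' T).inter (isOpen_lt continuous_const hg)
  obtain ⟨j, hj⟩ := (TopologicalSpace.denseRange_denseSeq ℝ≥0).exists_mem_open ho ⟨t, ht, hlt⟩
  exact absurd (h j hj.1) (not_le.2 hj.2)

/-- The paths that stay away from every ball, up to any finite time, by a positive amount. For a
continuous path this means never to hit a ball. -/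
def avoidingPaths (c : ℕ → EuclideanSpace ℝ (Fin d)) (r : ℕ → ℝ) :
    Set (ℝ≥0 → EuclideanSpace ℝ (Fin d)) :=
  {w | ∀ n N : ℕ, ∃ k : ℕ, ∀ j, TopologicalSpace.denseSeq ℝ≥0 j < N →
    r n + 1 / ((k : ℝ) + 1) ≤ dist (w (TopologicalSpace.denseSeq ℝ≥0 j)) (c n)}

lemma measurableSet_avoidingPaths (c : ℕ → EuclideanSpace ℝ (Fin d)) (r : ℕ → ℝ) :
    MeasurableSet (avoidingPaths c r) := by
  have h : avoidingPaths c r = ⋂ n : ℕ, ⋂ N : ℕ, ⋃ k : ℕ, ⋂ j : ℕ,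
      {w | TopologicalSpace.denseSeq ℝ≥0 j < N →
        r n + 1 / ((k : ℝ) + 1) ≤ dist (w (TopologicalSpace.denseSeq ℝ≥0 j)) (c n)} := by
    ext w
    simp [avoidingPaths]
  rw [h]
  refine MeasurableSet.iInter fun n => MeasurableSet.iInter fun N => MeasurableSet.iUnion fun k =>
    MeasurableSet.iInter fun j => ?_
  by_cases hj : TopologicalSpace.denseSeq ℝ≥0 j < N
  · simp only [hj, forall_const]
    exact measurableSet_le measurable_const ((measurable_pi_apply _).dist measurable_const)
  · simp [hj]

lemma mem_avoidingPaths_iff {c : ℕ → EuclideanSpace ℝ (Fin d)} {r : ℕ → ℝ}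
    {w : ℝ≥0 → EuclideanSpace ℝ (Fin d)} (hw : Continuous w) :
    w ∈ avoidingPaths c r ↔ ∀ (t : ℝ≥0) (n : ℕ), w t ∉ Metric.closedBall (c n) (r n) := by
  constructor
  · intro h t n ht
    obtain ⟨N, hN⟩ := exists_nat_gt t
    obtain ⟨k, hk⟩ := h n N
    have hg : Continuous fun s => -dist (w s) (c n) := by fun_prop
    have h1 := le_of_forall_denseSeq_lt hg (a := -(r n + 1 / ((k : ℝ) + 1)))
      (fun j hj => neg_le_neg (hk j hj)) hN
    have h2 : (0 : ℝ) < 1 / ((k : ℝ) + 1) := by positivity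
    rw [Metric.mem_closedBall] at ht
    linarith
  · intro h n N
    have hg : Continuous fun s => dist (w s) (c n) := by fun_prop
    -- On a compact time interval the distance to the centre attains its minimum, which gives a
    -- positive margin.
    obtain ⟨t, -, ht⟩ := (isCompact_Icc (a := (0 : ℝ≥0)) (b := N)).exists_isMinOn
      ⟨0, by simp⟩ hg.continuousOn
    have h1 : 0 < dist (w t) (c n) - r n := by
      have := h t n
      rw [Metric.mem_closedBall, not_le] at this
      linarith
    obtain ⟨k, hk⟩ := exists_nat_one_div_lt h1
    refine ⟨k, fun j hj => ?_⟩
    have h2 : dist (w t) (c n) ≤ dist (w (TopologicalSpace.denseSeq ℝ≥0 j)) (c n) :=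
      ht (show _ ∈ Set.Icc (0 : ℝ≥0) N from ⟨zero_le, hj.le⟩)
    linarith

variable {Ω : Type*} [MeasurableSpace Ω] {P : Measure Ω}
  {W : ℝ≥0 → Ω → EuclideanSpace ℝ (Fin d)}

lemma IsRegularBrownianMotion.continuous_add (hW : IsRegularBrownianMotion W P)
    (x : EuclideanSpace ℝ (Fin d)) (ω : Ω) : Continuous fun t => x + W t ω :=
  continuous_const.add (hW.continuous ω)

lemma IsRegularBrownianMotion.setOf_avoidingPaths (hW : IsRegularBrownianMotion W P)
    (x : EuclideanSpace ℝ (Fin d)) (c : ℕ → EuclideanSpace ℝ (Fin d)) (r : ℕ → ℝ) :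
    {ω | (fun t => x + W t ω) ∈ avoidingPaths c r} =
      {ω | ∀ (t : ℝ≥0) (n : ℕ), x + W t ω ∉ Metric.closedBall (c n) (r n)} := by
  ext ω
  exact mem_avoidingPaths_iff (w := fun t => x + W t ω) (hW.continuous_add x ω)

lemma avoidable_iff_of_ae_eq {B : ℝ≥0 → Ω → EuclideanSpace ℝ (Fin d)}
    (h : ∀ᵐ ω ∂P, ∀ t, W t ω = B t ω) (hW : IsRegularBrownianMotion W P)
    (c : ℕ → EuclideanSpace ℝ (Fin d)) (r : ℕ → ℝ) :
    Avoidable B P c r ↔ 0 < P {ω | (fun t => 0 + W t ω) ∈ avoidingPaths c r} := by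
  rw [Avoidable, hW.setOf_avoidingPaths]
  refine iff_of_eq (congrArg _ (measure_congr ?_))
  filter_upwards [h] with ω hω
  refine propext ?_
  change (∀ _ _, _) ↔ (∀ _ _, _)
  simp only [zero_add, hω]

end Paths

/-! ### Visiting probabilities and propagation of safety -/

section Visits

variable {d : ℕ} {Ω : Type*} [MeasurableSpace Ω]

/-- A ball of radius `ρ` is ever visited from `x` with a probability of order
`(ρ / dist x c) ^ (d - 2)` at most. -/
lemma exists_measure_visit_le (hd : 3 ≤ d) (P : Measure Ω) [IsProbabilityMeasure P] :
    ∃ C : ℝ, 0 < C ∧ ∀ W : ℝ≥0 → Ω → EuclideanSpace ℝ (Fin d), IsRegularBrownianMotion W P →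
      ∀ (x c : EuclideanSpace ℝ (Fin d)) (ρ : ℝ), 0 < ρ → x ≠ c →
        P {ω | ∃ t : ℝ≥0, x + W t ω ∈ Metric.closedBall c ρ} ≤
          ENNReal.ofReal (C * (ρ / dist x c) ^ (d - 2)) := by
  obtain ⟨C₁, hC₁, h1⟩ := exists_occupation_le hd P
  obtain ⟨C₂, hC₂, h2⟩ := exists_le_occupation hd P
  refine ⟨C₁ / C₂ * 2 ^ (d - 2), by positivity, fun W hW x c ρ hρ hxc => ?_⟩
  set τ := TopologicalSpace.denseSeq ℝ≥0 with hτ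
  -- The first passage estimate concerns finitely many times. By continuity, a visit to the small
  -- ball forces a visit to the doubled ball at a dense time, and the finite-time events increase.
  set A : ℕ → Set Ω := fun k =>
    {ω | ∃ q ∈ (Finset.range k).image τ, x + W q ω ∈ Metric.closedBall c (2 * ρ)} with hA
  have hmono : Monotone A := by
    intro k l hkl ω hω
    obtain ⟨q, hq, h⟩ := hω
    exact ⟨q, Finset.image_subset_image (Finset.range_mono hkl) hq, h⟩
  have hsub : {ω | ∃ t : ℝ≥0, x + W t ω ∈ Metric.closedBall c ρ} ⊆ ⋃ k, A k := by
    rintro ω ⟨t, ht⟩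
    have ho : IsOpen {s | x + W s ω ∈ Metric.ball c (2 * ρ)} :=
      Metric.isOpen_ball.preimage (hW.continuous_add x ω)
    obtain ⟨j, hj⟩ := (TopologicalSpace.denseRange_denseSeq ℝ≥0).exists_mem_open ho
      ⟨t, Metric.closedBall_subset_ball (by linarith) ht⟩
    exact Set.mem_iUnion.2 ⟨j + 1, τ j,
      Finset.mem_image_of_mem _ (Finset.mem_range.2 j.lt_succ_self),
      Metric.ball_subset_closedBall hj⟩
  refine (measure_mono hsub).trans ?_
  rw [hmono.measure_iUnion]
  refine iSup_le fun k => ?_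
  set lam := ENNReal.ofReal (C₂ * (2 * ρ) ^ 2) with hlam
  have h3 : lam * P (A k) ≤ occupation P W c (2 * ρ) x := by
    refine hW.mul_measure_visit_le x c (2 * ρ) (fun T z hz => ?_) _
    have h := h2 _ (hW.shift T) z c (2 * ρ) (2 * ρ) (by positivity) le_rfl hz
    rwa [div_self (by positivity), one_pow, mul_one] at h
  have hd0 : 0 < dist x c := dist_pos.2 hxc
  have h4 := ((h1 W hW x c (2 * ρ) (by positivity)).2 hxc)
  have h5 : ENNReal.ofReal (C₁ * (2 * ρ) ^ 2 * (2 * ρ / dist x c) ^ (d - 2)) =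
      lam * ENNReal.ofReal (C₁ / C₂ * 2 ^ (d - 2) * (ρ / dist x c) ^ (d - 2)) := by
    rw [hlam, ← ENNReal.ofReal_mul (by positivity)]
    congr 1
    rw [mul_div_assoc, mul_pow 2 (ρ / dist x c)]
    field_simp
  rw [h5] at h4
  refine (ENNReal.mul_le_mul_iff_right ?_ ENNReal.ofReal_ne_top).1 (h3.trans h4)
  exact (ENNReal.ofReal_pos.2 (by positivity)).ne'

/-- From any point near `x`, a Brownian motion avoids the balls with positive probability. -/
def IsSafe (P : Measure Ω) (c : ℕ → EuclideanSpace ℝ (Fin d)) (r : ℕ → ℝ)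
    (x : EuclideanSpace ℝ (Fin d)) : Prop :=
  ∃ δ > 0, ∀ x' ∈ Metric.ball x δ, ∀ W : ℝ≥0 → Ω → EuclideanSpace ℝ (Fin d),
    IsRegularBrownianMotion W P → 0 < P {ω | (fun t => x' + W t ω) ∈ avoidingPaths c r}

variable {P : Measure Ω} [IsProbabilityMeasure P] {W : ℝ≥0 → Ω → EuclideanSpace ℝ (Fin d)}

lemma IsRegularBrownianMotion.measurable_measure_future (hW : IsRegularBrownianMotion W P)
    (T : ℝ≥0) {S : Set ((Set.Iic T → EuclideanSpace ℝ (Fin d)) × (ℝ≥0 → EuclideanSpace ℝ (Fin d)))}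
    (mS : MeasurableSet S) :
    Measurable fun ω =>
      P {ω' | ((fun s : Set.Iic T => W s ω), fun t => W (T + t) ω' - W T ω') ∈ S} := by
  have m : Measurable fun p : Ω × Ω =>
      ((fun s : Set.Iic T => W s p.1), fun t => W (T + t) p.2 - W T p.2) :=
    (measurable_pi_lambda _ fun s => (hW.measurable _).comp measurable_fst).prodMk
      (measurable_pi_lambda _ fun t =>
        ((hW.shift T).measurable t).comp measurable_snd)
  exact measurable_measure_prodMk_left (m mS)

/-- Markov property, for events. -/
lemma IsRegularBrownianMotion.measure_markov (hW : IsRegularBrownianMotion W P)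
    (T : ℝ≥0) {S : Set ((Set.Iic T → EuclideanSpace ℝ (Fin d)) × (ℝ≥0 → EuclideanSpace ℝ (Fin d)))}
    (mS : MeasurableSet S) :
    P {ω | ((fun s : Set.Iic T => W s ω), fun t => W (T + t) ω - W T ω) ∈ S} =
      ∫⁻ ω, P {ω' | ((fun s : Set.Iic T => W s ω), fun t => W (T + t) ω' - W T ω') ∈ S} ∂P := by
  have h := hW.lintegral_markov T (g := S.indicator fun _ => 1) (measurable_const.indicator mS)
  have m1 : Measurable fun ω (s : Set.Iic T) => W s ω :=
    measurable_pi_lambda _ fun s => hW.measurable _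
  have m2 : Measurable fun ω (t : ℝ≥0) => W (T + t) ω - W T ω :=
    measurable_pi_lambda _ fun t => (hW.shift T).measurable t
  have e : ∀ A : Set Ω, MeasurableSet A → P A = ∫⁻ ω, A.indicator (fun _ => 1) ω ∂P :=
    fun A hA => (lintegral_indicator_one hA).symm
  refine (e _ ((m1.prodMk m2) mS)).trans (h.trans (lintegral_congr fun ω => ?_))
  exact (e _ ((measurable_const.prodMk m2) mS)).symm

/-- For small times, a Brownian motion follows any prescribed linear motion with positive
probability. -/
lemma IsRegularBrownianMotion.exists_measure_tube_pos (hd : d ≠ 0)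
    (hW : IsRegularBrownianMotion W P) (v : EuclideanSpace ℝ (Fin d)) {δ : ℝ} (hδ : 0 < δ) :
    ∃ T : ℝ≥0, 0 < T ∧ ∃ G : Set (Set.Iic T → EuclideanSpace ℝ (Fin d)), MeasurableSet G ∧
      0 < P {ω | (fun s : Set.Iic T => W s ω) ∈ G} ∧
      ∀ ω, (fun s : Set.Iic T => W s ω) ∈ G → ‖W T ω - v‖ ≤ δ ∧
        ∀ t < T, ‖W t ω - ((t : ℝ) / T) • v‖ ≤ 3 * δ := by
  -- Continuity at time 0 makes some initial interval uneventful with positive probability. There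
  -- the bridge is at most `2 * δ`, and it is independent of the endpoint, which may then be steered
  -- near any `v`.
  obtain ⟨k, hk⟩ : ∃ k : ℕ, 0 < P {ω | ∀ s ≤ ((k : ℝ≥0) + 1)⁻¹, ‖W s ω‖ ≤ δ} := by
    refine exists_measure_pos_of_not_measure_iUnion_null ?_
    have : ⋃ k : ℕ, {ω | ∀ s ≤ ((k : ℝ≥0) + 1)⁻¹, ‖W s ω‖ ≤ δ} = Set.univ := by
      refine Set.eq_univ_of_forall fun ω => Set.mem_iUnion.2 ?_
      have h0 : Filter.Tendsto (fun s => ‖W s ω‖) (nhds 0) (nhds 0) := by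
        have := (hW.continuous ω).norm.tendsto 0
        rwa [hW.start ω, norm_zero] at this
      obtain ⟨b, hb, h⟩ := (nhds_bot_basis_Iic (α := ℝ≥0)).eventually_iff.1
        (h0.eventually_le_const hδ)
      obtain ⟨k, hk⟩ := exists_nat_one_div_lt hb
      refine ⟨k, fun s hs => h (hs.trans ?_)⟩
      rw [← one_div]
      exact hk.le
    rw [this]
    simp
  set T : ℝ≥0 := ((k : ℝ≥0) + 1)⁻¹ with hT
  have hT0 : 0 < T := by positivity
  have hTR : (0 : ℝ) < T := by exact_mod_cast hT0
  set τ := TopologicalSpace.denseSeq ℝ≥0 with hτ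
  set G₁ : Set (Set.Iic T → EuclideanSpace ℝ (Fin d)) :=
    ⋂ j : ℕ, {f | ∀ h : τ j ≤ T, ‖f ⟨τ j, h⟩‖ ≤ 2 * δ} with hG₁
  have mG₁ : MeasurableSet G₁ := by
    refine MeasurableSet.iInter fun j => ?_
    by_cases hj : τ j ≤ T
    · simp only [hj, forall_true_left]
      exact measurableSet_le (measurable_pi_apply _).norm measurable_const
    · simp [hj]
  set bridge : (Set.Iic T → EuclideanSpace ℝ (Fin d)) → Set.Iic T → EuclideanSpace ℝ (Fin d) :=
    fun f s => f s - (((s : ℝ≥0) : ℝ) / T) • f ⟨T, le_refl T⟩ with hbridge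
  have mbridge : Measurable bridge := by
    simp only [hbridge]
    fun_prop
  refine ⟨T, hT0, bridge ⁻¹' G₁ ∩ {f | f ⟨T, le_refl T⟩ ∈ Metric.closedBall v δ},
    (mbridge mG₁).inter (measurable_pi_apply _ Metric.isClosed_closedBall.measurableSet), ?_, ?_⟩
  · have hind := (hW.indepFun_bridge hT0).measure_inter_preimage_eq_mul G₁ (Metric.closedBall v δ)
      mG₁ Metric.isClosed_closedBall.measurableSet
    change 0 < P ((fun ω (s : Set.Iic T) => W s ω - (((s : ℝ≥0) : ℝ) / T) • W T ω) ⁻¹' G₁ ∩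
      W T ⁻¹' Metric.closedBall v δ)
    rw [hind]
    refine ENNReal.mul_pos (ne_of_gt (hk.trans_le (measure_mono fun ω hω => ?_))) (ne_of_gt ?_)
    · refine Set.mem_iInter.2 fun j hj => ?_
      have h1 := hω (τ j) hj
      have h2 := hω T le_rfl
      have h3 : ((τ j : ℝ≥0) : ℝ) / T ≤ 1 := (div_le_one hTR).2 (by exact_mod_cast hj)
      calc ‖W (τ j) ω - (((τ j : ℝ≥0) : ℝ) / T) • W T ω‖
          ≤ ‖W (τ j) ω‖ + (((τ j : ℝ≥0) : ℝ) / T) * ‖W T ω‖ := by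
            refine (norm_sub_le _ _).trans_eq ?_
            rw [norm_smul, Real.norm_eq_abs, abs_of_nonneg (by positivity)]
        _ ≤ δ + 1 * δ := by gcongr
        _ = 2 * δ := by ring
    · have h := hW.le_measure_closedBall hT0.ne' hd 0 v hδ.le
      simp only [zero_add] at h
      refine lt_of_lt_of_le (ENNReal.ofReal_pos.2 ?_) h
      have : (0 : ℝ) < d := by exact_mod_cast Nat.pos_of_ne_zero hd
      positivity
  · rintro ω ⟨h1, h2⟩
    have h2' : ‖W T ω - v‖ ≤ δ := by
      rw [← dist_eq_norm]
      exact h2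
    refine ⟨h2', fun t ht => ?_⟩
    have hc : Continuous fun s : ℝ≥0 => ‖W s ω - ((s : ℝ) / T) • v‖ := by
      have := hW.continuous ω
      fun_prop
    refine le_of_forall_denseSeq_lt hc (fun j hj => ?_) ht
    have h3 : ‖W (τ j) ω - (((τ j : ℝ≥0) : ℝ) / T) • W T ω‖ ≤ 2 * δ :=
      Set.mem_iInter.1 h1 j hj.le
    have h4 : ((τ j : ℝ≥0) : ℝ) / T ≤ 1 := (div_le_one hTR).2 (by exact_mod_cast hj.le)
    have e : W (τ j) ω - (((τ j : ℝ≥0) : ℝ) / T) • v =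
        (W (τ j) ω - (((τ j : ℝ≥0) : ℝ) / T) • W T ω) +
          (((τ j : ℝ≥0) : ℝ) / T) • (W T ω - v) := by
      rw [smul_sub]
      abel
    rw [← hτ, e]
    calc _ ≤ 2 * δ + (((τ j : ℝ≥0) : ℝ) / T) * ‖W T ω - v‖ := by
          refine (norm_add_le _ _).trans (add_le_add h3 (le_of_eq ?_))
          rw [norm_smul, Real.norm_eq_abs, abs_of_nonneg (by positivity)]
      _ ≤ 2 * δ + 1 * δ := by gcongr
      _ = 3 * δ := by ring

/-- Safety propagates along segments in the complement of the balls. -/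
lemma IsSafe.of_segment_subset (hd : d ≠ 0) {c : ℕ → EuclideanSpace ℝ (Fin d)} {r : ℕ → ℝ}
    (hlf : LocallyFinite fun n => Metric.closedBall (c n) (r n))
    {x y : EuclideanSpace ℝ (Fin d)} (hy : IsSafe P c r y)
    (hxy : segment ℝ x y ⊆ freeRegion c r) : IsSafe P c r x := by
  obtain ⟨δ₁, hδ₁, hsafe⟩ := hy
  have hcomp : IsCompact (segment ℝ x y) := by
    rw [segment_eq_image']
    exact isCompact_Icc.image (by fun_prop)
  obtain ⟨η, hη, hthick⟩ := hcomp.exists_thickening_subset_open (isOpen_freeRegion hlf) hxy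
  -- The total error is `δ` from the start plus `3 * δ` along the path, or plus `δ` at the endpoint;
  -- all fit with room to spare.
  set δ := min δ₁ η / 8 with hδ
  have hδ0 : 0 < δ := by positivity
  have hδ8 : 8 * δ ≤ δ₁ ∧ 8 * δ ≤ η := by
    constructor <;> linarith [min_le_left δ₁ η, min_le_right δ₁ η]
  refine ⟨δ, hδ0, fun x' hx' W hW => ?_⟩
  obtain ⟨T, hT0, G, mG, hGpos, hG⟩ := hW.exists_measure_tube_pos hd (y - x) hδ0
  have hTR : (0 : ℝ) < T := by exact_mod_cast hT0
  set S : Set ((Set.Iic T → EuclideanSpace ℝ (Fin d)) × (ℝ≥0 → EuclideanSpace ℝ (Fin d))) :=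
    {p | p.1 ∈ G ∧ (fun t => x' + p.1 ⟨T, le_refl T⟩ + p.2 t) ∈ avoidingPaths c r} with hS
  have mS : MeasurableSet S := by
    have m : Measurable fun (p : (Set.Iic T → EuclideanSpace ℝ (Fin d)) ×
        (ℝ≥0 → EuclideanSpace ℝ (Fin d))) (t : ℝ≥0) => x' + p.1 ⟨T, le_refl T⟩ + p.2 t := by
      fun_prop
    exact (measurable_fst mG).inter (m (measurableSet_avoidingPaths c r))
  have hpos : 0 < P {ω | ((fun s : Set.Iic T => W s ω), fun t => W (T + t) ω - W T ω) ∈ S} := by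
    rw [hW.measure_markov T mS, lintegral_pos_iff_support (hW.measurable_measure_future T mS)]
    refine hGpos.trans_le (measure_mono fun ω hω => ?_)
    rw [Function.mem_support]
    refine ne_of_gt ?_
    have h1 := hsafe (x' + W T ω) ?_ _ (hW.shift T)
    · exact h1.trans_le (measure_mono fun ω' hω' => ⟨hω, hω'⟩)
    · have h2 := (hG ω hω).1
      rw [Metric.mem_ball, dist_eq_norm] at hx' ⊢
      have e : x' + W T ω - y = (x' - x) + (W T ω - (y - x)) := by abel
      rw [e]
      linarith [norm_add_le (x' - x) (W T ω - (y - x)), hδ8.1]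
  refine hpos.trans_le (measure_mono fun ω hω => ?_)
  obtain ⟨h1, h2⟩ := hω
  have hc2 : Continuous fun t : ℝ≥0 => x' + W T ω + (W (T + t) ω - W T ω) :=
    (hW.shift T).continuous_add _ ω
  rw [mem_avoidingPaths_iff hc2] at h2
  rw [Set.mem_ofPred_eq, mem_avoidingPaths_iff (hW.continuous_add x' ω)]
  intro t n
  rcases lt_or_ge t T with ht | ht
  · refine hthick ?_ n
    rw [Metric.mem_thickening_iff]
    refine ⟨x + ((t : ℝ) / T) • (y - x), ?_, ?_⟩
    · rw [segment_eq_image']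
      exact ⟨(t : ℝ) / T, ⟨by positivity, (div_le_one hTR).2 (by exact_mod_cast ht.le)⟩, rfl⟩
    · have h3 := (hG ω h1).2 t ht
      rw [Metric.mem_ball, dist_eq_norm] at hx'
      rw [dist_eq_norm]
      have e : x' + W t ω - (x + ((t : ℝ) / T) • (y - x)) =
          (x' - x) + (W t ω - ((t : ℝ) / T) • (y - x)) := by abel
      rw [e]
      linarith [norm_add_le (x' - x) (W t ω - ((t : ℝ) / T) • (y - x)), hδ8.2]
  · have h3 := h2 (t - T) n
    rw [add_tsub_cancel_of_le ht] at h3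
    rwa [add_assoc, add_sub_cancel] at h3

end Visits

/-! ### Convergent integral: safety of every free point -/

section Avoidable

variable {d : ℕ} {Ω : Type*} [MeasurableSpace Ω] {P : Measure Ω} [IsProbabilityMeasure P]
  {c : ℕ → EuclideanSpace ℝ (Fin d)} {r : ℕ → ℝ} {φ : ℝ → ℝ} {ε : ℝ}

/-- A union bound: the visiting probabilities add up to at most one half. The separation from the
centres is `ε / 2`; half of it is spent on varying the starting point, and the sum estimate uses the
other half. -/
lemma exists_forall_isSafe (hd : 3 ≤ d) (hε : 0 < ε)
    (hsep : ∀ n m, n ≠ m → 2 * ε ≤ dist (c n) (c m))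
    (hr : ∀ n, r n = φ ‖c n‖) (hneg : ∀ n, c n = 0 → r n < 0)
    (hφ : AntitoneOn φ (Set.Ioi 0)) (hφ0 : ∀ s, 0 < s → 0 < φ s)
    (hint : IntegrableOn (fun s => s * φ s ^ (d - 2)) (Set.Ioi 1)) :
    ∃ M, ∀ y, M < ‖y‖ → (∀ n, ε / 2 ≤ dist y (c n)) → IsSafe P c r y := by
  classical
  obtain ⟨C, hC, hvisit⟩ := exists_measure_visit_le hd P
  have hev := eventually_sum_le hd (ε := ε / 4) (by positivity)
    (fun n m h => le_trans (by linarith) (hsep n m h)) hφ hφ0 hint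
    (κ := 1 / (2 * C)) (by positivity)
  obtain ⟨M, -, hM⟩ := Filter.hasBasis_cobounded_norm.eventually_iff.1 hev
  refine ⟨M + ε / 4, fun y hy hyc => ⟨ε / 4, by positivity, fun y' hy' W hW => ?_⟩⟩
  rw [Metric.mem_ball] at hy'
  have hy'M : M ≤ ‖y'‖ := by
    have := norm_le_norm_add_norm_sub' y y'
    rw [← dist_eq_norm, dist_comm] at this
    linarith
  have hy'c : ∀ n, ε / 4 ≤ dist y' (c n) := by
    intro n
    have := dist_triangle_left y (c n) y'
    linarith [hyc n]
  have hsum := hM hy'M hy'c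
  set b : ℕ → ℝ := fun n => if c n = 0 then 0 else C * (φ ‖c n‖ / dist y' (c n)) ^ (d - 2) with hb
  have hb0 : ∀ n, 0 ≤ b n := by
    intro n
    simp only [hb]
    split_ifs with h
    · exact le_rfl
    · have := hφ0 _ (norm_pos_iff.2 h)
      positivity
  set A : ℕ → Set Ω := fun n => {ω | ∃ t : ℝ≥0, y' + W t ω ∈ Metric.closedBall (c n) (r n)} with hA
  have hAb : ∀ n, P (A n) ≤ ENNReal.ofReal (b n) := by
    intro n
    by_cases h : c n = 0
    · have : A n = ∅ := by
        refine Set.eq_empty_of_forall_notMem ?_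
        rintro ω ⟨t, ht⟩
        rw [Metric.closedBall_eq_empty.2 (hneg n h)] at ht
        exact ht
      rw [this, measure_empty]
      exact zero_le
    · have hrn : 0 < r n := by
        rw [hr]
        exact hφ0 _ (norm_pos_iff.2 h)
      have hne : y' ≠ c n := by
        rw [← dist_pos]
        linarith [hy'c n]
      have := hvisit W hW y' (c n) (r n) hrn hne
      simp only [hb, if_neg h, ← hr]
      exact this
  have hun : P (⋃ n, A n) ≤ ENNReal.ofReal (1 / 2) := by
    refine (measure_iUnion_le A).trans ((ENNReal.tsum_le_tsum hAb).trans ?_)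
    rw [ENNReal.tsum_eq_iSup_sum]
    refine iSup_le fun F => ?_
    rw [← ENNReal.ofReal_sum_of_nonneg fun n _ => hb0 n]
    refine ENNReal.ofReal_le_ofReal ?_
    have h1 := hsum (F.filter fun n => c n ≠ 0) fun n hn => (Finset.mem_filter.1 hn).2
    have h2 : ∑ n ∈ F, b n =
        C * ∑ n ∈ F.filter (fun n => c n ≠ 0), (φ ‖c n‖ / dist y' (c n)) ^ (d - 2) := by
      rw [Finset.mul_sum, Finset.sum_filter]
      refine Finset.sum_congr rfl fun n _ => ?_
      simp only [hb]
      split_ifs <;> simp_all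
    rw [h2]
    calc _ ≤ C * (1 / (2 * C)) := by gcongr
      _ = 1 / 2 := by field_simp
  rw [hW.setOf_avoidingPaths]
  refine pos_iff_ne_zero.2 fun hzero => ?_
  have hall : P Set.univ ≤ ENNReal.ofReal (1 / 2) := by
    refine (measure_mono fun ω _ => ?_).trans ((measure_union_le
      {ω | ∀ (t : ℝ≥0) (n : ℕ), y' + W t ω ∉ Metric.closedBall (c n) (r n)} (⋃ n, A n)).trans ?_)
    · by_cases h : ∀ (t : ℝ≥0) (n : ℕ), y' + W t ω ∉ Metric.closedBall (c n) (r n)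
      · exact Or.inl h
      · push Not at h
        obtain ⟨t, n, h⟩ := h
        exact Or.inr (Set.mem_iUnion.2 ⟨n, t, h⟩)
    · rw [hzero, zero_add]
      exact hun
  rw [measure_univ, ENNReal.one_le_ofReal] at hall
  norm_num at hall

lemma exists_forall_lt_of_integrableOn (hφ : AntitoneOn φ (Set.Ioi 0))
    (hφ0 : ∀ s, 0 < s → 0 < φ s) {k : ℕ}
    (hint : IntegrableOn (fun s => s * φ s ^ k) (Set.Ioi 1)) (hε : 0 < ε) :
    ∃ T, ∀ t, T < t → φ t < ε := by
  have h1 := (tendsto_pow_mul_sq hφ hφ0 k hint).eventually_lt_const (pow_pos hε k)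
  obtain ⟨T, hT⟩ := Filter.eventually_atTop.1 (h1.and (Filter.eventually_ge_atTop 1))
  refine ⟨T, fun t ht => ?_⟩
  obtain ⟨h2, h3⟩ := hT t ht.le
  have h4 : 0 < φ t := hφ0 t (by linarith)
  refine lt_of_pow_lt_pow_left₀ k hε.le (lt_of_le_of_lt ?_ h2)
  exact le_mul_of_one_le_right (by positivity) (one_le_pow₀ h3)

lemma locallyFinite_closedBall (hε : 0 < ε)
    (hsep : ∀ n m, n ≠ m → 2 * ε ≤ dist (c n) (c m))
    (hr : ∀ n, r n = φ ‖c n‖) (hφ : AntitoneOn φ (Set.Ioi 0)) :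
    LocallyFinite fun n => Metric.closedBall (c n) (r n) := by
  intro x
  refine ⟨Metric.ball x 1, Metric.ball_mem_nhds x one_pos, ?_⟩
  refine ((finite_centres_dist_le hε hsep 0 1).union
    (finite_centres_dist_le hε hsep x (φ 1 + 1))).subset ?_
  rintro n ⟨z, hz1, hz2⟩
  rw [Metric.mem_closedBall] at hz1
  rw [Metric.mem_ball] at hz2
  rcases le_total ‖c n‖ 1 with h | h
  · left
    simpa using h
  · right
    have h1 : r n ≤ φ 1 := by
      rw [hr]
      exact hφ (Set.mem_Ioi.2 one_pos) (Set.mem_Ioi.2 (by linarith)) h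
    change dist (c n) x ≤ φ 1 + 1
    linarith [dist_triangle_left (c n) x z]

/-- If the integral converges, the balls are avoided with positive probability from every point
outside of them. -/
lemma isSafe_of_integrableOn (hd : 3 ≤ d) (hε : 0 < ε)
    (hsep : ∀ n m, n ≠ m → 2 * ε ≤ dist (c n) (c m))
    (hr : ∀ n, r n = φ ‖c n‖) (hneg : ∀ n, c n = 0 → r n < 0)
    (hφ : AntitoneOn φ (Set.Ioi 0)) (hφ0 : ∀ s, 0 < s → 0 < φ s)
    (hint : IntegrableOn (fun s => s * φ s ^ (d - 2)) (Set.Ioi 1))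
    (hdisj : NonOverlapping c r) {x : EuclideanSpace ℝ (Fin d)} (hx : x ∈ freeRegion c r) :
    IsSafe P c r x := by
  have hlf := locallyFinite_closedBall hε hsep hr hφ
  have hpos : ∀ n, c n ≠ 0 → 0 < r n := fun n hn => by
    rw [hr]
    exact hφ0 _ (norm_pos_iff.2 hn)
  -- Beyond `T` all radii are below `ε / 2`; the finitely many remaining balls lie within norm `K`.
  obtain ⟨T, hT⟩ := exists_forall_lt_of_integrableOn hφ hφ0 hint (half_pos hε)
  obtain ⟨K, hK⟩ := ((finite_centres_dist_le hε hsep 0 T).image fun n => ‖c n‖ + r n).bddAbove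
  obtain ⟨M, hM⟩ := exists_forall_isSafe (P := P) hd hε hsep hr hneg hφ hφ0 hint
  have hK' : ∀ n, r n < ε / 2 ∨ ‖c n‖ + r n ≤ K := by
    intro n
    rcases le_or_gt ‖c n‖ T with h | h
    · exact Or.inr (hK ⟨n, by simpa using h, rfl⟩)
    · exact Or.inl (by rw [hr]; exact hT _ h)
  have hr0 : ∀ n, r n ≠ 0 := by
    intro n
    by_cases h : c n = 0
    · exact (hneg n h).ne
    · exact (hpos n h).ne'
  have hr1 : ∀ n, r n < 0 → c n = 0 := by
    intro n hn
    by_contra h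
    exact absurd (hpos n h) (not_lt.2 hn.le)
  obtain ⟨y, hxy, hyM, hyc⟩ :=
    exists_polygonallyJoined_far hd hε hsep hK' hlf hdisj hr0 hr1 hx M
  have hy := hM y hyM hyc
  clear hyM hyc
  -- Safety is carried back from the far endpoint, one segment at a time.
  induction hxy using Relation.ReflTransGen.head_induction_on with
  | refl => exact hy
  | head h _ ih =>
    exact (ih (h (right_mem_segment ℝ _ _))).of_segment_subset (by omega) hlf h

end Avoidable

/-! ### From a uniform visiting probability to an almost sure visit -/

section Recurrence

variable {d : ℕ} {Ω : Type*} [MeasurableSpace Ω] {P : Measure Ω}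
  {W : ℝ≥0 → Ω → EuclideanSpace ℝ (Fin d)} {V : Set (EuclideanSpace ℝ (Fin d))}

lemma IsRegularBrownianMotion.exists_mem_iff_denseSeq (hW : IsRegularBrownianMotion W P)
    (hV : IsOpen V) (x : EuclideanSpace ℝ (Fin d)) (ω : Ω) :
    (∃ t : ℝ≥0, x + W t ω ∈ V) ↔ ∃ j, x + W (TopologicalSpace.denseSeq ℝ≥0 j) ω ∈ V := by
  refine ⟨fun ⟨t, ht⟩ => ?_, fun ⟨j, hj⟩ => ⟨_, hj⟩⟩
  exact (TopologicalSpace.denseRange_denseSeq ℝ≥0).exists_mem_open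
    (hV.preimage (hW.continuous_add x ω)) ⟨t, ht⟩

lemma IsRegularBrownianMotion.measurableSet_exists_mem (hW : IsRegularBrownianMotion W P)
    (hV : IsOpen V) (x : EuclideanSpace ℝ (Fin d)) :
    MeasurableSet {ω | ∃ t : ℝ≥0, x + W t ω ∈ V} := by
  have : {ω | ∃ t : ℝ≥0, x + W t ω ∈ V} =
      ⋃ j, {ω | x + W (TopologicalSpace.denseSeq ℝ≥0 j) ω ∈ V} := by
    ext ω
    simpa using hW.exists_mem_iff_denseSeq hV x ω
  rw [this]
  exact MeasurableSet.iUnion fun j => ((hW.measurable _).const_add x) hV.measurableSet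

variable [IsProbabilityMeasure P]

/-- An open set that is visited with a probability bounded away from zero, from any starting point,
is visited almost surely. -/
lemma IsRegularBrownianMotion.measure_forall_notMem_eq_zero (hW : IsRegularBrownianMotion W P)
    (hV : IsOpen V) {δ : ENNReal} (hδ : δ ≠ 0)
    (h : ∀ W : ℝ≥0 → Ω → EuclideanSpace ℝ (Fin d), IsRegularBrownianMotion W P →
      ∀ x, δ ≤ P {ω | ∃ t : ℝ≥0, x + W t ω ∈ V}) (x : EuclideanSpace ℝ (Fin d)) :
    P {ω | ∀ t : ℝ≥0, x + W t ω ∉ V} = 0 := by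
  set τ := TopologicalSpace.denseSeq ℝ≥0 with hτ
  set A : ℕ → Set Ω := fun N => {ω | ∀ j, τ j ≤ N → x + W (τ j) ω ∉ V} with hA
  have mA : ∀ N, MeasurableSet (A N) := by
    intro N
    simp only [hA, Set.ofPred_forall]
    exact MeasurableSet.iInter fun j => MeasurableSet.iInter fun _ =>
      ((hW.measurable _).const_add x) hV.measurableSet.compl
  have hAanti : Antitone A := by
    intro N N' hN ω hω j hj
    exact hω j (hj.trans (by exact_mod_cast hN))
  have hinter : ⋂ N, A N = {ω | ∀ t : ℝ≥0, x + W t ω ∉ V} := by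
    ext ω
    simp only [Set.mem_iInter]
    constructor
    · intro hω t ht
      obtain ⟨j, hj⟩ := (hW.exists_mem_iff_denseSeq hV x ω).1 ⟨t, ht⟩
      obtain ⟨N, hN⟩ := exists_nat_ge (τ j)
      exact hω N j hN hj
    · exact fun hω N j _ => hω (τ j)
  -- To avoid `V` forever is to avoid it up to time `N` and again from the position reached then. As
  -- `N` grows this becomes `p ≤ (1 - δ) * p`, which forces `p = 0`.
  have hstep : ∀ N : ℕ, P {ω | ∀ t : ℝ≥0, x + W t ω ∉ V} ≤ (1 - δ) * P (A N) := by
    intro N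
    set T : ℝ≥0 := (N : ℝ≥0) with hT
    set S : Set ((Set.Iic T → EuclideanSpace ℝ (Fin d)) × (ℝ≥0 → EuclideanSpace ℝ (Fin d))) :=
      {p | (∀ j, ∀ hj : τ j ≤ T, x + p.1 ⟨τ j, hj⟩ ∉ V) ∧
        ∀ j, x + p.1 ⟨T, le_refl T⟩ + p.2 (τ j) ∉ V} with hS
    have mS : MeasurableSet S := by
      have e : S = (⋂ j, ⋂ hj : τ j ≤ T, {p | x + p.1 ⟨τ j, hj⟩ ∈ Vᶜ}) ∩
          ⋂ j, {p | x + p.1 ⟨T, le_refl T⟩ + p.2 (τ j) ∈ Vᶜ} := by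
        ext p
        simp [hS]
      rw [e]
      refine (MeasurableSet.iInter fun j => MeasurableSet.iInter fun hj => ?_).inter
        (MeasurableSet.iInter fun j => ?_)
      · have m : Measurable fun p : (Set.Iic T → EuclideanSpace ℝ (Fin d)) ×
            (ℝ≥0 → EuclideanSpace ℝ (Fin d)) => x + p.1 ⟨τ j, hj⟩ := by fun_prop
        exact m hV.measurableSet.compl
      · have m : Measurable fun p : (Set.Iic T → EuclideanSpace ℝ (Fin d)) ×
            (ℝ≥0 → EuclideanSpace ℝ (Fin d)) => x + p.1 ⟨T, le_refl T⟩ + p.2 (τ j) := by fun_prop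
        exact m hV.measurableSet.compl
    calc P {ω | ∀ t : ℝ≥0, x + W t ω ∉ V}
        ≤ P {ω | ((fun s : Set.Iic T => W s ω), fun t => W (T + t) ω - W T ω) ∈ S} := by
          refine measure_mono fun ω hω => ⟨fun j _ => hω (τ j), fun j => ?_⟩
          have := hω (T + τ j)
          rwa [add_assoc, add_sub_cancel]
      _ = ∫⁻ ω, P {ω' | ((fun s : Set.Iic T => W s ω), fun t => W (T + t) ω' - W T ω') ∈ S} ∂P :=
          hW.measure_markov T mS
      _ ≤ ∫⁻ ω, (A N).indicator (fun _ => 1 - δ) ω ∂P := by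
          refine lintegral_mono fun ω => ?_
          by_cases hω : ω ∈ A N
          · rw [Set.indicator_of_mem hω]
            have h1 := h _ (hW.shift T) (x + W T ω)
            have h2 := prob_compl_eq_one_sub (μ := P)
              ((hW.shift T).measurableSet_exists_mem hV (x + W T ω))
            refine le_trans (measure_mono fun ω' hω' => ?_)
              (h2.le.trans (tsub_le_tsub_left h1 1))
            intro hex
            obtain ⟨j, hj⟩ := ((hW.shift T).exists_mem_iff_denseSeq hV _ ω').1 hex
            exact hω'.2 j hj
          · rw [Set.indicator_of_notMem hω]
            refine le_of_eq (measure_mono_null (fun ω' hω' => ?_) measure_empty)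
            exact hω fun j hj => hω'.1 j hj
      _ = (1 - δ) * P (A N) := lintegral_indicator_const (mA N) _
  have hlim := tendsto_measure_iInter_atTop (μ := P) (s := A) (fun N => (mA N).nullMeasurableSet)
    hAanti ⟨0, measure_ne_top P _⟩
  rw [hinter] at hlim
  set p := P {ω | ∀ t : ℝ≥0, x + W t ω ∉ V} with hp
  have hle : p ≤ (1 - δ) * p :=
    ge_of_tendsto' (ENNReal.Tendsto.const_mul hlim (Or.inr (by simp))) hstep
  by_contra hp0
  have hlt : (1 - δ) * p < 1 * p :=
    (ENNReal.mul_lt_mul_iff_left hp0 (measure_ne_top P _)).2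
      (ENNReal.sub_lt_self ENNReal.one_ne_top one_ne_zero hδ)
  rw [one_mul] at hlt
  exact absurd hle (not_le.2 hlt)

lemma IsRegularBrownianMotion.potential_sum (hW : IsRegularBrownianMotion W P) (I : Finset ℕ)
    (a : ℕ → ENNReal) {f : ℕ → EuclideanSpace ℝ (Fin d) → ENNReal} (hf : ∀ n, Measurable (f n))
    (x : EuclideanSpace ℝ (Fin d)) :
    potential P W (fun y => ∑ n ∈ I, a n * f n y) x = ∑ n ∈ I, a n * potential P W (f n) x := by
  have m : ∀ n, Measurable fun p : ℝ × Ω => f n (x + W p.1.toNNReal p.2) := fun n =>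
    (hf n).comp (hW.measurable_uncurry.const_add x)
  have m1 : ∀ n (s : ℝ), Measurable fun ω => f n (x + W s.toNNReal ω) := fun n s =>
    (m n).comp measurable_prodMk_left
  have m2 : ∀ n, Measurable fun s : ℝ => ∫⁻ ω, f n (x + W s.toNNReal ω) ∂P := fun n =>
    (m n).lintegral_prod_right'
  unfold potential
  calc _ = ∫⁻ s in Set.Ioi (0 : ℝ), ∑ n ∈ I, a n * ∫⁻ ω, f n (x + W s.toNNReal ω) ∂P := by
        refine lintegral_congr fun s => ?_
        rw [lintegral_finsetSum _ fun n _ => (m1 n s).const_mul _]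
        exact Finset.sum_congr rfl fun n _ => lintegral_const_mul _ (m1 n s)
    _ = _ := by
        rw [lintegral_finsetSum _ fun n _ => (m2 n).const_mul _]
        exact Finset.sum_congr rfl fun n _ => lintegral_const_mul _ (m2 n)

end Recurrence

/-! ### Divergent integral: a uniform lower bound for the visiting probability -/

section Unavoidable

variable {d : ℕ} {Ω : Type*} [MeasurableSpace Ω] {P : Measure Ω} [IsProbabilityMeasure P]
  {c : ℕ → EuclideanSpace ℝ (Fin d)} {r : ℕ → ℝ} {φ : ℝ → ℝ} {ε R : ℝ}

/-- If the integral diverges, then the union of the open balls is visited with a probability bounded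
away from zero, from any starting point. -/
lemma exists_le_measure_visit (hd : 3 ≤ d) (hε : 0 < ε) (hε1 : ε ≤ 1) (hR : 0 < R)
    (hsep : ∀ n m, n ≠ m → 2 * ε ≤ dist (c n) (c m)) (hdense : ∀ x, ∃ n, c n ∈ Metric.ball x R)
    (hr : ∀ n, r n = φ ‖c n‖) (hφ : AntitoneOn φ (Set.Ioi 0)) (hφ0 : ∀ s, 0 < s → 0 < φ s)
    (hint : ¬ IntegrableOn (fun s => s * φ s ^ (d - 2)) (Set.Ioi 1)) :
    ∃ δ : ENNReal, δ ≠ 0 ∧ ∀ W : ℝ≥0 → Ω → EuclideanSpace ℝ (Fin d),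
      IsRegularBrownianMotion W P → ∀ x,
        δ ≤ P {ω | ∃ t : ℝ≥0, x + W t ω ∈ ⋃ n, Metric.ball (c n) (r n)} := by
  classical
  obtain ⟨C₂, hC₂, hupper⟩ := exists_occupation_le hd P
  obtain ⟨C₁, hC₁, hlower⟩ := exists_le_occupation hd P
  obtain ⟨C, hC, henergy⟩ := exists_energy_bound hd hε hε1 hR hsep hdense hφ hφ0
  have hφ1 : 0 < φ 1 := hφ0 1 one_pos
  -- The factor at most `1 / 2` puts the shrunken closed balls inside the open ones; the other bound
  -- keeps `ρ n ≤ ε / 2` for centres of norm at least 1, as the energy bound requires.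
  set κ := min (1 / 2) (ε / (2 * φ 1)) with hκ
  have hκ0 : 0 < κ := lt_min (by norm_num) (by positivity)
  have hκ1 : κ ≤ 1 / 2 := min_le_left _ _
  set ρ : ℕ → ℝ := fun n => κ * φ ‖c n‖ with hρ
  have hφc : ∀ n, 1 ≤ ‖c n‖ → 0 < φ ‖c n‖ := fun n hn => hφ0 _ (by linarith)
  have hρ0 : ∀ n, 1 ≤ ‖c n‖ → 0 < ρ n := fun n hn => mul_pos hκ0 (hφc n hn)
  have hρε : ∀ n, 1 ≤ ‖c n‖ → ρ n ≤ ε / 2 := by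
    intro n hn
    calc κ * φ ‖c n‖ ≤ ε / (2 * φ 1) * φ 1 := by
          refine mul_le_mul (min_le_right _ _) ?_ (hφc n hn).le (by positivity)
          exact hφ (Set.mem_Ioi.2 one_pos) (Set.mem_Ioi.2 (by linarith)) hn
      _ = ε / 2 := by field_simp
  set b : ℝ := C₂ * (1 + C) with hb
  have hb0 : 0 < b := by positivity
  set a : ℝ := C₁ * (κ / 2) ^ (d - 2) with ha
  have ha0 : 0 < a := by positivity
  refine ⟨ENNReal.ofReal (a / (4 * b)), (ENNReal.ofReal_pos.2 (by positivity)).ne',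
    fun W hW x => ?_⟩
  set I : ℝ → Finset ℕ := fun M =>
    (finite_centres_dist_le hε hsep 0 M).toFinset.filter fun n => 1 ≤ ‖c n‖ with hI
  have hmem : ∀ M n, n ∈ I M ↔ 1 ≤ ‖c n‖ ∧ ‖c n‖ ≤ M := by
    intro M n
    simp [hI, and_comm]
  set g : ℕ → ℝ := fun n => φ ‖c n‖ ^ (d - 2) * (‖c n‖⁻¹) ^ (d - 2) with hg
  -- Centres of norm above `L` are within `2 * ‖c n‖` of `x`. Discarding the others costs a fixed
  -- sum, and `M` is taken so large that at least `(1 + SM) / 2` remains.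
  set L := ‖x‖ + 1 with hL
  obtain ⟨M, hM, hsum⟩ := exists_sum_gt hd hR hdense hφ hφ0 hint (max 2 (2 * ∑ n ∈ I L, g n + 1))
  replace hsum := hsum (I M) (hmem M)
  have hM2 : 2 ≤ M := (le_max_left _ _).trans hM
  have hSM : 2 * ∑ n ∈ I L, g n + 1 < ∑ n ∈ I M, g n := (le_max_right _ _).trans_lt hsum
  have hSM2 : 2 < ∑ n ∈ I M, g n := (le_max_left _ _).trans_lt hsum
  have henergy' := henergy M (I M) hM2 (hmem M)
  set SM := ∑ n ∈ I M, g n with hSMdef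
  set q : ℕ → EuclideanSpace ℝ (Fin d) → ENNReal := fun n =>
    (Metric.closedBall (c n) (ρ n)).indicator 1 with hq
  have mq : ∀ n, Measurable (q n) := fun n =>
    measurable_one.indicator Metric.isClosed_closedBall.measurableSet
  -- With this weight each ball contributes a bounded potential to its own points and one comparable
  -- to its relative capacity elsewhere.
  set w : ℕ → ENNReal := fun n => ENNReal.ofReal ((ρ n ^ 2)⁻¹) with hw
  set f : EuclideanSpace ℝ (Fin d) → ENNReal := fun y => ∑ n ∈ I M, w n * q n y with hf
  have mf : Measurable f := Finset.measurable_fun_sum _ fun n _ => (mq n).const_mul _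
  have hpot : ∀ W : ℝ≥0 → Ω → EuclideanSpace ℝ (Fin d), IsRegularBrownianMotion W P → ∀ z,
      potential P W f z = ∑ n ∈ I M, w n * occupation P W (c n) (ρ n) z := by
    intro W hW z
    rw [hf, hW.potential_sum (I M) w mq z]
    exact Finset.sum_congr rfl fun n _ => by rw [hq, hW.potential_indicator]
  have hfne : ∀ z, f z ≠ 0 → ∃ n ∈ I M, z ∈ Metric.closedBall (c n) (ρ n) := by
    intro z hz
    obtain ⟨n, hn, h⟩ := Finset.exists_ne_zero_of_sum_ne_zero hz
    refine ⟨n, hn, ?_⟩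
    by_contra hout
    have h0 : q n z = 0 := Set.indicator_of_notMem hout _
    exact h (by rw [h0, mul_zero])
  have hown : ∀ W : ℝ≥0 → Ω → EuclideanSpace ℝ (Fin d), IsRegularBrownianMotion W P →
      ∀ z, ∀ n ∈ I M, w n * occupation P W (c n) (ρ n) z ≤ ENNReal.ofReal C₂ := by
    intro W hW z n hn
    have h1 := hρ0 n ((hmem M n).1 hn).1
    calc w n * occupation P W (c n) (ρ n) z ≤ w n * ENNReal.ofReal (C₂ * ρ n ^ 2) :=
          mul_le_mul_right (hupper W hW z (c n) (ρ n) h1).1 _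
      _ = ENNReal.ofReal C₂ := by
          rw [hw, ← ENNReal.ofReal_mul (by positivity)]
          congr 1
          field_simp
  have hS : ∀ T : ℝ≥0, ∀ z, f z ≠ 0 →
      potential P (fun t ω => W (T + t) ω - W T ω) f z ≤ ENNReal.ofReal (b * (1 + SM)) := by
    intro T z hz
    obtain ⟨m, hm, hzm⟩ := hfne z hz
    rw [Metric.mem_closedBall] at hzm
    have hzε : dist z (c m) ≤ ε / 2 := hzm.trans (hρε m ((hmem M m).1 hm).1)
    rw [hpot _ (hW.shift T), ← Finset.add_sum_erase _ _ hm]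
    have hother : ∀ n ∈ (I M).erase m,
        w n * occupation P (fun t ω => W (T + t) ω - W T ω) (c n) (ρ n) z ≤
          ENNReal.ofReal (C₂ * (φ ‖c n‖ / dist z (c n)) ^ (d - 2)) := by
      intro n hn
      obtain ⟨hnm, hn⟩ := Finset.mem_erase.1 hn
      have hn1 := ((hmem M n).1 hn).1
      have h1 := hρ0 n hn1
      have h2 := hφc n hn1
      have h3 : 0 < dist z (c n) := by
        have := hsep n m hnm
        have h4 := dist_triangle_left (c n) (c m) z
        linarith
      calc _ ≤ w n * ENNReal.ofReal (C₂ * ρ n ^ 2 * (ρ n / dist z (c n)) ^ (d - 2)) :=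
            mul_le_mul_right ((hupper _ (hW.shift T) z (c n) (ρ n) h1).2 (dist_pos.1 h3)) _
        _ = ENNReal.ofReal (C₂ * (ρ n / dist z (c n)) ^ (d - 2)) := by
            rw [hw, ← ENNReal.ofReal_mul (by positivity)]
            congr 1
            field_simp
        _ ≤ _ := by
            refine ENNReal.ofReal_le_ofReal ?_
            have h4 : ρ n ≤ φ ‖c n‖ := by
              simp only [hρ]
              nlinarith
            gcongr
    calc _ ≤ ENNReal.ofReal C₂ + ∑ n ∈ (I M).erase m,
            ENNReal.ofReal (C₂ * (φ ‖c n‖ / dist z (c n)) ^ (d - 2)) :=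
          add_le_add (hown _ (hW.shift T) z m hm) (Finset.sum_le_sum hother)
      _ = ENNReal.ofReal (C₂ + ∑ n ∈ (I M).erase m,
            C₂ * (φ ‖c n‖ / dist z (c n)) ^ (d - 2)) := by
          have h0 : ∀ n ∈ (I M).erase m, 0 ≤ C₂ * (φ ‖c n‖ / dist z (c n)) ^ (d - 2) := by
            intro n hn
            have := hφc n ((hmem M n).1 (Finset.mem_of_mem_erase hn)).1
            positivity
          rw [ENNReal.ofReal_add hC₂.le (Finset.sum_nonneg h0), ENNReal.ofReal_sum_of_nonneg h0]
      _ ≤ ENNReal.ofReal (b * (1 + SM)) := by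
          refine ENNReal.ofReal_le_ofReal ?_
          rw [← Finset.mul_sum]
          have h1 := mul_le_mul_of_nonneg_left (henergy' z m hm hzε) hC₂.le
          have h2 : 0 ≤ C₂ * SM := by positivity
          rw [hb]
          linarith
  have hfin : potential P W f x ≠ ⊤ := by
    rw [hpot W hW]
    exact ENNReal.sum_ne_top.2 fun n hn => ne_top_of_le_ne_top ENNReal.ofReal_ne_top
      (hown W hW x n hn)
  have hlow : ENNReal.ofReal (a * ((1 + SM) / 2)) ≤ potential P W f x := by
    have hsub : ∑ n ∈ I M \ I L, g n + ∑ n ∈ I L, g n ≥ SM := by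
      rw [hSMdef]
      refine (Finset.sum_le_sum_of_subset_of_nonneg (t := I M \ I L ∪ I L)
        (by rw [Finset.sdiff_union_self_eq_union]; exact Finset.subset_union_left) ?_).trans_eq
        (Finset.sum_union Finset.sdiff_disjoint)
      intro n hn _
      have h1 : 1 ≤ ‖c n‖ := by
        rcases Finset.mem_union.1 hn with h | h
        · exact ((hmem M n).1 (Finset.mem_sdiff.1 h).1).1
        · exact ((hmem L n).1 h).1
      have := hφc n h1
      positivity
    have hterm : ∀ n ∈ I M \ I L, ENNReal.ofReal (a * g n) ≤
        w n * occupation P W (c n) (ρ n) x := by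
      intro n hn
      obtain ⟨hnM, hnL⟩ := Finset.mem_sdiff.1 hn
      have hn1 := ((hmem M n).1 hnM).1
      have hnL' : L < ‖c n‖ := by
        by_contra! h
        exact hnL ((hmem L n).2 ⟨hn1, h⟩)
      have h1 := hρ0 n hn1
      have h2 : ρ n ≤ 2 * ‖c n‖ := by linarith [hρε n hn1]
      have h3 : dist x (c n) ≤ 2 * ‖c n‖ := by
        rw [dist_eq_norm]
        linarith [norm_sub_le x (c n)]
      have h4 : 0 < ‖c n‖ := by linarith
      calc ENNReal.ofReal (a * g n)
          = w n * ENNReal.ofReal (C₁ * ρ n ^ 2 * (ρ n / (2 * ‖c n‖)) ^ (d - 2)) := by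
            rw [hw, ← ENNReal.ofReal_mul (by positivity)]
            congr 1
            have e : ρ n / (2 * ‖c n‖) = κ / 2 * (φ ‖c n‖ * ‖c n‖⁻¹) := by
              simp only [hρ]
              field_simp
            rw [e, mul_pow (κ / 2), mul_pow (φ ‖c n‖), ha, hg]
            field_simp
        _ ≤ _ := mul_le_mul_right (hlower W hW x (c n) (ρ n) _ h1 h2 h3) _
    have hg0 : ∀ n ∈ I M \ I L, 0 ≤ a * g n := by
      intro n hn
      have := hφc n ((hmem M n).1 (Finset.mem_sdiff.1 hn).1).1
      positivity
    rw [hpot W hW]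
    calc ENNReal.ofReal (a * ((1 + SM) / 2)) ≤ ENNReal.ofReal (∑ n ∈ I M \ I L, a * g n) := by
          refine ENNReal.ofReal_le_ofReal ?_
          rw [← Finset.mul_sum]
          refine mul_le_mul_of_nonneg_left ?_ ha0.le
          linarith
      _ = ∑ n ∈ I M \ I L, ENNReal.ofReal (a * g n) := ENNReal.ofReal_sum_of_nonneg hg0
      _ ≤ ∑ n ∈ I M \ I L, w n * occupation P W (c n) (ρ n) x := Finset.sum_le_sum hterm
      _ ≤ _ := Finset.sum_le_sum_of_subset Finset.sdiff_subset
  have hmain := hlow.trans (hW.potential_le_mul_measure_visit mf x hS hfin)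
  have hsubset : {ω | ∃ t : ℝ≥0, f (x + W t ω) ≠ 0} ⊆
      {ω | ∃ t : ℝ≥0, x + W t ω ∈ ⋃ n, Metric.ball (c n) (r n)} := by
    rintro ω ⟨t, ht⟩
    obtain ⟨n, hn, h⟩ := hfne _ ht
    refine ⟨t, Set.mem_iUnion.2 ⟨n, Metric.closedBall_subset_ball ?_ h⟩⟩
    have := hφc n ((hmem M n).1 hn).1
    rw [hr]
    simp only [hρ]
    nlinarith
  refine le_trans ?_ (measure_mono hsubset)
  have hSM0 : 0 < 1 + SM := by linarith
  have e1 : ENNReal.ofReal (a * ((1 + SM) / 2)) =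
      2 * ENNReal.ofReal (b * (1 + SM)) * ENNReal.ofReal (a / (4 * b)) := by
    rw [show (2 : ENNReal) = ENNReal.ofReal 2 by simp, ← ENNReal.ofReal_mul (by norm_num),
      ← ENNReal.ofReal_mul (by positivity)]
    congr 1
    field_simp
    norm_num
  rw [e1] at hmain
  refine (ENNReal.mul_le_mul_iff_right ?_ ?_).1 hmain
  · exact mul_ne_zero two_ne_zero (ENNReal.ofReal_pos.2 (by positivity)).ne'
  · exact ENNReal.mul_ne_top ENNReal.ofNat_ne_top ENNReal.ofReal_ne_top

end Unavoidable

end BallConfig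

/-! ### The criterion -/

theorem theorem3 {d : ℕ} (hd : 3 ≤ d)
    {Ω : Type*} [MeasurableSpace Ω] (P : Measure Ω) [IsProbabilityMeasure P]
    (B : ℝ≥0 → Ω → EuclideanSpace ℝ (Fin d)) (hB : BallConfig.IsBrownianMotion B P)
    (c : ℕ → EuclideanSpace ℝ (Fin d)) (r : ℕ → ℝ) (φ : ℝ → ℝ)
    (hreg : BallConfig.RegularlyLocated c r φ)
    (hdisj : BallConfig.NonOverlapping c r)
    (h0 : ∀ n : ℕ, (0 : EuclideanSpace ℝ (Fin d)) ∉ Metric.closedBall (c n) (r n)) :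
    BallConfig.Avoidable B P c r ↔
      IntegrableOn (fun s : ℝ => s * φ s ^ (d - 2)) (Set.Ioi 1) := by
  obtain ⟨W, hW, hWB⟩ := hB.exists_regular
  obtain ⟨ε, hε, hsep⟩ := hreg.separated
  obtain ⟨R, hR, hdense⟩ := hreg.uniformlyDense
  rw [BallConfig.avoidable_iff_of_ae_eq hWB hW]
  constructor
  · intro havoid
    by_contra hint
    obtain ⟨δ, hδ, hvisit⟩ := BallConfig.exists_le_measure_visit (P := P) (ε := min ε 1) hd
      (lt_min hε one_pos) (min_le_right _ _) hR
      (fun n m h => le_trans (by linarith [min_le_left ε 1]) (hsep n m h)) hdense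
      hreg.radius_eq hreg.radius_antitone hreg.radius_pos hint
    have hzero := hW.measure_forall_notMem_eq_zero
      (isOpen_iUnion fun n => Metric.isOpen_ball) hδ hvisit 0
    refine havoid.ne' (measure_mono_null (fun ω hω => ?_) hzero)
    rw [hW.setOf_avoidingPaths] at hω
    intro t ht
    obtain ⟨n, hn⟩ := Set.mem_iUnion.1 ht
    exact hω t n (Metric.ball_subset_closedBall hn)
  · intro hint
    -- Nothing is assumed about `φ 0`. A centre at the origin is compatible with `h0` only if its
    -- radius is negative, that is, if its ball is empty.
    have hneg : ∀ n, c n = 0 → r n < 0 := by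
      intro n hn
      have h := h0 n
      rwa [hn, Metric.mem_closedBall, dist_self, not_le] at h
    obtain ⟨δ, hδ, h⟩ := BallConfig.isSafe_of_integrableOn (P := P) hd hε hsep hreg.radius_eq
      hneg hreg.radius_antitone hreg.radius_pos hint hdisj h0
    exact h 0 (Metric.mem_ball_self hδ) W hW
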